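/- Let $M$ be a smooth $3$-manifold and let $I\subset\mathbb R$ be a nondegenerate interval. For $t\in I$ let $g_t$ be Riemannian metrics on $M$, $U_t$ vector fields with $g_t(U_t,U_t)=1$, and let $f:I\times M\to\mathbb R$ be a nowhere vanishing function, all depending smoothly on $(t,x)\in I\times M$. Let $T=T_t$ be a symmetric covariant $2$-tensor field on $M$, write $\theta=g(U,\cdot)$, $\theta\odot df=\frac12(\theta\otimes df+df\otimes\theta)$, where $df$ is the differential of $f$ along $M$, and define $\hat T$ by $g(\hat T(E),F)=T(E,F)$. Suppose that $$\frac{\partial U}{\partial t}=-f\nabla^g_UU+\mathrm{grad}_g f,\qquad \frac{\partial g}{\partial t}=-2\,\theta\odot df+2T,\qquad \hat T(U)=-\tfrac12\mathrm{grad}_gf+\tfrac12U(f)U .$$ (1) Every integral curve of the vector field $\partial_t+fU$ on $I\times M$ is, up to parametrization, a null geodesic of the space-time metric $\mathcal G=-f^2dt^2+g_t$; that is, its velocity $\dot\gamma$ satisfies $\mathcal G(\dot\gamma,\dot\gamma)=0$ and $\nabla^{\mathcal G}_{\dot\gamma}\dot\gamma=\alpha\,\dot\gamma$ for some function $\alpha$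 of the parameter. (2) Write $R(X,Y)=[\nabla_X,\nabla_Y]-\nabla_{[X,Y]}$ for the curvature, $\mathrm{Ricci}(v,w)=\mathrm{trace}\,(z\mapsto R(z,v)w)$, and $$\mathcal R=-f\,\mathrm{Ricci}^g+\mathrm{sym}\,\mathcal G\big({}^{\mathcal G}R(\partial_t,\cdot)U,\cdot\big),\qquad (\mathrm{sym}\,S)(X,Y)=\tfrac12\big(S(X,Y)+S(Y,X)\big).$$ Suppose in addition that at every point of $I\times M$, for all $Z=X-iY$ with $X,Y,U$ a $g_t$-orthonormal triple and with $\rho=g(\nabla^g_{\bar Z}U,Z)$ (tensors being extended complex-linearly), $$-\tfrac12T(Z,Z)\big(\rho-2U(\ln |f|)\big)+\tfrac1f\,Z(f)^2+\mathcal R(Z,Z)=0 .$$ Suppose that $0\in I$ and that $U_0$ is tangent to a conformal foliation on $(M,g_0)$, i.e. there is a function $a$ with $(\mathcal L_{U_0}g_0)(X,Y)=a\,g_0(X,Y)$ for all $X,Y$ orthogonal to $U_0$. Then for every $t\in I$ with $t\ge0$ the field $U_t$ is tangent to a conformal foliation, with respect to $g_t$, on the set of all $x\in M$ such that $(t,x)$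 lies on an integral curve of $\partial_t+fU$ starting from $\{0\}\times M$. If $M$ is compact, then $U_t$ is tangent to a conformal foliation on all of $(M,g_t)$ for every $t\in I$ with $t\ge 0$. -/

import Mathlib

open Set
open scoped Manifold ContDiff

noncomputable section

namespace SlicedSpacetime

/-- The model space of a 3-manifold. -/
abbrev E3 : Type := EuclideanSpace ℝ (Fin 3)

/-! ### Semi-Riemannian geometry in local coordinates

A metric in local coordinates is a function `G` from a coordinate domain `S ⊆ E` to bilinear forms.
All derivatives are taken within `S`; this is the ordinary derivative when `S` is open, and the
one-sided one at the boundary of `S = J × V` when the time interval `J` contains an endpoint. -/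

section Local

variable {E : Type*} [NormedAddCommGroup E] [NormedSpace ℝ E]

/-- Raising an index: for a nondegenerate form `B` (in finite dimension), `sharp B η` is the vector
`v` with `B v = η`. -/
def sharp (B : E →L[ℝ] E →L[ℝ] ℝ) (η : E →L[ℝ] ℝ) : E := B.inverse η

/-- The Christoffel symbols `Γ(v, w) = v^a w^b Γ^c_{ab}`, where
`Γ^c_{ab} = ½ G^{cd} (∂_a G_{bd} + ∂_b G_{ad} - ∂_d G_{ab})`. -/
def christoffel (G : E → E →L[ℝ] E →L[ℝ] ℝ) (S : Set E) (p v w : E) : E :=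
  sharp (G p) ((1 / 2 : ℝ) •
    (fderivWithin ℝ G S p v w + fderivWithin ℝ G S p w v
      - ((fderivWithin ℝ G S p).flip v).flip w))

/-- The Levi-Civita covariant derivative `∇_v Y` at the point `p`. -/
def covDeriv (G : E → E →L[ℝ] E →L[ℝ] ℝ) (S : Set E) (Y : E → E) (p v : E) : E :=
  fderivWithin ℝ Y S p v + christoffel G S p v (Y p)

/-- The curvature `R(a, b)c`, with the convention
`R(∂_a, ∂_b)∂_c = ∇_{∂_a}∇_{∂_b}∂_c - ∇_{∂_b}∇_{∂_a}∂_c`, that is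
`R^d_{abc} = ∂_a Γ^d_{bc} - ∂_b Γ^d_{ac} + Γ^e_{bc} Γ^d_{ae} - Γ^e_{ac} Γ^d_{be}`. -/
def curvature (G : E → E →L[ℝ] E →L[ℝ] ℝ) (S : Set E) (p a b c : E) : E :=
  fderivWithin ℝ (fun q => christoffel G S q b c) S p a
    - fderivWithin ℝ (fun q => christoffel G S q a c) S p b
    + christoffel G S p a (christoffel G S p b c)
    - christoffel G S p b (christoffel G S p a c)

/-- The metric `𝒢 = -f² dt² + g_t` in coordinates `(t, y)`. -/
def lorentz (f : ℝ → E → ℝ) (g : ℝ → E → E →L[ℝ] E →L[ℝ] ℝ) (p : ℝ × E) :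
    (ℝ × E) →L[ℝ] (ℝ × E) →L[ℝ] ℝ :=
  (-(f p.1 p.2) ^ 2) •
      (ContinuousLinearMap.fst ℝ ℝ E).smulRight (ContinuousLinearMap.fst ℝ ℝ E)
    + (g p.1 p.2).bilinearComp (ContinuousLinearMap.snd ℝ ℝ E) (ContinuousLinearMap.snd ℝ ℝ E)

/-- The complex-bilinear extension of a real bilinear form `B`; a pair `z` stands for the complex
vector `z.1 + i z.2`. -/
def complexify (B : E → E → ℝ) (z w : E × E) : ℂ :=
  ((B z.1 w.1 - B z.2 w.2 : ℝ) : ℂ) + Complex.I * ((B z.1 w.2 + B z.2 w.1 : ℝ) : ℂ)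

/-- The Ricci curvature `Ricci(v, w) = trace (z ↦ R(z, v)w)` of a metric in dimension three. -/
def ricci (G : E3 → E3 →L[ℝ] E3 →L[ℝ] ℝ) (S : Set E3) (p v w : E3) : ℝ :=
  ∑ i : Fin 3, curvature G S p (EuclideanSpace.single i 1) v w i

variable (J : Set ℝ) (V : Set E3) (f : ℝ → E3 → ℝ) (g : ℝ → E3 → E3 →L[ℝ] E3 →L[ℝ] ℝ)
  (U : ℝ → E3 → E3) (T : ℝ → E3 → E3 →L[ℝ] E3 →L[ℝ] ℝ)

/-- The differential at `y` of `f_t`, a function on the slice. -/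
def slicediff (t : ℝ) (y : E3) : E3 →L[ℝ] ℝ := fderivWithin ℝ (f t) V y

/-- The gradient of `f_t` with respect to `g_t`. -/
def slicegrad (t : ℝ) (y : E3) : E3 := sharp (g t y) (slicediff V f t y)

/-- The tensor `𝒢(R^𝒢(∂_t, v)U, w)` on the slices. -/
def mixedCurv (t : ℝ) (y v w : E3) : ℝ :=
  lorentz f g (t, y)
    (curvature (lorentz f g) (J ×ˢ V) (t, y) ((1 : ℝ), (0 : E3)) ((0 : ℝ), v) ((0 : ℝ), U t y))
    ((0 : ℝ), w)

/-- The tensor `ℛ = -f Ricci^g + sym 𝒢(R^𝒢(∂_t, ·)U, ·)` on the slices. -/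
def curvTensor (t : ℝ) (y v w : E3) : ℝ :=
  -(f t y) * ricci (g t) V y v w
    + (1 / 2) * (mixedCurv J V f g U t y v w + mixedCurv J V f g U t y w v)

/-- `ρ = g(∇_{Z̄} U, Z)` for `Z = X - iY`. -/
def rho (t : ℝ) (y X Y : E3) : ℂ :=
  complexify (fun v w => g t y (covDeriv (g t) V (U t) y v) w) (X, Y) (X, -Y)

/-- The quadratic expression
`-½ T(Z,Z) (ρ - 2 U(ln f)) + (1/f) Z(f)² + ℛ(Z,Z)` for `Z = X - iY`, where `U(ln f) = U(f) / f`. -/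
def quadExpr (t : ℝ) (y X Y : E3) : ℂ :=
  -(1 / 2) * complexify (fun v w => T t y v w) (X, -Y) (X, -Y) *
      (rho V g U t y X Y - 2 * ((slicediff V f t y (U t y) / f t y : ℝ) : ℂ))
    + (1 / (f t y : ℂ)) *
      ((slicediff V f t y X : ℂ) - Complex.I * (slicediff V f t y Y : ℂ)) ^ 2
    + complexify (curvTensor J V f g U t y) (X, -Y) (X, -Y)

/-- The evolution equations in a coordinate domain `V`, for `t` in the interval `J`. -/
structure EvolvesLocally : Prop where
  /-- `T` is symmetric. -/
  T_symm : ∀ t ∈ J, ∀ y ∈ V, ∀ v w, T t y v w = T t y w v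
  /-- `T̂(U) = -½ grad f + ½ U(f) U`, where `g(T̂(v), w) = T(v, w)`. -/
  T_U : ∀ t ∈ J, ∀ y ∈ V,
    sharp (g t y) (T t y (U t y)) =
      -(1 / 2 : ℝ) • slicegrad V f g t y + ((1 / 2 : ℝ) * slicediff V f t y (U t y)) • U t y
  /-- `∂U/∂t = -f ∇_U U + grad f`. -/
  evol_U : ∀ t ∈ J, ∀ y ∈ V,
    HasDerivWithinAt (fun s => U s y)
      (-(f t y) • covDeriv (g t) V (U t) y (U t y) + slicegrad V f g t y) J t
  /-- `∂g/∂t = -2 θ ⊙ df + 2T`, where `θ = g(U, ·)` and `2 θ ⊙ df = θ ⊗ df + df ⊗ θ`. -/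
  evol_g : ∀ t ∈ J, ∀ y ∈ V, ∀ v w,
    HasDerivWithinAt (fun s => g s y v w)
      (-(g t y (U t y) v * slicediff V f t y w + slicediff V f t y v * g t y (U t y) w)
        + 2 * T t y v w) J t

/-- The quadratic condition in a coordinate domain `V`: the quadratic expression vanishes for every
`Z = X - iY` such that `X, Y, U` is orthonormal. -/
def QuadLocally : Prop :=
  ∀ t ∈ J, ∀ y ∈ V, ∀ X Y : E3,
    g t y X X = 1 → g t y Y Y = 1 → g t y X Y = 0 → g t y X (U t y) = 0 → g t y Y (U t y) = 0 →
    quadExpr J V f g U T t y X Y = 0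

end Local

/-! ### Fields on a 3-manifold and their coordinate expressions -/

section Manifold

variable {M : Type*} [TopologicalSpace M] [ChartedSpace E3 M]

/-- The coordinate expression, in the chart around `x₀`, of a covariant 2-tensor field. -/
def chartTensor (B : ∀ x : M, TangentSpace (𝓡 3) x →L[ℝ] TangentSpace (𝓡 3) x →L[ℝ] ℝ)
    (x₀ : M) (y : E3) : E3 →L[ℝ] E3 →L[ℝ] ℝ :=
  let A : E3 →L[ℝ] E3 := mfderiv 𝓘(ℝ, E3) (𝓡 3) (extChartAt (𝓡 3) x₀).symm y
  let B' : E3 →L[ℝ] E3 →L[ℝ] ℝ := B ((extChartAt (𝓡 3) x₀).symm y)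
  B'.bilinearComp A A

/-- The coordinate expression, in the chart around `x₀`, of a vector field. -/
def chartVec (X : ∀ x : M, TangentSpace (𝓡 3) x) (x₀ : M) (y : E3) : E3 :=
  mfderiv (𝓡 3) 𝓘(ℝ, E3) (extChartAt (𝓡 3) x₀) ((extChartAt (𝓡 3) x₀).symm y)
    (X ((extChartAt (𝓡 3) x₀).symm y))

/-- The coordinate expression, in the chart around `x₀`, of a function. -/
def chartFun (f : M → ℝ) (x₀ : M) (y : E3) : ℝ := f ((extChartAt (𝓡 3) x₀).symm y)

variable (J : Set ℝ) (f : ℝ → M → ℝ)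
  (g : ℝ → ∀ x : M, TangentSpace (𝓡 3) x →L[ℝ] TangentSpace (𝓡 3) x →L[ℝ] ℝ)
  (U : ℝ → ∀ x : M, TangentSpace (𝓡 3) x)
  (T : ℝ → ∀ x : M, TangentSpace (𝓡 3) x →L[ℝ] TangentSpace (𝓡 3) x →L[ℝ] ℝ)

/-- For `t ∈ J`: `g_t` are Riemannian metrics, `U_t` are vector fields of unit length and `f` is a
nowhere vanishing function, all smooth on `J × M`. -/
structure IsEvolvingTriple [IsManifold (𝓡 3) ∞ M] : Prop where
  smooth_f : ContMDiffOn (𝓘(ℝ, ℝ).prod (𝓡 3)) 𝓘(ℝ, ℝ) ∞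
    (fun p : ℝ × M => f p.1 p.2) (J ×ˢ univ)
  smooth_U : ContMDiffOn (𝓘(ℝ, ℝ).prod (𝓡 3)) ((𝓡 3).prod 𝓘(ℝ, E3)) ∞
    (fun p : ℝ × M => (⟨p.2, U p.1 p.2⟩ : TangentBundle (𝓡 3) M)) (J ×ˢ univ)
  smooth_g : ContMDiffOn (𝓘(ℝ, ℝ).prod (𝓡 3)) ((𝓡 3).prod 𝓘(ℝ, E3 →L[ℝ] E3 →L[ℝ] ℝ)) ∞
    (fun p : ℝ × M => Bundle.TotalSpace.mk' (E3 →L[ℝ] E3 →L[ℝ] ℝ)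
      (E := fun x : M => TangentSpace (𝓡 3) x →L[ℝ] TangentSpace (𝓡 3) x →L[ℝ] ℝ)
      p.2 (g p.1 p.2)) (J ×ˢ univ)
  symm : ∀ t ∈ J, ∀ x v w, g t x v w = g t x w v
  pos : ∀ t ∈ J, ∀ x v, v ≠ 0 → 0 < g t x v v
  unit : ∀ t ∈ J, ∀ x, g t x (U t x) (U t x) = 1
  f_ne : ∀ t ∈ J, ∀ x, f t x ≠ 0

/-- The evolution equations hold in every chart. -/
def Evolves : Prop :=
  ∀ x₀ : M, EvolvesLocally J (extChartAt (𝓡 3) x₀).target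
    (fun t => chartFun (f t) x₀) (fun t => chartTensor (g t) x₀)
    (fun t => chartVec (U t) x₀) (fun t => chartTensor (T t) x₀)

/-- The quadratic condition holds in every chart. -/
def QuadCondition : Prop :=
  ∀ x₀ : M, QuadLocally J (extChartAt (𝓡 3) x₀).target
    (fun t => chartFun (f t) x₀) (fun t => chartTensor (g t) x₀)
    (fun t => chartVec (U t) x₀) (fun t => chartTensor (T t) x₀)

/-- The vector field `∂_t + fU` on `ℝ × M`. -/
def nullField (p : ℝ × M) : TangentSpace (𝓘(ℝ, ℝ).prod (𝓡 3)) p :=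
  ((1 : ℝ), (f p.1 p.2 • U p.1 p.2 : TangentSpace (𝓡 3) p.2))

/-- The regular curve `γ`, with parameter in the interval `s`, is a null geodesic of
`𝒢 = -f² dt² + g_t` in `J × M`, up to parametrization: `γ' ≠ 0`, `𝒢(γ', γ') = 0` and
`∇_{γ'} γ' = α γ'` for a function `α` of the parameter. The equations are written for the coordinate
expression `c` of `γ` in the chart `(t, x) ↦ (t, y)` of `ℝ × M`, for every chart of `M`. -/
def IsNullGeodesicOn (γ : ℝ → ℝ × M) (s : Set ℝ) : Prop :=
  ∃ α : ℝ → ℝ, ContinuousOn α s ∧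
    ∀ x₀ : M, ∀ τ ∈ s, (γ τ).2 ∈ (extChartAt (𝓡 3) x₀).source →
      let c : ℝ → ℝ × E3 := fun r => ((γ r).1, extChartAt (𝓡 3) x₀ (γ r).2)
      let c' : ℝ → ℝ × E3 := derivWithin c s
      let G := lorentz (fun t => chartFun (f t) x₀) (fun t => chartTensor (g t) x₀)
      ContDiffWithinAt ℝ 2 c s τ ∧ c' τ ≠ 0 ∧ G (c τ) (c' τ) (c' τ) = 0 ∧
        derivWithin c' s τ
            + christoffel G (J ×ˢ (extChartAt (𝓡 3) x₀).target) (c τ) (c' τ) (c' τ)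
          = α τ • c' τ

/-- The points `x` such that `(t, x)` lies on an integral curve of `∂_t + fU` which starts from the
slice `{0} × M`. -/
def reachedAt (t : ℝ) : Set M :=
  {x | ∃ γ : ℝ → ℝ × M, IsMIntegralCurveOn (I := 𝓘(ℝ, ℝ).prod (𝓡 3)) γ (nullField f U) (Icc 0 t) ∧
    (γ 0).1 = 0 ∧ γ t = (t, x)}

end Manifold

/-! ### Conformal foliations -/

section Conformal

variable {M : Type*} [TopologicalSpace M] [ChartedSpace E3 M]
  (g : ∀ x : M, TangentSpace (𝓡 3) x →L[ℝ] TangentSpace (𝓡 3) x →L[ℝ] ℝ)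
  (U : ∀ x : M, TangentSpace (𝓡 3) x)

/-- The Lie derivative `(ℒ_U g)(X, Y) = U(g(X, Y)) - g([U, X], Y) - g(X, [U, Y])`. -/
def lieDerivMetric (X Y : ∀ x : M, TangentSpace (𝓡 3) x) (x : M) : ℝ :=
  mvfderiv (𝓡 3) (fun z => g z (X z) (Y z)) x (U x)
    - g x (VectorField.mlieBracket (𝓡 3) U X x) (Y x)
    - g x (X x) (VectorField.mlieBracket (𝓡 3) U Y x)

/-- On the set `A`, the (nowhere vanishing) field `U` is tangent to a conformal foliation: there is a
function `a` with `(ℒ_U g)(X, Y) = a g(X, Y)` for `X`, `Y` orthogonal to `U`. -/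
def IsTangentToConformalFoliationOn [IsManifold (𝓡 3) ∞ M] (A : Set M) : Prop :=
  ∃ a : M → ℝ, ∀ x ∈ A, ∀ X Y : ∀ x : M, TangentSpace (𝓡 3) x,
    MDifferentiableAt (𝓡 3) ((𝓡 3).prod 𝓘(ℝ, E3))
      (fun z => (⟨z, X z⟩ : TangentBundle (𝓡 3) M)) x →
    MDifferentiableAt (𝓡 3) ((𝓡 3).prod 𝓘(ℝ, E3))
      (fun z => (⟨z, Y z⟩ : TangentBundle (𝓡 3) M)) x →
    g x (U x) (X x) = 0 → g x (U x) (Y x) = 0 →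
    lieDerivMetric g U X Y x = a x * g x (X x) (Y x)

end Conformal

end SlicedSpacetime

end

open SlicedSpacetime

/-!
In a chart, the evolution equations of `U` and `g` make `∂_t + fU` a null field whose covariant
derivative along itself is a multiple of itself; this is part (1). For part (2), let `W` be the
squared shear of `U_t`, that is, the squared norm of the part of `ℒ_U g` on the plane orthogonal to
`U` which is trace-free with respect to `g`, so that `U_t` is tangent to a conformal foliation
exactly where `W` vanishes. The derivative of `ℒ_U g` along `∂_t + fU` is a curvature term of the
space-time plus terms which are linear in the shear, and the quadratic condition cancels everything
else. Hence `W` satisfies, locally, a differential inequality `(∂_t + fU) W ≤ C W`. As `W ≥ 0` is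
zero for `t = 0`, Grönwall's inequality makes it vanish along integral curves starting from the
initial slice; if `M` is compact, the maximum principle makes it vanish everywhere.
-/

open Set
open scoped Manifold ContDiff

noncomputable section

set_option maxSynthPendingDepth 3

namespace SlicedSpacetime

section Calculus

variable {𝕜 : Type*} [NontriviallyNormedField 𝕜]
  {D : Type*} [NormedAddCommGroup D] [NormedSpace 𝕜 D]
  {E : Type*} [NormedAddCommGroup E] [NormedSpace 𝕜 E]
  {F : Type*} [NormedAddCommGroup F] [NormedSpace 𝕜 F]
  {G : Type*} [NormedAddCommGroup G] [NormedSpace 𝕜 G] {S : Set D} {p : D}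

theorem fderivWithin_clm_apply_apply (hS : UniqueDiffWithinAt 𝕜 S p) {H : D → E →L[𝕜] F}
    {A : D → E} (hH : DifferentiableWithinAt 𝕜 H S p) (hA : DifferentiableWithinAt 𝕜 A S p)
    (x : D) : fderivWithin 𝕜 (fun q => H q (A q)) S p x =
      fderivWithin 𝕜 H S p x (A p) + H p (fderivWithin 𝕜 A S p x) := by
  rw [fderivWithin_clm_apply hS hH hA]
  simp [add_comm]

theorem fderivWithin_clm_apply₂_apply (hS : UniqueDiffWithinAt 𝕜 S p) {B : D → E →L[𝕜] F →L[𝕜] G}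
    {A : D → E} {C : D → F} (hB : DifferentiableWithinAt 𝕜 B S p)
    (hA : DifferentiableWithinAt 𝕜 A S p) (hC : DifferentiableWithinAt 𝕜 C S p) (x : D) :
    fderivWithin 𝕜 (fun q => B q (A q) (C q)) S p x =
      fderivWithin 𝕜 B S p x (A p) (C p) + B p (fderivWithin 𝕜 A S p x) (C p)
        + B p (A p) (fderivWithin 𝕜 C S p x) := by
  rw [fderivWithin_clm_apply_apply hS (hB.clm_apply hA) hC, fderivWithin_clm_apply_apply hS hB hA,
    add_apply]

theorem fderivWithin_clm_apply_const_apply (hS : UniqueDiffWithinAt 𝕜 S p) {H : D → E →L[𝕜] F}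
    (hH : DifferentiableWithinAt 𝕜 H S p) (v : E) (x : D) :
    fderivWithin 𝕜 (fun q => H q v) S p x = fderivWithin 𝕜 H S p x v := by
  rw [fderivWithin_clm_apply_apply hS hH (differentiableWithinAt_const v)]
  simp

theorem fderivWithin_clm_apply₂_const_apply (hS : UniqueDiffWithinAt 𝕜 S p)
    {B : D → E →L[𝕜] F →L[𝕜] G} (hB : DifferentiableWithinAt 𝕜 B S p) (v : E) (w : F) (x : D) :
    fderivWithin 𝕜 (fun q => B q v w) S p x = fderivWithin 𝕜 B S p x v w := by
  rw [fderivWithin_clm_apply_const_apply hS (hB.clm_apply (differentiableWithinAt_const v)),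
    fderivWithin_clm_apply_const_apply hS hB]

end Calculus

theorem isInvertible_of_nondegenerate {𝕜 : Type*} [NontriviallyNormedField 𝕜] [CompleteSpace 𝕜]
    {E : Type*} [NormedAddCommGroup E] [NormedSpace 𝕜 E] [FiniteDimensional 𝕜 E]
    {B : E →L[𝕜] E →L[𝕜] 𝕜} (h : ∀ v, (∀ w, B v w = 0) → v = 0) : B.IsInvertible := by
  have injective : Function.Injective (B : E →ₗ[𝕜] E →L[𝕜] 𝕜) :=
    (injective_iff_map_eq_zero _).2 fun v hv => h v fun w => congrArg (fun η => η w) hv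
  have finrank_dual : Module.finrank 𝕜 E = Module.finrank 𝕜 (E →L[𝕜] 𝕜) := by
    rw [← (LinearMap.toContinuousLinearMap (𝕜 := 𝕜) (E := E) (F' := 𝕜)).finrank_eq]
    exact Subspace.dual_finrank_eq.symm
  exact ⟨(LinearMap.linearEquivOfInjective (B : E →ₗ[𝕜] E →L[𝕜] 𝕜) injective
    finrank_dual).toContinuousLinearEquiv, by ext; simp⟩

variable {E : Type*} [NormedAddCommGroup E] [NormedSpace ℝ E]

theorem isInvertible_of_pos [FiniteDimensional ℝ E] {B : E →L[ℝ] E →L[ℝ] ℝ}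
    (h : ∀ v, v ≠ 0 → 0 < B v v) : B.IsInvertible :=
  isInvertible_of_nondegenerate fun v hv => by_contra fun hne => (h v hne).ne' (hv v)

section SpaceAndTime

variable {F : Type*} [NormedAddCommGroup F] [NormedSpace ℝ F] {Q : ℝ × E → F} {S : Set (ℝ × E)}
  {J : Set ℝ} {V : Set E} {t : ℝ} {y : E}

/-- The partial derivative, within `S`, along the space factor of `ℝ × E`. -/
def spatialDeriv (Q : ℝ × E → F) (S : Set (ℝ × E)) (q : ℝ × E) : E →L[ℝ] F :=
  (fderivWithin ℝ Q S q).comp (ContinuousLinearMap.inr ℝ ℝ E)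

/-- The partial derivative, within `S`, along the time factor of `ℝ × E`. -/
def timeDeriv (Q : ℝ × E → F) (S : Set (ℝ × E)) (q : ℝ × E) : F :=
  fderivWithin ℝ Q S q (1, 0)

theorem spatialDeriv_apply (Q : ℝ × E → F) (S : Set (ℝ × E)) (q : ℝ × E) (v : E) :
    spatialDeriv Q S q v = fderivWithin ℝ Q S q (0, v) := by
  simp [spatialDeriv]

theorem fderivWithin_eq_time_add_spatial (Q : ℝ × E → F) (S : Set (ℝ × E)) (q : ℝ × E) (a : ℝ)
    (v : E) : fderivWithin ℝ Q S q (a, v) = a • timeDeriv Q S q + spatialDeriv Q S q v := by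
  rw [spatialDeriv_apply, timeDeriv, ← map_smul, ← map_add]
  simp

theorem fderivWithin_slice (hV : UniqueDiffWithinAt ℝ V y) (ht : t ∈ J)
    (hQ : DifferentiableWithinAt ℝ Q (J ×ˢ V) (t, y)) :
    fderivWithin ℝ (fun z => Q (t, z)) V y = spatialDeriv Q (J ×ˢ V) (t, y) :=
  (hQ.hasFDerivWithinAt.comp y (hasFDerivAt_prodMk_right t y).hasFDerivWithinAt
    fun _ hz => ⟨ht, hz⟩).fderivWithin hV

theorem hasDerivWithinAt_time (hy : y ∈ V) (hQ : DifferentiableWithinAt ℝ Q (J ×ˢ V) (t, y)) :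
    HasDerivWithinAt (fun s => Q (s, y)) (timeDeriv Q (J ×ˢ V) (t, y)) J t :=
  HasFDerivWithinAt.comp_hasDerivWithinAt (t := J ×ˢ V) t hQ.hasFDerivWithinAt
    ((hasDerivWithinAt_id t J).prodMk (hasDerivWithinAt_const t J y)) fun _ hs => ⟨hs, hy⟩

theorem contDiffOn_spatialDeriv {m n : WithTop ℕ∞} (hS : UniqueDiffOn ℝ S)
    (hQ : ContDiffOn ℝ n Q S) (hmn : m + 1 ≤ n) : ContDiffOn ℝ m (spatialDeriv Q S) S :=
  (hQ.fderivWithin hS hmn).clm_comp contDiffOn_const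

theorem contDiffOn_timeDeriv {m n : WithTop ℕ∞} (hS : UniqueDiffOn ℝ S)
    (hQ : ContDiffOn ℝ n Q S) (hmn : m + 1 ≤ n) : ContDiffOn ℝ m (timeDeriv Q S) S :=
  (hQ.fderivWithin hS hmn).clm_apply contDiffOn_const

theorem fderivWithin_timeDeriv {q : ℝ × E} (hS : UniqueDiffWithinAt ℝ S q)
    (hQ : DifferentiableWithinAt ℝ (fderivWithin ℝ Q S) S q) (x : ℝ × E) :
    fderivWithin ℝ (timeDeriv Q S) S q x =
      fderivWithin ℝ (fderivWithin ℝ Q S) S q x (1, 0) :=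
  fderivWithin_clm_apply_const_apply hS hQ _ x

end SpaceAndTime

/-! ### The geometry of the slices -/

section SliceGeometry

variable (g : ℝ × E → E →L[ℝ] E →L[ℝ] ℝ) (S : Set (ℝ × E))

/-- The Christoffel symbols of the slice metrics `g_t`, as a field on `S ⊆ ℝ × E`. -/
def sliceChristoffel (q : ℝ × E) : E →L[ℝ] E →L[ℝ] E :=
  (ContinuousLinearMap.compL ℝ E (E →L[ℝ] ℝ) E (g q).inverse).comp
    ((1 / 2 : ℝ) • (spatialDeriv g S q + (spatialDeriv g S q).flip
      - ((ContinuousLinearMap.flipₗᵢ ℝ E E ℝ).toContinuousLinearEquiv :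
          (E →L[ℝ] E →L[ℝ] ℝ) →L[ℝ] (E →L[ℝ] E →L[ℝ] ℝ)).comp (spatialDeriv g S q).flip))

/-- The covariant derivative `v ↦ ∇_v A` along the slices. -/
def sliceNabla (A : ℝ × E → E) (q : ℝ × E) : E →L[ℝ] E :=
  spatialDeriv A S q + (sliceChristoffel g S q).flip (A q)

/-- The bilinear form `(v, w) ↦ g(∇_v A, w)` on the slices. -/
def nablaForm (A : ℝ × E → E) (q : ℝ × E) : E →L[ℝ] E →L[ℝ] ℝ :=
  (g q).comp (sliceNabla g S A q)

/-- The gradient of a function along the slices. -/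
def sliceGradient (f : ℝ × E → ℝ) (q : ℝ × E) : E :=
  (g q).inverse (spatialDeriv f S q)

/-- The endomorphism associated by `g_t` with the bilinear form `∂g/∂t`. -/
def metricRate (q : ℝ × E) : E →L[ℝ] E :=
  (g q).inverse.comp (timeDeriv g S q)

/-- The curvature `R(a, b)c` of the slice metrics. -/
def sliceCurvature (q : ℝ × E) (a b c : E) : E :=
  fderivWithin ℝ (sliceChristoffel g S) S q (0, a) b c
    - fderivWithin ℝ (sliceChristoffel g S) S q (0, b) a c
    + sliceChristoffel g S q a (sliceChristoffel g S q b c)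
    - sliceChristoffel g S q b (sliceChristoffel g S q a c)

/-- The fields `g_t` are Riemannian metrics, depending smoothly on the point of `S ⊆ ℝ × E`. The
conditions on `S` hold for the product of a nondegenerate interval and an open set. -/
structure IsSliceMetric : Prop where
  uniqueDiffOn : UniqueDiffOn ℝ S
  subset_closure_interior : S ⊆ closure (interior S)
  contDiffOn_metric : ContDiffOn ℝ ∞ g S
  symm : ∀ p ∈ S, ∀ v w, g p v w = g p w v
  pos : ∀ p ∈ S, ∀ v, v ≠ 0 → 0 < g p v v

variable {g S}

theorem sliceNabla_apply (A : ℝ × E → E) (q : ℝ × E) (v : E) :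
    sliceNabla g S A q v = spatialDeriv A S q v + sliceChristoffel g S q v (A q) := by
  simp [sliceNabla]

theorem nablaForm_apply (A : ℝ × E → E) (q : ℝ × E) (v w : E) :
    nablaForm g S A q v w = g q (sliceNabla g S A q v) w := by
  simp [nablaForm]

theorem sliceChristoffel_apply (q : ℝ × E) (v w : E) :
    sliceChristoffel g S q v w = (g q).inverse ((1 / 2 : ℝ) •
      (spatialDeriv g S q v w + spatialDeriv g S q w v
        - ((spatialDeriv g S q).flip v).flip w)) := by
  simp [sliceChristoffel]

end SliceGeometry

namespace IsSliceMetric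

variable {g : ℝ × E → E →L[ℝ] E →L[ℝ] ℝ} {S : Set (ℝ × E)} {p : ℝ × E}

section Derivatives

variable (hg : IsSliceMetric g S)
include hg

theorem differentiableWithinAt_metric (hp : p ∈ S) : DifferentiableWithinAt ℝ g S p :=
  hg.contDiffOn_metric.differentiableOn (by simp) p hp

theorem differentiableWithinAt_fderivWithin {F : Type*} [NormedAddCommGroup F] [NormedSpace ℝ F]
    {Q : ℝ × E → F} (hQ : ContDiffOn ℝ ∞ Q S) (hp : p ∈ S) :
    DifferentiableWithinAt ℝ (fderivWithin ℝ Q S) S p :=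
  (hQ.fderivWithin (m := ∞) hg.uniqueDiffOn (by simp)).differentiableOn (by simp) p hp

theorem fderivWithin_fderivWithin_comm {F : Type*} [NormedAddCommGroup F] [NormedSpace ℝ F]
    {Q : ℝ × E → F} (hQ : ContDiffOn ℝ ∞ Q S) (hp : p ∈ S) (x z : ℝ × E) :
    fderivWithin ℝ (fderivWithin ℝ Q S) S p x z = fderivWithin ℝ (fderivWithin ℝ Q S) S p z x :=
  (hQ p hp).isSymmSndFDerivWithinAt (n := ∞) (by simpa using ENat.LEInfty.out) hg.uniqueDiffOn
    (hg.subset_closure_interior hp) hp x z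

theorem fderivWithin_metric_symm (hp : p ∈ S) (x : ℝ × E) (v w : E) :
    fderivWithin ℝ g S p x v w = fderivWithin ℝ g S p x w v := by
  have hu := hg.uniqueDiffOn p hp
  have hd := hg.differentiableWithinAt_metric hp
  rw [← fderivWithin_clm_apply₂_const_apply hu hd, ← fderivWithin_clm_apply₂_const_apply hu hd,
    fderivWithin_congr (fun q hq => hg.symm q hq v w) (hg.symm p hp v w)]

theorem timeDeriv_metric_symm (hp : p ∈ S) (v w : E) :
    timeDeriv g S p v w = timeDeriv g S p w v :=
  hg.fderivWithin_metric_symm hp _ v w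

theorem spatialDeriv_metric_symm (hp : p ∈ S) (x v w : E) :
    spatialDeriv g S p x v w = spatialDeriv g S p x w v := by
  simpa only [spatialDeriv_apply] using hg.fderivWithin_metric_symm hp _ v w

end Derivatives

variable [FiniteDimensional ℝ E] (hg : IsSliceMetric g S)
include hg

theorem isInvertible (hp : p ∈ S) : (g p).IsInvertible := isInvertible_of_pos (hg.pos p hp)

theorem metric_inverse (hp : p ∈ S) (η : E →L[ℝ] ℝ) : g p ((g p).inverse η) = η :=
  (hg.isInvertible hp).self_apply_inverse η

theorem ext_metric (hp : p ∈ S) {v w : E} (hvw : ∀ z, g p v z = g p w z) : v = w :=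
  (hg.isInvertible hp).injective (ContinuousLinearMap.ext hvw)

theorem contDiffOn_inverse : ContDiffOn ℝ ∞ (fun q => (g q).inverse) S := by
  have : CompleteSpace E := FiniteDimensional.complete ℝ E
  exact fun p hp => (hg.isInvertible hp).contDiffAt_map_inverse.comp_contDiffWithinAt p
    (hg.contDiffOn_metric p hp)

theorem contDiffOn_sliceChristoffel : ContDiffOn ℝ ∞ (sliceChristoffel g S) S := by
  have smooth_deriv : ContDiffOn ℝ ∞ (spatialDeriv g S) S :=
    contDiffOn_spatialDeriv hg.uniqueDiffOn hg.contDiffOn_metric (by simp)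
  have smooth_flip : ContDiffOn ℝ ∞ (fun q => (spatialDeriv g S q).flip) S :=
    (ContinuousLinearMap.flipₗᵢ ℝ E E (E →L[ℝ] ℝ)).contDiff.comp_contDiffOn smooth_deriv
  exact ((ContinuousLinearMap.contDiff _).comp_contDiffOn hg.contDiffOn_inverse).clm_comp
    (((smooth_deriv.add smooth_flip).sub (contDiffOn_const.clm_comp smooth_flip)).const_smul
      (1 / 2 : ℝ))

theorem contDiffOn_sliceNabla {A : ℝ × E → E} (hA : ContDiffOn ℝ ∞ A S) :
    ContDiffOn ℝ ∞ (sliceNabla g S A) S :=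
  (contDiffOn_spatialDeriv hg.uniqueDiffOn hA (by simp)).add
    (((ContinuousLinearMap.flipₗᵢ ℝ E E E).contDiff.comp_contDiffOn
      hg.contDiffOn_sliceChristoffel).clm_apply hA)

theorem contDiffOn_sliceGradient {f : ℝ × E → ℝ} (hf : ContDiffOn ℝ ∞ f S) :
    ContDiffOn ℝ ∞ (sliceGradient g S f) S :=
  hg.contDiffOn_inverse.clm_apply (contDiffOn_spatialDeriv hg.uniqueDiffOn hf (by simp))

theorem contDiffOn_metricRate : ContDiffOn ℝ ∞ (metricRate g S) S :=
  hg.contDiffOn_inverse.clm_comp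
    (contDiffOn_timeDeriv hg.uniqueDiffOn hg.contDiffOn_metric (by simp))

theorem differentiableWithinAt_sliceChristoffel (hp : p ∈ S) :
    DifferentiableWithinAt ℝ (sliceChristoffel g S) S p :=
  hg.contDiffOn_sliceChristoffel.differentiableOn (by simp) p hp

theorem metric_sliceGradient (hp : p ∈ S) (f : ℝ × E → ℝ) (w : E) :
    g p (sliceGradient g S f p) w = spatialDeriv f S p w := by
  rw [sliceGradient, hg.metric_inverse hp]

theorem metric_metricRate (hp : p ∈ S) (v w : E) :
    g p (metricRate g S p v) w = timeDeriv g S p v w := by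
  rw [metricRate, ContinuousLinearMap.comp_apply, hg.metric_inverse hp]

theorem metric_sliceChristoffel (hp : p ∈ S) (v w z : E) :
    g p (sliceChristoffel g S p v w) z = (1 / 2) * (spatialDeriv g S p v w z
      + spatialDeriv g S p w v z - spatialDeriv g S p z v w) := by
  rw [sliceChristoffel_apply, hg.metric_inverse hp]
  simp

theorem sliceChristoffel_symm (hp : p ∈ S) (v w : E) :
    sliceChristoffel g S p v w = sliceChristoffel g S p w v := by
  refine hg.ext_metric hp fun z => ?_
  rw [hg.metric_sliceChristoffel hp, hg.metric_sliceChristoffel hp,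
    hg.spatialDeriv_metric_symm hp z v w]
  ring

theorem spatialDeriv_metric (hp : p ∈ S) (v w z : E) :
    spatialDeriv g S p v w z = g p (sliceChristoffel g S p v w) z
      + g p (sliceChristoffel g S p v z) w := by
  rw [hg.metric_sliceChristoffel hp, hg.metric_sliceChristoffel hp,
    hg.spatialDeriv_metric_symm hp z v w, hg.spatialDeriv_metric_symm hp v z w]
  ring

theorem fderivWithin_metric_sliceChristoffel (hp : p ∈ S) (a b c d : E) :
    fderivWithin ℝ (fun q => g q (sliceChristoffel g S q b c) d) S p (0, a) =
      g p (fderivWithin ℝ (sliceChristoffel g S) S p (0, a) b c) d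
        + g p (sliceChristoffel g S p a (sliceChristoffel g S p b c)) d
        + g p (sliceChristoffel g S p a d) (sliceChristoffel g S p b c) := by
  have hu := hg.uniqueDiffOn p hp
  have hΓ := hg.differentiableWithinAt_sliceChristoffel hp
  rw [fderivWithin_clm_apply_const_apply hu ((hg.differentiableWithinAt_metric hp).clm_apply
      ((hΓ.clm_apply (differentiableWithinAt_const b)).clm_apply (differentiableWithinAt_const c))),
    fderivWithin_clm_apply_apply hu (hg.differentiableWithinAt_metric hp)
      ((hΓ.clm_apply (differentiableWithinAt_const b)).clm_apply (differentiableWithinAt_const c)),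
    fderivWithin_clm_apply₂_const_apply hu hΓ, add_apply, ← spatialDeriv_apply g,
    hg.spatialDeriv_metric hp]
  ring

theorem fderivWithin_fderivWithin_metric (hp : p ∈ S) (x : ℝ × E) (b c d : E) :
    fderivWithin ℝ (fderivWithin ℝ g S) S p x (0, b) c d =
      fderivWithin ℝ (fun q => g q (sliceChristoffel g S q b c) d) S p x
        + fderivWithin ℝ (fun q => g q (sliceChristoffel g S q b d) c) S p x := by
  have hu := hg.uniqueDiffOn p hp
  have hd := hg.differentiableWithinAt_fderivWithin hg.contDiffOn_metric hp
  have differentiable_metric_christoffel (c d : E) :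
      DifferentiableWithinAt ℝ (fun q => g q (sliceChristoffel g S q b c) d) S p :=
    ((hg.differentiableWithinAt_metric hp).clm_apply
      (((hg.differentiableWithinAt_sliceChristoffel hp).clm_apply
        (differentiableWithinAt_const b)).clm_apply (differentiableWithinAt_const c))).clm_apply
      (differentiableWithinAt_const d)
  have compatible : EqOn (fun q => fderivWithin ℝ g S q (0, b) c d)
      (fun q => g q (sliceChristoffel g S q b c) d + g q (sliceChristoffel g S q b d) c) S :=
    fun q hq => by
      simpa only [spatialDeriv_apply] using hg.spatialDeriv_metric hq b c d
  rw [← fderivWithin_clm_apply_const_apply hu hd,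
    ← fderivWithin_clm_apply₂_const_apply hu (hd.clm_apply (differentiableWithinAt_const _)),
    fderivWithin_congr compatible (compatible hp), fderivWithin_fun_add hu
      (differentiable_metric_christoffel c d) (differentiable_metric_christoffel d c), add_apply]

theorem metric_sliceCurvature_skew (hp : p ∈ S) (a b c d : E) :
    g p (sliceCurvature g S p a b c) d = -g p (sliceCurvature g S p a b d) c := by
  have second_deriv_comm : fderivWithin ℝ (fderivWithin ℝ g S) S p (0, a) (0, b) c d =
      fderivWithin ℝ (fderivWithin ℝ g S) S p (0, b) (0, a) c d := by
    rw [hg.fderivWithin_fderivWithin_comm hg.contDiffOn_metric hp]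
  simp only [hg.fderivWithin_fderivWithin_metric hp, hg.fderivWithin_metric_sliceChristoffel hp,
    hg.symm p hp (sliceChristoffel g S p a c) (sliceChristoffel g S p b d),
    hg.symm p hp (sliceChristoffel g S p a d) (sliceChristoffel g S p b c)] at second_deriv_comm
  simp only [sliceCurvature, map_add, map_sub, add_apply, sub_apply]
  linarith

theorem fderivWithin_sliceNabla_apply (hp : p ∈ S) {A : ℝ × E → E} (hA : ContDiffOn ℝ ∞ A S)
    (x : ℝ × E) (v : E) :
    fderivWithin ℝ (sliceNabla g S A) S p x v =
      fderivWithin ℝ (fderivWithin ℝ A S) S p x (0, v)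
        + fderivWithin ℝ (sliceChristoffel g S) S p x v (A p)
        + sliceChristoffel g S p v (fderivWithin ℝ A S p x) := by
  have hu := hg.uniqueDiffOn p hp
  have hΓ := (hg.differentiableWithinAt_sliceChristoffel hp).clm_apply
    (differentiableWithinAt_const v)
  have hA' := hA.differentiableOn (by simp) p hp
  have hdA := hg.differentiableWithinAt_fderivWithin hA hp
  rw [← fderivWithin_clm_apply_const_apply hu
    ((hg.contDiffOn_sliceNabla hA).differentiableOn (by simp) p hp)]
  simp only [sliceNabla_apply, spatialDeriv_apply]
  rw [fderivWithin_fun_add hu (hdA.clm_apply (differentiableWithinAt_const _)) (hΓ.clm_apply hA'),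
    add_apply, fderivWithin_clm_apply_const_apply hu hdA, fderivWithin_clm_apply_apply hu hΓ hA',
    fderivWithin_clm_apply_const_apply hu (hg.differentiableWithinAt_sliceChristoffel hp),
    add_assoc]

theorem fderivWithin_sliceNabla_self (hp : p ∈ S) {A : ℝ × E → E} (hA : ContDiffOn ℝ ∞ A S)
    (v : E) :
    fderivWithin ℝ (sliceNabla g S A) S p (0, A p) v =
      sliceCurvature g S p (A p) v (A p)
        + fderivWithin ℝ (fun q => sliceNabla g S A q (A q)) S p (0, v)
        + sliceChristoffel g S p v (sliceNabla g S A p (A p))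
        - sliceChristoffel g S p (A p) (sliceNabla g S A p v)
        - sliceNabla g S A p (spatialDeriv A S p v) := by
  rw [fderivWithin_clm_apply_apply (hg.uniqueDiffOn p hp)
      ((hg.contDiffOn_sliceNabla hA).differentiableOn (by simp) p hp)
      (hA.differentiableOn (by simp) p hp),
    hg.fderivWithin_sliceNabla_apply hp hA, hg.fderivWithin_sliceNabla_apply hp hA,
    hg.fderivWithin_fderivWithin_comm hA hp, ← spatialDeriv_apply A, ← spatialDeriv_apply A]
  simp only [sliceNabla_apply, sliceCurvature, map_add]
  rw [hg.sliceChristoffel_symm hp (spatialDeriv A S p v)]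
  abel

end IsSliceMetric

variable {E : Type*} [NormedAddCommGroup E] [NormedSpace ℝ E]

/-! ### The space-time metric -/

/-- The metric `-f² dt² + g_t` of a pair of fields on `ℝ × E`: the uncurried form of `lorentz`. -/
abbrev lorentzMetric (f : ℝ × E → ℝ) (g : ℝ × E → E →L[ℝ] E →L[ℝ] ℝ) :
    ℝ × E → (ℝ × E) →L[ℝ] (ℝ × E) →L[ℝ] ℝ :=
  lorentz (fun t y => f (t, y)) (fun t y => g (t, y))

theorem lorentzMetric_apply (f : ℝ × E → ℝ) (g : ℝ × E → E →L[ℝ] E →L[ℝ] ℝ) (q u v : ℝ × E) :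
    lorentzMetric f g q u v = -(f q) ^ 2 * (u.1 * v.1) + g q u.2 v.2 := by
  simp [lorentz]

/-- The slice metrics `g_t` and the nowhere vanishing lapse function `f` define the space-time
metric `-f² dt² + g_t` on `S ⊆ ℝ × E`. -/
structure IsSlicedSpacetime (f : ℝ × E → ℝ) (g : ℝ × E → E →L[ℝ] E →L[ℝ] ℝ) (S : Set (ℝ × E)) :
    Prop extends IsSliceMetric g S where
  contDiffOn_lapse : ContDiffOn ℝ ∞ f S
  lapse_ne_zero : ∀ p ∈ S, f p ≠ 0

namespace IsSlicedSpacetime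

variable {f : ℝ × E → ℝ} {g : ℝ × E → E →L[ℝ] E →L[ℝ] ℝ} {S : Set (ℝ × E)} {p : ℝ × E}

section Derivatives

variable (h : IsSlicedSpacetime f g S)
include h

theorem differentiableWithinAt_lapse (hp : p ∈ S) : DifferentiableWithinAt ℝ f S p :=
  h.contDiffOn_lapse.differentiableOn (by simp) p hp

end Derivatives

variable [FiniteDimensional ℝ E] (h : IsSlicedSpacetime f g S)
include h

theorem contDiffOn_lorentzMetric : ContDiffOn ℝ ∞ (lorentzMetric f g) S := by
  refine contDiffOn_clm_apply.2 fun u => contDiffOn_clm_apply.2 fun v => ?_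
  simp only [lorentzMetric_apply]
  exact ((h.contDiffOn_lapse.pow 2).neg.mul contDiffOn_const).add
    ((h.contDiffOn_metric.clm_apply contDiffOn_const).clm_apply contDiffOn_const)

theorem isInvertible_lorentzMetric (hp : p ∈ S) : (lorentzMetric f g p).IsInvertible := by
  refine isInvertible_of_nondegenerate fun u hu => ?_
  have time_zero : u.1 = 0 := by
    simpa [lorentzMetric_apply, h.lapse_ne_zero p hp] using hu (1, 0)
  have space_zero : u.2 = 0 := by
    have orthogonal : g p u.2 u.2 = 0 := by simpa [lorentzMetric_apply] using hu (0, u.2)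
    exact by_contra fun hne => (h.pos p hp _ hne).ne' orthogonal
  exact Prod.ext time_zero space_zero

theorem fderivWithin_lorentzMetric (hp : p ∈ S) (x u v : ℝ × E) :
    fderivWithin ℝ (lorentzMetric f g) S p x u v =
      -(2 * f p * fderivWithin ℝ f S p x) * (u.1 * v.1) + fderivWithin ℝ g S p x u.2 v.2 := by
  have hu := h.uniqueDiffOn p hp
  have hf := h.differentiableWithinAt_lapse hp
  have hg := h.differentiableWithinAt_metric hp
  have lapse_part := (hf.hasFDerivWithinAt.pow 2).neg.mul_const (u.1 * v.1)
  have metric_part := ((hg.clm_apply (differentiableWithinAt_const u.2)).clm_apply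
    (differentiableWithinAt_const v.2)).hasFDerivWithinAt
  rw [← fderivWithin_clm_apply₂_const_apply hu
      (h.contDiffOn_lorentzMetric.differentiableOn (by simp) p hp),
    ← fderivWithin_clm_apply₂_const_apply hu hg]
  simp only [lorentzMetric_apply]
  refine (DFunLike.congr_fun ((lapse_part.add metric_part).fderivWithin hu) x).trans ?_
  simp
  ring

theorem christoffel_lorentzMetric (hp : p ∈ S) (a b : ℝ) (v w : E) :
    christoffel (lorentzMetric f g) S p (a, v) (b, w) =
      (a * b * (timeDeriv f S p / f p)
          + (a * spatialDeriv f S p w + b * spatialDeriv f S p v) / f p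
          + timeDeriv g S p v w / (2 * f p ^ 2),
        (a * b * f p) • sliceGradient g S f p + (1 / 2 : ℝ) • metricRate g S p (a • w + b • v)
          + sliceChristoffel g S p v w) := by
  refine ((h.isInvertible_lorentzMetric hp).inverse_apply_eq).2 (ContinuousLinearMap.ext ?_)
  rintro ⟨c, z⟩
  have hf := h.lapse_ne_zero p hp
  rw [lorentzMetric_apply]
  simp only [smul_apply, add_apply, sub_apply, ContinuousLinearMap.flip_apply,
    h.fderivWithin_lorentzMetric hp]
  simp only [smul_apply, add_apply, map_add, map_smul, smul_eq_mul,
    fderivWithin_eq_time_add_spatial, h.metric_sliceGradient hp, h.metric_metricRate hp,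
    h.metric_sliceChristoffel hp]
  field_simp
  ring

theorem christoffel_lorentzMetric_spatial (hp : p ∈ S) (v u : E) :
    christoffel (lorentzMetric f g) S p (0, v) (0, u) =
      (timeDeriv g S p v u * (2 * f p ^ 2)⁻¹, sliceChristoffel g S p v u) := by
  rw [h.christoffel_lorentzMetric hp]
  simp [div_eq_mul_inv]

theorem christoffel_lorentzMetric_time_spatial (hp : p ∈ S) (u : E) :
    christoffel (lorentzMetric f g) S p (1, 0) (0, u) =
      (spatialDeriv f S p u * (f p)⁻¹, (1 / 2 : ℝ) • metricRate g S p u) := by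
  rw [h.christoffel_lorentzMetric hp]
  simp [div_eq_mul_inv]

theorem snd_fderivWithin_christoffel_spatial (hp : p ∈ S) (x : ℝ × E) (v u : E) :
    (fderivWithin ℝ (fun q => christoffel (lorentzMetric f g) S q (0, v) (0, u)) S p x).2 =
      fderivWithin ℝ (sliceChristoffel g S) S p x v u := by
  have hu := h.uniqueDiffOn p hp
  have hΓ := h.differentiableWithinAt_sliceChristoffel hp
  have differentiable_rate : DifferentiableWithinAt ℝ (timeDeriv g S) S p :=
    (contDiffOn_timeDeriv (m := ∞) h.uniqueDiffOn h.contDiffOn_metric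
      (by simp)).differentiableOn (by simp) p hp
  have differentiable_fst :
      DifferentiableWithinAt ℝ (fun q => timeDeriv g S q v u * (2 * f q ^ 2)⁻¹) S p :=
    ((differentiable_rate.clm_apply (differentiableWithinAt_const v)).clm_apply
      (differentiableWithinAt_const u)).mul ((((h.differentiableWithinAt_lapse hp).pow 2).const_mul
        2).inv (mul_ne_zero two_ne_zero (pow_ne_zero 2 (h.lapse_ne_zero p hp))))
  rw [fderivWithin_congr (fun q hq => h.christoffel_lorentzMetric_spatial hq v u)
      (h.christoffel_lorentzMetric_spatial hp v u),
    differentiable_fst.fderivWithin_prodMk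
      ((hΓ.clm_apply (differentiableWithinAt_const v)).clm_apply
        (differentiableWithinAt_const u)) hu,
    ContinuousLinearMap.prod_apply,
    fderivWithin_clm_apply₂_const_apply hu hΓ]

theorem snd_fderivWithin_christoffel_time_spatial (hp : p ∈ S) (x : ℝ × E) (u : E) :
    (fderivWithin ℝ (fun q => christoffel (lorentzMetric f g) S q (1, 0) (0, u)) S p x).2 =
      (1 / 2 : ℝ) • fderivWithin ℝ (metricRate g S) S p x u := by
  have hu := h.uniqueDiffOn p hp
  have hr := h.contDiffOn_metricRate.differentiableOn (by simp) p hp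
  have hru := hr.clm_apply (differentiableWithinAt_const u)
  have differentiable_differential : DifferentiableWithinAt ℝ (spatialDeriv f S) S p :=
    (contDiffOn_spatialDeriv (m := ∞) h.uniqueDiffOn h.contDiffOn_lapse
      (by simp)).differentiableOn (by simp) p hp
  have differentiable_fst :
      DifferentiableWithinAt ℝ (fun q => spatialDeriv f S q u * (f q)⁻¹) S p :=
    (differentiable_differential.clm_apply (differentiableWithinAt_const u)).mul
      ((h.differentiableWithinAt_lapse hp).inv (h.lapse_ne_zero p hp))
  rw [fderivWithin_congr (fun q hq => h.christoffel_lorentzMetric_time_spatial hq u)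
      (h.christoffel_lorentzMetric_time_spatial hp u),
    differentiable_fst.fderivWithin_prodMk (hru.fun_const_smul _) hu,
    ContinuousLinearMap.prod_apply, fderivWithin_fun_const_smul hu hru, smul_apply,
    fderivWithin_clm_apply_const_apply hu hr]

theorem lorentzMetric_curvature (hp : p ∈ S) (u v w : E) :
    lorentzMetric f g p (curvature (lorentzMetric f g) S p (1, 0) (0, v) (0, u)) (0, w) =
      g p (fderivWithin ℝ (sliceChristoffel g S) S p (1, 0) v u) w
        - (1 / 2) * g p (fderivWithin ℝ (metricRate g S) S p (0, v) u) w
        + (timeDeriv g S p v u / (2 * f p)) * spatialDeriv f S p w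
        + (1 / 2) * timeDeriv g S p (sliceChristoffel g S p v u) w
        - (spatialDeriv f S p u / (2 * f p)) * timeDeriv g S p v w
        - (1 / 2) * g p (sliceChristoffel g S p v (metricRate g S p u)) w := by
  have hf := h.lapse_ne_zero p hp
  rw [lorentzMetric_apply]
  simp only [curvature, Prod.snd_add, Prod.snd_sub, h.snd_fderivWithin_christoffel_spatial hp,
    h.snd_fderivWithin_christoffel_time_spatial hp, h.christoffel_lorentzMetric_spatial hp,
    h.christoffel_lorentzMetric_time_spatial hp, mul_zero, zero_add]
  rw [h.christoffel_lorentzMetric hp, h.christoffel_lorentzMetric hp]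
  simp only [map_add, map_sub, map_smul, add_apply, sub_apply, smul_apply, smul_eq_mul,
    h.metric_sliceGradient hp, h.metric_metricRate hp, one_mul, zero_mul, zero_smul, one_smul,
    zero_add, add_zero, map_zero, smul_zero, zero_apply]
  field_simp
  ring

end IsSlicedSpacetime

/-! ### The evolution equations -/

/-- The field `U` is smooth and of unit length for the slice metrics `g_t`. -/
structure IsUnitField (g : ℝ × E → E →L[ℝ] E →L[ℝ] ℝ) (U : ℝ × E → E) (S : Set (ℝ × E)) :
    Prop extends IsSliceMetric g S where
  contDiffOn_field : ContDiffOn ℝ ∞ U S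
  unit : ∀ p ∈ S, g p (U p) (U p) = 1

theorem IsUnitField.differentiableWithinAt_field {g : ℝ × E → E →L[ℝ] E →L[ℝ] ℝ} {U : ℝ × E → E}
    {S : Set (ℝ × E)} {p : ℝ × E} (h : IsUnitField g U S) (hp : p ∈ S) :
    DifferentiableWithinAt ℝ U S p :=
  h.contDiffOn_field.differentiableOn (by simp) p hp

/-- The fields satisfy `∂U/∂t = -f ∇_U U + grad f` and `(∂g/∂t)(U, ·) = -2 df`. The tensor `T`
does not occur: its value on `U` has been inserted into the second equation, and on the orthogonal
complement of `U` it is `½ ∂g/∂t`. -/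
structure IsEvolving (f : ℝ × E → ℝ) (g : ℝ × E → E →L[ℝ] E →L[ℝ] ℝ) (U : ℝ × E → E)
    (S : Set (ℝ × E)) : Prop extends IsSlicedSpacetime f g S, IsUnitField g U S where
  evol_field : ∀ p ∈ S, timeDeriv U S p =
    -(f p) • sliceNabla g S U p (U p) + sliceGradient g S f p
  rate_field : ∀ p ∈ S, ∀ w, timeDeriv g S p (U p) w = -2 * spatialDeriv f S p w

section NullDirection

variable (f : ℝ × E → ℝ) (g : ℝ × E → E →L[ℝ] E →L[ℝ] ℝ) (U : ℝ × E → E) (S : Set (ℝ × E))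

/-- The derivative of a field `A`, tangent to the slices, along the null field `∂_t + fU`: in the
direction of `∂_t` the components of `A` are differentiated, in the direction of `fU` the covariant
derivative of the slices is used. -/
def nullNabla (A : ℝ × E → E) (p : ℝ × E) : E :=
  fderivWithin ℝ A S p (1, f p • U p) + f p • sliceChristoffel g S p (U p) (A p)

/-- The form `𝒢(R^𝒢(∂_t, v)U, w) + f g(R^g(U, v)U, w)`, through which the curvature enters the
derivative of `∇U` along `∂_t + fU`. -/
def tidalForm (p : ℝ × E) (v w : E) : ℝ :=
  lorentzMetric f g p (curvature (lorentzMetric f g) S p (1, 0) (0, v) (0, U p)) (0, w)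
    + f p * g p (sliceCurvature g S p (U p) v (U p)) w

end NullDirection

theorem IsSliceMetric.fderivWithin_metric_null {f : ℝ × E → ℝ} {g : ℝ × E → E →L[ℝ] E →L[ℝ] ℝ}
    {S : Set (ℝ × E)} {p : ℝ × E} [FiniteDimensional ℝ E] (hg : IsSliceMetric g S) (hp : p ∈ S)
    (U : ℝ × E → E) {A C : ℝ × E → E} (hA : DifferentiableWithinAt ℝ A S p)
    (hC : DifferentiableWithinAt ℝ C S p) :
    fderivWithin ℝ (fun q => g q (A q) (C q)) S p (1, f p • U p) =
      timeDeriv g S p (A p) (C p) + g p (nullNabla f g U S A p) (C p)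
        + g p (A p) (nullNabla f g U S C p) := by
  rw [fderivWithin_clm_apply₂_apply (hg.uniqueDiffOn p hp) (hg.differentiableWithinAt_metric hp)
    hA hC, fderivWithin_eq_time_add_spatial g]
  simp only [nullNabla, map_smul, map_add, add_apply, smul_apply, smul_eq_mul, one_smul,
    hg.spatialDeriv_metric hp, hg.symm p hp (sliceChristoffel g S p (U p) (C p))]
  ring

namespace IsEvolving

variable {f : ℝ × E → ℝ} {g : ℝ × E → E →L[ℝ] E →L[ℝ] ℝ} {U : ℝ × E → E} {S : Set (ℝ × E)}
  {p : ℝ × E}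

theorem rate_field_right (h : IsEvolving f g U S) (hp : p ∈ S) (w : E) :
    timeDeriv g S p w (U p) = -2 * spatialDeriv f S p w := by
  rw [h.timeDeriv_metric_symm hp, h.rate_field p hp]

variable (h : IsEvolving f g U S) [FiniteDimensional ℝ E]
include h

theorem metricRate_field (hp : p ∈ S) :
    metricRate g S p (U p) = (-2 : ℝ) • sliceGradient g S f p := by
  refine h.ext_metric hp fun z => ?_
  rw [h.metric_metricRate hp, h.rate_field p hp, map_smul, smul_apply,
    h.metric_sliceGradient hp, smul_eq_mul]

theorem nabla_nullField (hp : p ∈ S) :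
    fderivWithin ℝ (fun q => ((1 : ℝ), f q • U q)) S p (1, f p • U p)
        + christoffel (lorentzMetric f g) S p (1, f p • U p) (1, f p • U p) =
      (fderivWithin ℝ f S p (1, f p • U p) / f p) • ((1 : ℝ), f p • U p) := by
  have hu := h.uniqueDiffOn p hp
  have hf := h.lapse_ne_zero p hp
  have hdf := h.differentiableWithinAt_lapse hp
  have hdU := h.differentiableWithinAt_field hp
  rw [(differentiableWithinAt_const (1 : ℝ)).fderivWithin_prodMk (hdf.fun_smul hdU) hu,
    fderivWithin_fun_smul hu hdf hdU, h.christoffel_lorentzMetric hp]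
  simp only [fderivWithin_fun_const, Pi.zero_apply, ContinuousLinearMap.prod_apply, add_apply,
    zero_apply, smul_apply, ContinuousLinearMap.smulRight_apply, fderivWithin_eq_time_add_spatial,
    map_smul, h.rate_field p hp, map_add, h.metricRate_field hp, h.evol_field p hp,
    sliceNabla_apply, smul_eq_mul]
  ext
  · simp only [Prod.fst_add, Prod.smul_fst, smul_eq_mul]
    field_simp
    ring
  · simp only [Prod.snd_add, Prod.smul_snd]
    match_scalars <;> field_simp <;> ring

theorem timeDeriv_spatialDeriv_field (hp : p ∈ S) (v : E) :
    fderivWithin ℝ (fderivWithin ℝ U S) S p (1, 0) (0, v) =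
      -(spatialDeriv f S p v) • sliceNabla g S U p (U p)
        - f p • fderivWithin ℝ (fun q => sliceNabla g S U q (U q)) S p (0, v)
        + fderivWithin ℝ (sliceGradient g S f) S p (0, v) := by
  have hu := h.uniqueDiffOn p hp
  have hdf := (h.differentiableWithinAt_lapse hp).fun_neg
  have hacc := ((h.contDiffOn_sliceNabla h.contDiffOn_field).clm_apply
    h.contDiffOn_field).differentiableOn (by simp) p hp
  have hgrad := (h.contDiffOn_sliceGradient h.contDiffOn_lapse).differentiableOn (by simp) p hp
  rw [h.fderivWithin_fderivWithin_comm h.contDiffOn_field hp, ← fderivWithin_timeDeriv hu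
      (h.differentiableWithinAt_fderivWithin h.contDiffOn_field hp),
    fderivWithin_congr h.evol_field (h.evol_field p hp),
    fderivWithin_fun_add hu (hdf.fun_smul hacc) hgrad, fderivWithin_fun_smul hu hdf hacc,
    fderivWithin_fun_neg hu]
  simp only [add_apply, smul_apply, ContinuousLinearMap.smulRight_apply, neg_apply,
    spatialDeriv_apply]
  module

theorem lorentzMetric_curvature_field (hp : p ∈ S) (v w : E) :
    lorentzMetric f g p (curvature (lorentzMetric f g) S p (1, 0) (0, v) (0, U p)) (0, w) =
      g p (fderivWithin ℝ (sliceChristoffel g S) S p (1, 0) v (U p)) w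
        + g p (fderivWithin ℝ (sliceGradient g S f) S p (0, v)) w
        + g p (sliceChristoffel g S p v (sliceGradient g S f p)) w
        + (1 / 2) * timeDeriv g S p (sliceNabla g S U p v) w
        - spatialDeriv f S p v * spatialDeriv f S p w / f p
        - spatialDeriv f S p (U p) / (2 * f p) * timeDeriv g S p v w := by
  have hu := h.uniqueDiffOn p hp
  have hf := h.lapse_ne_zero p hp
  have hr := h.contDiffOn_metricRate.differentiableOn (by simp) p hp
  have hgrad := (h.contDiffOn_sliceGradient h.contDiffOn_lapse).differentiableOn (by simp) p hp
  have deriv_metricRate :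
      g p (fderivWithin ℝ (metricRate g S) S p (0, v) (U p)) w =
        -2 * g p (fderivWithin ℝ (sliceGradient g S f) S p (0, v)) w
          - timeDeriv g S p (spatialDeriv U S p v) w := by
    have e := fderivWithin_clm_apply_apply hu hr (h.differentiableWithinAt_field hp) (0, v)
    rw [fderivWithin_congr (fun q hq => h.metricRate_field hq) (h.metricRate_field hp),
      fderivWithin_fun_const_smul hu hgrad, smul_apply, ← spatialDeriv_apply U] at e
    rw [eq_sub_of_add_eq e.symm, ← h.metric_metricRate hp]
    simp
  rw [h.lorentzMetric_curvature hp, h.rate_field_right hp, h.metricRate_field hp, sliceNabla_apply,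
    deriv_metricRate]
  simp only [map_add, map_smul, add_apply, smul_apply, smul_eq_mul]
  field_simp
  ring

theorem metric_nullNabla_sliceNabla (hp : p ∈ S) {A : ℝ × E → E}
    (hA : DifferentiableWithinAt ℝ A S p) (w : E) :
    g p (nullNabla f g U S (fun q => sliceNabla g S U q (A q)) p) w =
      tidalForm f g U S p (A p) w
        - (1 / 2) * timeDeriv g S p (sliceNabla g S U p (A p)) w
        - spatialDeriv f S p (A p) * nablaForm g S U p (U p) w
        + spatialDeriv f S p (A p) * spatialDeriv f S p w / f p
        + spatialDeriv f S p (U p) / (2 * f p) * timeDeriv g S p (A p) w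
        - f p * nablaForm g S U p (sliceNabla g S U p (A p)) w
        + nablaForm g S U p (nullNabla f g U S A p) w := by
  have deriv_field : spatialDeriv U S p (A p) =
      sliceNabla g S U p (A p) - sliceChristoffel g S p (U p) (A p) := by
    rw [sliceNabla_apply, h.sliceChristoffel_symm hp (U p)]
    abel
  have evol_field : fderivWithin ℝ U S p (1, 0) = _ := h.evol_field p hp
  rw [nullNabla, fderivWithin_clm_apply_apply (h.uniqueDiffOn p hp)
      ((h.contDiffOn_sliceNabla h.contDiffOn_field).differentiableOn (by simp) p hp) hA,
    fderivWithin_eq_time_add_spatial (sliceNabla g S U), timeDeriv, map_smul, spatialDeriv_apply,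
    add_apply, smul_apply, smul_apply, h.fderivWithin_sliceNabla_self hp h.contDiffOn_field,
    h.fderivWithin_sliceNabla_apply hp h.contDiffOn_field, h.timeDeriv_spatialDeriv_field hp,
    evol_field, deriv_field, tidalForm, h.lorentzMetric_curvature_field hp]
  simp only [nablaForm_apply, nullNabla, map_add, map_sub, map_smul, add_apply, sub_apply,
    smul_apply, smul_eq_mul, neg_smul, map_neg, neg_apply, one_smul]
  ring

theorem fderivWithin_nablaForm_null (hp : p ∈ S) {A C : ℝ × E → E}
    (hA : DifferentiableWithinAt ℝ A S p) (hC : DifferentiableWithinAt ℝ C S p) :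
    fderivWithin ℝ (fun q => nablaForm g S U q (A q) (C q)) S p (1, f p • U p) =
      tidalForm f g U S p (A p) (C p)
        + (1 / 2) * timeDeriv g S p (sliceNabla g S U p (A p)) (C p)
        - spatialDeriv f S p (A p) * nablaForm g S U p (U p) (C p)
        + spatialDeriv f S p (A p) * spatialDeriv f S p (C p) / f p
        + spatialDeriv f S p (U p) / (2 * f p) * timeDeriv g S p (A p) (C p)
        - f p * nablaForm g S U p (sliceNabla g S U p (A p)) (C p)
        + nablaForm g S U p (nullNabla f g U S A p) (C p)
        + nablaForm g S U p (A p) (nullNabla f g U S C p) := by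
  have hNA := ((h.contDiffOn_sliceNabla h.contDiffOn_field).differentiableOn (by simp) p
    hp).clm_apply hA
  simp only [nablaForm_apply _ _ (A _)]
  rw [h.fderivWithin_metric_null hp U hNA hC, h.metric_nullNabla_sliceNabla hp hA]
  ring

end IsEvolving

variable {E : Type*} [NormedAddCommGroup E] [NormedSpace ℝ E]

/-! ### Orthonormal frames -/

/-- The vectors `X, Y, N` are orthonormal for the bilinear form `B`. -/
structure IsFrame (B : E →L[ℝ] E →L[ℝ] ℝ) (X Y N : E) : Prop where
  xx : B X X = 1
  yy : B Y Y = 1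
  nn : B N N = 1
  xy : B X Y = 0
  xn : B X N = 0
  yn : B Y N = 0

/-- The multiple of `v` of length one with respect to `B`; it is `0` if `B v v ≤ 0`. -/
def normalized (B : E →L[ℝ] E →L[ℝ] ℝ) (v : E) : E := (√(B v v))⁻¹ • v

section Frames

variable {B : E →L[ℝ] E →L[ℝ] ℝ} {X Y N : E}

theorem normalized_apply_self {v : E} (hv : 0 < B v v) :
    B (normalized B v) (normalized B v) = 1 := by
  have sqrt_ne_zero := (Real.sqrt_pos.2 hv).ne'
  simp only [normalized, map_smul, smul_apply, smul_eq_mul]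
  field_simp
  exact (Real.sq_sqrt hv.le).symm

theorem normalized_of_unit {v : E} (hv : B v v = 1) : normalized B v = v := by
  simp [normalized, hv]

theorem normalized_apply_eq_zero {v w : E} (h : B v w = 0) : B (normalized B v) w = 0 := by
  simp [normalized, h]

theorem apply_normalized_eq_zero {v w : E} (h : B w v = 0) : B w (normalized B v) = 0 := by
  simp [normalized, h]

theorem isFrame_gramSchmidt (hB : ∀ v w, B v w = B w v) (hN : B N N = 1) {v w : E}
    (hX : X = normalized B (v - B v N • N)) (hv : 0 < B (v - B v N • N) (v - B v N • N))
    (hw : 0 < B (w - B w N • N - B w X • X) (w - B w N • N - B w X • X)) :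
    IsFrame B X (normalized B (w - B w N • N - B w X • X)) N := by
  have xx : B X X = 1 := by rw [hX, normalized_apply_self hv]
  have xn : B X N = 0 := by
    rw [hX]
    exact normalized_apply_eq_zero (by simp [hN])
  exact
    { xx, xn
      yy := normalized_apply_self hw
      nn := hN
      xy := apply_normalized_eq_zero (by simp [xx, xn, hB X w])
      yn := normalized_apply_eq_zero (by simp [hN, xn]) }

variable [FiniteDimensional ℝ E]

theorem exists_ne_zero_forall_apply_eq_zero (hE : 2 < Module.finrank ℝ E) (η ξ : E →L[ℝ] ℝ) :
    ∃ v, v ≠ 0 ∧ η v = 0 ∧ ξ v = 0 := by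
  obtain ⟨v, hv, hne⟩ := Submodule.exists_mem_ne_zero_of_ne_bot
    (LinearMap.ker_ne_bot_of_finrank_lt
      (f := (η : E →ₗ[ℝ] ℝ).prod (ξ : E →ₗ[ℝ] ℝ)) (by simpa using hE))
  have components : (η v, ξ v) = 0 := hv
  exact ⟨v, hne, congrArg Prod.fst components, congrArg Prod.snd components⟩

theorem exists_isFrame (hE : 2 < Module.finrank ℝ E) (hB : ∀ v w, B v w = B w v)
    (hpos : ∀ v, v ≠ 0 → 0 < B v v) (hN : B N N = 1) : ∃ X Y, IsFrame B X Y N := by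
  obtain ⟨v, hv, hNv, -⟩ := exists_ne_zero_forall_apply_eq_zero hE (B N) 0
  obtain ⟨w, hw, hNw, hvw⟩ := exists_ne_zero_forall_apply_eq_zero hE (B N) (B v)
  exact ⟨normalized B v, normalized B w,
    { xx := normalized_apply_self (hpos v hv)
      yy := normalized_apply_self (hpos w hw)
      nn := hN
      xy := normalized_apply_eq_zero (apply_normalized_eq_zero hvw)
      xn := normalized_apply_eq_zero ((hB v N).trans hNv)
      yn := normalized_apply_eq_zero ((hB w N).trans hNw) }⟩

theorem IsFrame.expand (h : IsFrame B X Y N) (hE : Module.finrank ℝ E = 3)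
    (hB : ∀ v w, B v w = B w v) (v : E) : v = B v X • X + B v Y • Y + B v N • N := by
  let components : E →ₗ[ℝ] ℝ × ℝ × ℝ :=
    ((B.flip X : E →L[ℝ] ℝ) : E →ₗ[ℝ] ℝ).prod
      (((B.flip Y : E →L[ℝ] ℝ) : E →ₗ[ℝ] ℝ).prod ((B.flip N : E →L[ℝ] ℝ) : E →ₗ[ℝ] ℝ))
  have components_apply : ∀ z, components z = (B z X, B z Y, B z N) := fun z => rfl
  have components_combination : ∀ a b c : ℝ, components (a • X + b • Y + c • N) = (a, b, c) := by
    simp [components_apply, h.xx, h.yy, h.nn, h.xy, h.xn, h.yn, hB Y X, hB N X, hB N Y]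
  have components_surjective : Function.Surjective components :=
    fun ⟨a, b, c⟩ => ⟨_, components_combination a b c⟩
  have components_injective : Function.Injective components :=
    (LinearMap.injective_iff_surjective_of_finrank_eq_finrank (by simp [hE])).2
      components_surjective
  exact components_injective (by rw [components_combination, components_apply])

end Frames

section Shear

/-- For `Z = X - iY`, the real part of `l(Z, Z)`. -/
def plusPart (l : E →L[ℝ] E →L[ℝ] ℝ) (X Y : E) : ℝ := l X X - l Y Y

/-- For `Z = X - iY`, minus the imaginary part of `l(Z, Z)`. -/
def crossPart (l : E →L[ℝ] E →L[ℝ] ℝ) (X Y : E) : ℝ := l X Y + l Y X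

/-- For `Z = X - iY`, the squared absolute value of `l(Z, Z)`. If `X, Y` are orthonormal it is twice
the squared norm of the symmetric trace-free part of `l` on the plane spanned by `X, Y`. -/
def shearNorm (l : E →L[ℝ] E →L[ℝ] ℝ) (X Y : E) : ℝ := plusPart l X Y ^ 2 + crossPart l X Y ^ 2

theorem shearNorm_nonneg (l : E →L[ℝ] E →L[ℝ] ℝ) (X Y : E) : 0 ≤ shearNorm l X Y := by
  unfold shearNorm
  positivity

theorem shearNorm_rotate (l : E →L[ℝ] E →L[ℝ] ℝ) (X Y : E) {a b s : ℝ} (hab : a ^ 2 + b ^ 2 = 1)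
    (hs : s ^ 2 = 1) :
    shearNorm l (a • X + b • Y) ((-s * b) • X + (s * a) • Y) = shearNorm l X Y := by
  have plus : plusPart l (a • X + b • Y) ((-s * b) • X + (s * a) • Y) =
      (a ^ 2 - b ^ 2) * plusPart l X Y + 2 * a * b * crossPart l X Y := by
    simp only [plusPart, crossPart, map_add, map_smul, add_apply, smul_apply, smul_eq_mul]
    linear_combination (-b ^ 2 * l X X + a * b * (l X Y + l Y X) - a ^ 2 * l Y Y) * hs
  have cross : crossPart l (a • X + b • Y) ((-s * b) • X + (s * a) • Y) =
      s * ((a ^ 2 - b ^ 2) * crossPart l X Y - 2 * a * b * plusPart l X Y) := by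
    simp only [plusPart, crossPart, map_add, map_smul, add_apply, smul_apply, smul_eq_mul]
    ring
  rw [shearNorm, plus, cross, mul_pow, hs, shearNorm]
  linear_combination (plusPart l X Y ^ 2 + crossPart l X Y ^ 2) * (a ^ 2 + b ^ 2 + 1) * hab

theorem exists_rotation_of_orthonormal {a b c d : ℝ} (hab : a ^ 2 + b ^ 2 = 1)
    (hcd : c ^ 2 + d ^ 2 = 1) (horth : a * c + b * d = 0) :
    ∃ s : ℝ, s ^ 2 = 1 ∧ c = -s * b ∧ d = s * a := by
  refine ⟨a * d - b * c, ?_, ?_, ?_⟩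
  · linear_combination (c ^ 2 + d ^ 2) * hab + hcd - (a * c + b * d) * horth
  · linear_combination (-c) * hab + a * horth
  · linear_combination (-d) * hab + b * horth

theorem shearNorm_eq [FiniteDimensional ℝ E] (hE : Module.finrank ℝ E = 3)
    {B : E →L[ℝ] E →L[ℝ] ℝ} (hB : ∀ v w, B v w = B w v) {X Y X' Y' N : E} (h : IsFrame B X Y N)
    (h' : IsFrame B X' Y' N) (l : E →L[ℝ] E →L[ℝ] ℝ) : shearNorm l X' Y' = shearNorm l X Y := by
  have expand_orthogonal : ∀ v, B v N = 0 → v = B v X • X + B v Y • Y := fun v hv => by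
    simpa [hv] using h.expand hE hB v
  have inner_orthogonal : ∀ v w, B v N = 0 → B v w = B v X * B w X + B v Y * B w Y := by
    intro v w hv
    conv_lhs => rw [expand_orthogonal v hv]
    simp [hB X w, hB Y w]
  obtain ⟨s, hs, hc, hd⟩ := exists_rotation_of_orthonormal
    (a := B X' X) (b := B X' Y) (c := B Y' X) (d := B Y' Y)
    (by rw [← h'.xx, inner_orthogonal X' X' h'.xn]; ring)
    (by rw [← h'.yy, inner_orthogonal Y' Y' h'.yn]; ring)
    (by rw [← h'.xy, inner_orthogonal X' Y' h'.xn])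
  rw [expand_orthogonal X' h'.xn, expand_orthogonal Y' h'.yn, hc, hd]
  exact shearNorm_rotate l X Y (by rw [← h'.xx, inner_orthogonal X' X' h'.xn]; ring) hs

theorem IsFrame.apply_eq_of_shearNorm_eq_zero [FiniteDimensional ℝ E]
    (hE : Module.finrank ℝ E = 3) {B : E →L[ℝ] E →L[ℝ] ℝ} (hB : ∀ v w, B v w = B w v) {X Y N : E}
    (h : IsFrame B X Y N) {l : E →L[ℝ] E →L[ℝ] ℝ} (hl : ∀ v w, l v w = l w v)
    (hs : shearNorm l X Y = 0) {v w : E} (hv : B v N = 0) (hw : B w N = 0) :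
    l v w = l X X * B v w := by
  have parts := (add_eq_zero_iff_of_nonneg (sq_nonneg _) (sq_nonneg _)).1 hs
  have plus : plusPart l X Y = 0 := (pow_eq_zero_iff two_ne_zero).1 parts.1
  have cross : crossPart l X Y = 0 := (pow_eq_zero_iff two_ne_zero).1 parts.2
  have yy : l Y Y = l X X := (sub_eq_zero.1 plus).symm
  have yx : l Y X = -l X Y := eq_neg_of_add_eq_zero_right cross
  have xy : l X Y = 0 := by linarith [hl X Y]
  have expand_v : v = B v X • X + B v Y • Y := by simpa [hv] using h.expand hE hB v
  have expand_w : w = B w X • X + B w Y • Y := by simpa [hw] using h.expand hE hB w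
  generalize B v X = a, B v Y = b, B w X = c, B w Y = d at expand_v expand_w
  simp only [expand_v, expand_w, map_add, map_smul, add_apply, smul_apply, smul_eq_mul, yy, yx, xy,
    h.xx, h.yy, h.xy, hB Y X]
  ring

theorem IsFrame.shearNorm_eq_zero {B : E →L[ℝ] E →L[ℝ] ℝ} (hB : ∀ v w, B v w = B w v) {X Y N : E}
    (h : IsFrame B X Y N) {l : E →L[ℝ] E →L[ℝ] ℝ} {a : ℝ}
    (hl : ∀ v w, B v N = 0 → B w N = 0 → l v w = a * B v w) : shearNorm l X Y = 0 := by
  simp [shearNorm, plusPart, crossPart, hl X X h.xn h.xn, hl Y Y h.yn h.yn, hl X Y h.xn h.yn,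
    hl Y X h.yn h.xn, hB Y X, h.xx, h.yy, h.xy]

/-- The squared shear `shearNorm l X Y` of the form `l` on the plane orthogonal to `N`, where
`X, Y, N` is any orthonormal frame of a 3-dimensional space: all frames give the same value. -/
def orthogonalShear (B : E →L[ℝ] E →L[ℝ] ℝ) (N : E) (l : E →L[ℝ] E →L[ℝ] ℝ) : ℝ :=
  sSup {w | ∃ X Y, IsFrame B X Y N ∧ shearNorm l X Y = w}

theorem IsFrame.orthogonalShear_eq [FiniteDimensional ℝ E] (hE : Module.finrank ℝ E = 3)
    {B : E →L[ℝ] E →L[ℝ] ℝ} (hB : ∀ v w, B v w = B w v) {X Y N : E} (h : IsFrame B X Y N)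
    (l : E →L[ℝ] E →L[ℝ] ℝ) : orthogonalShear B N l = shearNorm l X Y := by
  have values_eq : {w | ∃ X Y, IsFrame B X Y N ∧ shearNorm l X Y = w} = {shearNorm l X Y} :=
    Set.ext fun w => ⟨fun ⟨_, _, h', hw⟩ => hw.symm.trans (shearNorm_eq hE hB h h' l),
      fun hw => ⟨X, Y, h, hw.symm⟩⟩
  rw [orthogonalShear, values_eq, csSup_singleton]

end Shear

/-! ### Transport of the shear -/

section FrameFields

/-- The fields `X, Y` are continuously differentiable at `p` and, near `p`, complete `U` to an
orthonormal frame of the slices. -/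
structure IsFrameFieldAt (g : ℝ × E → E →L[ℝ] E →L[ℝ] ℝ) (U : ℝ × E → E) (S : Set (ℝ × E))
    (X Y : ℝ × E → E) (p : ℝ × E) : Prop where
  contDiff_x : ContDiffWithinAt ℝ 1 X S p
  contDiff_y : ContDiffWithinAt ℝ 1 Y S p
  frame : ∀ᶠ q in nhdsWithin p S, IsFrame (g q) (X q) (Y q) (U q)

variable {g : ℝ × E → E →L[ℝ] E →L[ℝ] ℝ} {U X Y : ℝ × E → E} {S : Set (ℝ × E)} {p : ℝ × E}

theorem IsFrameFieldAt.isFrame (h : IsFrameFieldAt g U S X Y p) (hp : p ∈ S) :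
    IsFrame (g p) (X p) (Y p) (U p) :=
  h.frame.self_of_nhdsWithin hp

theorem IsFrameFieldAt.eventually (h : IsFrameFieldAt g U S X Y p) (hp : p ∈ S) :
    ∀ᶠ q in nhdsWithin p S, IsFrameFieldAt g U S X Y q := by
  have near_x := h.contDiff_x.eventually (by simp)
  have near_y := h.contDiff_y.eventually (by simp)
  rw [insert_eq_of_mem hp] at near_x near_y
  filter_upwards [near_x, near_y, eventually_eventually_nhdsWithin.2 h.frame] with q hx hy hF
  exact ⟨hx, hy, hF⟩

theorem contDiffWithinAt_normalized (hg : ContDiffWithinAt ℝ 1 g S p) {A : ℝ × E → E}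
    (hA : ContDiffWithinAt ℝ 1 A S p) (hpos : 0 < g p (A p) (A p)) :
    ContDiffWithinAt ℝ 1 (fun q => normalized (g q) (A q)) S p :=
  ((((hg.clm_apply hA).clm_apply hA).sqrt hpos.ne').inv (Real.sqrt_pos.2 hpos).ne').smul hA

theorem eventually_metric_pos (hg : ContDiffWithinAt ℝ 1 g S p) {A : ℝ × E → E}
    (hA : ContDiffWithinAt ℝ 1 A S p) (hpos : 0 < g p (A p) (A p)) :
    ∀ᶠ q in nhdsWithin p S, 0 < g q (A q) (A q) :=
  ((hg.clm_apply hA).clm_apply hA).continuousWithinAt.eventually_const_lt hpos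

theorem IsUnitField.exists_isFrameFieldAt [FiniteDimensional ℝ E] (h : IsUnitField g U S)
    (hE : 2 < Module.finrank ℝ E) (hp : p ∈ S) : ∃ X Y, IsFrameFieldAt g U S X Y p := by
  obtain ⟨X₀, Y₀, hF⟩ := exists_isFrame hE (h.symm p hp) (h.pos p hp) (h.unit p hp)
  have hg : ContDiffWithinAt ℝ 1 g S p := (h.contDiffOn_metric p hp).of_le (by simp)
  have hU : ContDiffWithinAt ℝ 1 U S p := (h.contDiffOn_field p hp).of_le (by simp)
  let X₁ : ℝ × E → E := fun q => X₀ - g q X₀ (U q) • U q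
  let X : ℝ × E → E := fun q => normalized (g q) (X₁ q)
  let Y₁ : ℝ × E → E := fun q => Y₀ - g q Y₀ (U q) • U q - g q Y₀ (X q) • X q
  have X₁_self : X₁ p = X₀ := by simp [X₁, hF.xn]
  have X_self : X p = X₀ := by rw [← normalized_of_unit hF.xx, ← X₁_self]
  have Y₁_self : Y₁ p = Y₀ := by simp [Y₁, X_self, hF.yn, h.symm p hp Y₀ X₀, hF.xy]
  have X₁_pos : 0 < g p (X₁ p) (X₁ p) := by simp [X₁_self, hF.xx]
  have Y₁_pos : 0 < g p (Y₁ p) (Y₁ p) := by simp [Y₁_self, hF.yy]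
  have hX₁ : ContDiffWithinAt ℝ 1 X₁ S p :=
    contDiffWithinAt_const.sub (((hg.clm_apply contDiffWithinAt_const).clm_apply hU).smul hU)
  have hX : ContDiffWithinAt ℝ 1 X S p := contDiffWithinAt_normalized hg hX₁ X₁_pos
  have hY₁ : ContDiffWithinAt ℝ 1 Y₁ S p :=
    (contDiffWithinAt_const.sub
      (((hg.clm_apply contDiffWithinAt_const).clm_apply hU).smul hU)).sub
      (((hg.clm_apply contDiffWithinAt_const).clm_apply hX).smul hX)
  refine ⟨X, fun q => normalized (g q) (Y₁ q), hX, contDiffWithinAt_normalized hg hY₁ Y₁_pos, ?_⟩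
  filter_upwards [eventually_metric_pos hg hX₁ X₁_pos, eventually_metric_pos hg hY₁ Y₁_pos,
    self_mem_nhdsWithin] with q hXq hYq hq
  exact isFrame_gramSchmidt (h.symm q hq) (h.unit q hq) rfl hXq hYq

end FrameFields

variable {E : Type*} [NormedAddCommGroup E] [NormedSpace ℝ E] [FiniteDimensional ℝ E]
  {f : ℝ × E → ℝ} {g : ℝ × E → E →L[ℝ] E →L[ℝ] ℝ} {U : ℝ × E → E} {S : Set (ℝ × E)} {p : ℝ × E}

theorem IsUnitField.differentiableWithinAt_nablaForm (h : IsUnitField g U S) (hp : p ∈ S)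
    {A C : ℝ × E → E} (hA : DifferentiableWithinAt ℝ A S p) (hC : DifferentiableWithinAt ℝ C S p) :
    DifferentiableWithinAt ℝ (fun q => nablaForm g S U q (A q) (C q)) S p := by
  have hN := (h.contDiffOn_sliceNabla h.contDiffOn_field).differentiableOn (by simp) p hp
  simp only [nablaForm_apply]
  exact ((h.differentiableWithinAt_metric hp).clm_apply (hN.clm_apply hA)).clm_apply hC

theorem IsUnitField.nablaForm_field_right (h : IsUnitField g U S) (hp : p ∈ S) (v : E) :
    nablaForm g S U p v (U p) = 0 := by
  have hdU := h.differentiableWithinAt_field hp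
  have unit_deriv := fderivWithin_clm_apply₂_apply (h.uniqueDiffOn p hp)
    (h.differentiableWithinAt_metric hp) hdU hdU (0, v)
  rw [fderivWithin_congr (f := fun _ => (1 : ℝ)) h.unit (h.unit p hp), ← spatialDeriv_apply g,
    ← spatialDeriv_apply U, h.spatialDeriv_metric hp] at unit_deriv
  simp only [fderivWithin_fun_const, Pi.zero_apply, zero_apply,
    h.symm p hp (U p) (spatialDeriv U S p v)] at unit_deriv
  rw [nablaForm_apply, sliceNabla_apply, map_add, add_apply]
  linarith

theorem IsUnitField.sliceNabla_expand (h : IsUnitField g U S) (hE : Module.finrank ℝ E = 3)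
    (hp : p ∈ S) {X Y : E} (hF : IsFrame (g p) X Y (U p)) (v : E) :
    sliceNabla g S U p v = nablaForm g S U p v X • X + nablaForm g S U p v Y • Y := by
  have expansion := hF.expand hE (h.symm p hp) (sliceNabla g S U p v)
  simpa only [← nablaForm_apply, h.nablaForm_field_right hp, zero_smul, add_zero] using expansion

theorem IsSliceMetric.timeDeriv_metric_add_nullNabla (h : IsSliceMetric g S) (hp : p ∈ S)
    {A C : ℝ × E → E} {c : ℝ} (hA : DifferentiableWithinAt ℝ A S p)
    (hC : DifferentiableWithinAt ℝ C S p) (hc : ∀ᶠ q in nhdsWithin p S, g q (A q) (C q) = c) :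
    timeDeriv g S p (A p) (C p) + g p (nullNabla f g U S A p) (C p)
      + g p (nullNabla f g U S C p) (A p) = 0 := by
  have constant : fderivWithin ℝ (fun q => g q (A q) (C q)) S p (1, f p • U p) = 0 := by
    rw [Filter.EventuallyEq.fderivWithin_eq (f₁ := fun q => g q (A q) (C q)) (f := fun _ => c) hc
      (hc.self_of_nhdsWithin hp)]
    simp
  rw [← constant, h.fderivWithin_metric_null hp U hA hC,
    h.symm p hp (A p) (nullNabla f g U S C p)]

/-- The quadratic condition at `p`, with the derivatives of the metric in place of the tensor `T`:
for `Z = X - iY` it is the real and the imaginary part of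
`-¼ (∂g/∂t)(Z, Z) (ρ - 2U(f)/f) + Z(f)²/f + K(Z, Z) = 0`, where `K` is the `tidalForm`. -/
def QuadAt (f : ℝ × E → ℝ) (g : ℝ × E → E →L[ℝ] E →L[ℝ] ℝ) (U : ℝ × E → E) (S : Set (ℝ × E))
    (p : ℝ × E) : Prop :=
  ∀ X Y, IsFrame (g p) X Y (U p) →
    -(1 / 4) * (plusPart (timeDeriv g S p) X Y * (nablaForm g S U p X X + nablaForm g S U p Y Y
          - 2 * (spatialDeriv f S p (U p) / f p))
        + crossPart (timeDeriv g S p) X Y * (nablaForm g S U p Y X - nablaForm g S U p X Y))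
      + (spatialDeriv f S p X ^ 2 - spatialDeriv f S p Y ^ 2) / f p
      + (tidalForm f g U S p X X - tidalForm f g U S p Y Y) = 0 ∧
    -(1 / 4) * (plusPart (timeDeriv g S p) X Y * (nablaForm g S U p Y X - nablaForm g S U p X Y)
        - crossPart (timeDeriv g S p) X Y * (nablaForm g S U p X X + nablaForm g S U p Y Y
          - 2 * (spatialDeriv f S p (U p) / f p)))
      - 2 * (spatialDeriv f S p X * spatialDeriv f S p Y) / f p
      - (tidalForm f g U S p X Y + tidalForm f g U S p Y X) = 0

/-- The growth rate of the shear along `∂_t + fU`, in terms of an orthonormal pair `X, Y`. -/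
def shearRate (f : ℝ × E → ℝ) (g : ℝ × E → E →L[ℝ] E →L[ℝ] ℝ) (U : ℝ × E → E) (S : Set (ℝ × E))
    (p : ℝ × E) (X Y : E) : ℝ :=
  -(1 / 4) * (timeDeriv g S p X X + timeDeriv g S p Y Y)
    - f p * (nablaForm g S U p X X + nablaForm g S U p Y Y)

namespace IsEvolving

variable (h : IsEvolving f g U S) (hp : p ∈ S) {X Y : ℝ × E → E}
include h hp

omit [FiniteDimensional ℝ E] in
theorem nullNabla_field : nullNabla f g U S U p = sliceGradient g S f p := by
  rw [nullNabla, fderivWithin_eq_time_add_spatial, h.evol_field p hp, sliceNabla_apply, map_smul]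
  module

theorem metric_nullNabla_field {A : ℝ × E → E} (hA : DifferentiableWithinAt ℝ A S p)
    (hAU : ∀ᶠ q in nhdsWithin p S, g q (A q) (U q) = 0) :
    g p (nullNabla f g U S A p) (U p) = spatialDeriv f S p (A p) := by
  have constant := h.timeDeriv_metric_add_nullNabla (f := f) (U := U) hp hA
    (h.differentiableWithinAt_field hp) hAU
  rw [h.nullNabla_field hp, h.metric_sliceGradient hp, h.rate_field_right hp] at constant
  linarith

variable (hE : Module.finrank ℝ E = 3) (hXY : IsFrameFieldAt g U S X Y p)
include hE hXY

theorem exists_nullNabla_frame : ∃ ν : ℝ,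
    nullNabla f g U S X p = (-(1 / 2) * timeDeriv g S p (X p) (X p)) • X p + ν • Y p
      + spatialDeriv f S p (X p) • U p ∧
    nullNabla f g U S Y p = (-timeDeriv g S p (X p) (Y p) - ν) • X p
      + (-(1 / 2) * timeDeriv g S p (Y p) (Y p)) • Y p + spatialDeriv f S p (Y p) • U p := by
  have hX := hXY.contDiff_x.differentiableWithinAt one_ne_zero
  have hY := hXY.contDiff_y.differentiableWithinAt one_ne_zero
  have const_xx := h.timeDeriv_metric_add_nullNabla (f := f) (U := U) hp hX hX
    (hXY.frame.mono fun q hq => hq.xx)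
  have const_yy := h.timeDeriv_metric_add_nullNabla (f := f) (U := U) hp hY hY
    (hXY.frame.mono fun q hq => hq.yy)
  have const_xy := h.timeDeriv_metric_add_nullNabla (f := f) (U := U) hp hX hY
    (hXY.frame.mono fun q hq => hq.xy)
  refine ⟨g p (nullNabla f g U S X p) (Y p), ?_, ?_⟩
  · rw [← h.metric_nullNabla_field hp hX (hXY.frame.mono fun q hq => hq.xn),
      show -(1 / 2) * timeDeriv g S p (X p) (X p) = g p (nullNabla f g U S X p) (X p) by linarith]
    exact (hXY.isFrame hp).expand hE (h.symm p hp) _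
  · rw [← h.metric_nullNabla_field hp hY (hXY.frame.mono fun q hq => hq.yn),
      show -(1 / 2) * timeDeriv g S p (Y p) (Y p) = g p (nullNabla f g U S Y p) (Y p) by linarith,
      show -timeDeriv g S p (X p) (Y p) - g p (nullNabla f g U S X p) (Y p) =
        g p (nullNabla f g U S Y p) (X p) by linarith]
    exact (hXY.isFrame hp).expand hE (h.symm p hp) _

theorem exists_fderivWithin_shear (hQ : QuadAt f g U S p) : ∃ μ : ℝ,
    fderivWithin ℝ (fun q => plusPart (nablaForm g S U q) (X q) (Y q)) S p (1, f p • U p) =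
      shearRate f g U S p (X p) (Y p) * plusPart (nablaForm g S U p) (X p) (Y p)
        + μ * crossPart (nablaForm g S U p) (X p) (Y p) ∧
    fderivWithin ℝ (fun q => crossPart (nablaForm g S U q) (X q) (Y q)) S p (1, f p • U p) =
      shearRate f g U S p (X p) (Y p) * crossPart (nablaForm g S U p) (X p) (Y p)
        - μ * plusPart (nablaForm g S U p) (X p) (Y p) := by
  have hu := h.uniqueDiffOn p hp
  have hX := hXY.contDiff_x.differentiableWithinAt one_ne_zero
  have hY := hXY.contDiff_y.differentiableWithinAt one_ne_zero
  have hF := hXY.isFrame hp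
  have hB {A C : ℝ × E → E} : DifferentiableWithinAt ℝ A S p → DifferentiableWithinAt ℝ C S p →
      DifferentiableWithinAt ℝ (fun q => nablaForm g S U q (A q) (C q)) S p :=
    h.differentiableWithinAt_nablaForm hp
  obtain ⟨ν, nabla_x, nabla_y⟩ := h.exists_nullNabla_frame hp hE hXY
  obtain ⟨re, im⟩ := hQ _ _ hF
  refine ⟨2 * ν + timeDeriv g S p (X p) (Y p), ?_, ?_⟩
  · simp only [plusPart]
    rw [fderivWithin_fun_sub hu (hB hX hX) (hB hY hY), sub_apply,
      h.fderivWithin_nablaForm_null hp hX hX, h.fderivWithin_nablaForm_null hp hY hY, nabla_x,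
      nabla_y, h.sliceNabla_expand hE hp hF, h.sliceNabla_expand hE hp hF]
    simp only [plusPart, crossPart, shearRate, map_add, map_smul, add_apply, smul_apply,
      smul_eq_mul, h.nablaForm_field_right hp,
      h.timeDeriv_metric_symm hp (Y p) (X p)] at re ⊢
    linear_combination re
  · simp only [crossPart]
    rw [fderivWithin_fun_add hu (hB hX hY) (hB hY hX), add_apply,
      h.fderivWithin_nablaForm_null hp hX hY, h.fderivWithin_nablaForm_null hp hY hX, nabla_x,
      nabla_y, h.sliceNabla_expand hE hp hF, h.sliceNabla_expand hE hp hF]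
    simp only [plusPart, crossPart, shearRate, map_add, map_smul, add_apply, smul_apply,
      smul_eq_mul, h.nablaForm_field_right hp,
      h.timeDeriv_metric_symm hp (Y p) (X p)] at im ⊢
    linear_combination -im

theorem fderivWithin_shearNorm (hQ : QuadAt f g U S p) :
    DifferentiableWithinAt ℝ (fun q => shearNorm (nablaForm g S U q) (X q) (Y q)) S p ∧
    fderivWithin ℝ (fun q => shearNorm (nablaForm g S U q) (X q) (Y q)) S p (1, f p • U p) =
      2 * shearRate f g U S p (X p) (Y p) * shearNorm (nablaForm g S U p) (X p) (Y p) := by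
  have hX := hXY.contDiff_x.differentiableWithinAt one_ne_zero
  have hY := hXY.contDiff_y.differentiableWithinAt one_ne_zero
  have hB {A C : ℝ × E → E} : DifferentiableWithinAt ℝ A S p → DifferentiableWithinAt ℝ C S p →
      DifferentiableWithinAt ℝ (fun q => nablaForm g S U q (A q) (C q)) S p :=
    h.differentiableWithinAt_nablaForm hp
  have plus : DifferentiableWithinAt ℝ (fun q => plusPart (nablaForm g S U q) (X q) (Y q)) S p :=
    (hB hX hX).sub (hB hY hY)
  have cross : DifferentiableWithinAt ℝ (fun q => crossPart (nablaForm g S U q) (X q) (Y q)) S p :=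
    (hB hX hY).add (hB hY hX)
  have norm := (plus.hasFDerivWithinAt.pow 2).add (cross.hasFDerivWithinAt.pow 2)
  obtain ⟨μ, plus_deriv, cross_deriv⟩ := h.exists_fderivWithin_shear hp hE hXY hQ
  refine ⟨norm.differentiableWithinAt,
    (DFunLike.congr_fun (norm.fderivWithin (h.uniqueDiffOn p hp)) _).trans ?_⟩
  simp only [add_apply, smul_apply, smul_eq_mul, plus_deriv, cross_deriv, shearNorm]
  ring

end IsEvolving

/-- The Lie derivative `ℒ_U g` of the slice metrics. -/
def lieForm (g : ℝ × E → E →L[ℝ] E →L[ℝ] ℝ) (S : Set (ℝ × E)) (U : ℝ × E → E) (q : ℝ × E) :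
    E →L[ℝ] E →L[ℝ] ℝ :=
  spatialDeriv g S q (U q) + (g q).comp (spatialDeriv U S q)
    + ((g q).flip.comp (spatialDeriv U S q)).flip

omit [FiniteDimensional ℝ E] in
theorem lieForm_apply (v w : E) : lieForm g S U p v w =
    spatialDeriv g S p (U p) v w + g p (spatialDeriv U S p v) w + g p v (spatialDeriv U S p w) :=
  rfl

theorem IsSliceMetric.lieForm_eq (h : IsSliceMetric g S) (hp : p ∈ S) (v w : E) :
    lieForm g S U p v w = nablaForm g S U p v w + nablaForm g S U p w v := by
  rw [lieForm_apply, h.spatialDeriv_metric hp, nablaForm_apply, nablaForm_apply, sliceNabla_apply,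
    sliceNabla_apply, h.symm p hp v, h.sliceChristoffel_symm hp v, h.sliceChristoffel_symm hp w]
  simp only [map_add, add_apply]
  ring

theorem IsSliceMetric.shearNorm_lieForm (h : IsSliceMetric g S) (hp : p ∈ S) (X Y : E) :
    shearNorm (lieForm g S U p) X Y = 4 * shearNorm (nablaForm g S U p) X Y := by
  simp only [shearNorm, plusPart, crossPart, h.lieForm_eq hp]
  ring

theorem IsEvolving.fderivWithin_eq_shearRate_mul (h : IsEvolving f g U S)
    (hE : Module.finrank ℝ E = 3) {W : ℝ × E → ℝ}
    (hW : ∀ q ∈ S, ∀ X Y, IsFrame (g q) X Y (U q) → W q = shearNorm (lieForm g S U q) X Y)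
    (hp : p ∈ S) (hQ : QuadAt f g U S p) {X Y : ℝ × E → E} (hXY : IsFrameFieldAt g U S X Y p) :
    DifferentiableWithinAt ℝ W S p ∧
      fderivWithin ℝ W S p (1, f p • U p) = 2 * shearRate f g U S p (X p) (Y p) * W p := by
  obtain ⟨norm_diff, norm_deriv⟩ := h.fderivWithin_shearNorm hp hE hXY hQ
  have W_eq : ∀ q ∈ S, IsFrame (g q) (X q) (Y q) (U q) →
      W q = 4 * shearNorm (nablaForm g S U q) (X q) (Y q) :=
    fun q hq hFq => (hW q hq _ _ hFq).trans (h.shearNorm_lieForm hq _ _)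
  have W_eq_p := W_eq p hp (hXY.isFrame hp)
  have W_eventuallyEq :
      W =ᶠ[nhdsWithin p S] fun q => 4 * shearNorm (nablaForm g S U q) (X q) (Y q) := by
    filter_upwards [hXY.frame, self_mem_nhdsWithin] with q hFq hq using W_eq q hq hFq
  refine ⟨(norm_diff.const_mul 4).congr_of_eventuallyEq W_eventuallyEq W_eq_p, ?_⟩
  rw [W_eventuallyEq.fderivWithin_eq W_eq_p, fderivWithin_const_mul (h.uniqueDiffOn p hp) norm_diff,
    smul_apply, norm_deriv, W_eq_p, smul_eq_mul]
  ring

theorem IsEvolving.exists_eventually_shear_le (h : IsEvolving f g U S)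
    (hE : Module.finrank ℝ E = 3) (hQ : ∀ p ∈ S, QuadAt f g U S p) {W : ℝ × E → ℝ}
    (hW : ∀ q ∈ S, ∀ X Y, IsFrame (g q) X Y (U q) → W q = shearNorm (lieForm g S U q) X Y)
    {p₀ : ℝ × E} (hp₀ : p₀ ∈ S) :
    ∃ C : ℝ, ∀ᶠ p in nhdsWithin p₀ S, DifferentiableWithinAt ℝ W S p ∧
      fderivWithin ℝ W S p (1, f p • U p) ≤ C * W p := by
  obtain ⟨X, Y, hXY⟩ := h.toIsUnitField.exists_isFrameFieldAt (by simp [hE]) hp₀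
  have hX := hXY.contDiff_x.continuousWithinAt
  have hY := hXY.contDiff_y.continuousWithinAt
  have hN := (h.contDiffOn_sliceNabla h.contDiffOn_field).continuousOn p₀ hp₀
  have hB : ContinuousWithinAt (nablaForm g S U) S p₀ :=
    (h.contDiffOn_metric.continuousOn p₀ hp₀).clm_comp hN
  have hτ := (contDiffOn_timeDeriv (m := ∞) h.uniqueDiffOn h.contDiffOn_metric
    (by simp)).continuousOn p₀ hp₀
  have continuous_rate :
      ContinuousWithinAt (fun p => shearRate f g U S p (X p) (Y p)) S p₀ :=
    (continuousWithinAt_const.mul (((hτ.clm_apply hX).clm_apply hX).add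
      ((hτ.clm_apply hY).clm_apply hY))).sub ((h.contDiffOn_lapse.continuousOn p₀ hp₀).mul
      (((hB.clm_apply hX).clm_apply hX).add ((hB.clm_apply hY).clm_apply hY)))
  refine ⟨2 * (shearRate f g U S p₀ (X p₀) (Y p₀) + 1), ?_⟩
  filter_upwards [continuous_rate.eventually_lt_const (lt_add_one _), hXY.eventually hp₀,
    self_mem_nhdsWithin] with p rate_lt hXYp hp
  have W_nonneg : 0 ≤ W p := (hW p hp _ _ (hXYp.isFrame hp)).symm ▸ shearNorm_nonneg _ _ _
  obtain ⟨W_diff, W_deriv⟩ := h.fderivWithin_eq_shearRate_mul hE hW hp (hQ p hp) hXYp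
  refine ⟨W_diff, ?_⟩
  rw [W_deriv]
  gcongr

/-! ### The hypotheses on a coordinate slice -/

section CurvatureNeg

variable {E : Type*} [NormedAddCommGroup E] [NormedSpace ℝ E] {G : E → E →L[ℝ] E →L[ℝ] ℝ}
  {S : Set E} {p : E}

theorem christoffel_neg_left (v w : E) : christoffel G S p (-v) w = -christoffel G S p v w := by
  simp only [christoffel, sharp, ← map_neg]
  congr 1
  ext z
  simp
  ring

theorem christoffel_neg_right (v w : E) : christoffel G S p v (-w) = -christoffel G S p v w := by
  simp only [christoffel, sharp, ← map_neg]
  congr 1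
  ext z
  simp
  ring

theorem curvature_neg_middle (hS : UniqueDiffWithinAt ℝ S p) (a b c : E) :
    curvature G S p a (-b) c = -curvature G S p a b c := by
  simp only [curvature, christoffel_neg_left, christoffel_neg_right, fderivWithin_fun_neg hS,
    neg_apply, map_neg]
  abel

theorem curvature_neg_right (hS : UniqueDiffWithinAt ℝ S p) (a b c : E) :
    curvature G S p a b (-c) = -curvature G S p a b c := by
  simp only [curvature, christoffel_neg_right, fderivWithin_fun_neg hS, neg_apply]
  abel

end CurvatureNeg

section Complexify

variable {E : Type*} [NormedAddCommGroup E] {B : E → E → ℝ}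

theorem complexify_conj_conj (left : ∀ v w, B (-v) w = -B v w) (right : ∀ v w, B v (-w) = -B v w)
    (X Y : E) : complexify B (X, -Y) (X, -Y) =
      ((B X X - B Y Y : ℝ) : ℂ) - Complex.I * ((B X Y + B Y X : ℝ) : ℂ) := by
  simp only [complexify, left, right]
  push_cast
  ring

theorem complexify_self_conj (right : ∀ v w, B v (-w) = -B v w) (X Y : E) :
    complexify B (X, Y) (X, -Y) =
      ((B X X + B Y Y : ℝ) : ℂ) + Complex.I * ((B Y X - B X Y : ℝ) : ℂ) := by
  simp only [complexify, right]
  push_cast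
  ring

end Complexify

section Slices

variable {E : Type*} [NormedAddCommGroup E] [NormedSpace ℝ E] [FiniteDimensional ℝ E]
  {J : Set ℝ} {V : Set E} {g : ℝ × E → E →L[ℝ] E →L[ℝ] ℝ} {t : ℝ} {y : E}
  (h : IsSliceMetric g (J ×ˢ V)) (hV : UniqueDiffOn ℝ V) (ht : t ∈ J) (hy : y ∈ V)
include h hV ht hy

omit [FiniteDimensional ℝ E] in
theorem christoffel_slice (v w : E) :
    christoffel (fun z => g (t, z)) V y v w = sliceChristoffel g (J ×ˢ V) (t, y) v w := by
  rw [christoffel, fderivWithin_slice (hV y hy) ht (h.differentiableWithinAt_metric ⟨ht, hy⟩),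
    sliceChristoffel_apply]
  rfl

omit [FiniteDimensional ℝ E] in
theorem covDeriv_slice {A : ℝ × E → E} (hA : DifferentiableWithinAt ℝ A (J ×ˢ V) (t, y)) (v : E) :
    covDeriv (fun z => g (t, z)) V (fun z => A (t, z)) y v =
      sliceNabla g (J ×ˢ V) A (t, y) v := by
  rw [covDeriv, fderivWithin_slice (hV y hy) ht hA, christoffel_slice h hV ht hy, sliceNabla_apply]

theorem curvature_slice (a b c : E) :
    curvature (fun z => g (t, z)) V y a b c = sliceCurvature g (J ×ˢ V) (t, y) a b c := by
  have hΓ := h.differentiableWithinAt_sliceChristoffel (p := (t, y)) ⟨ht, hy⟩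
  have derivative : ∀ a b : E,
      fderivWithin ℝ (fun q => christoffel (fun z => g (t, z)) V q b c) V y a =
        fderivWithin ℝ (sliceChristoffel g (J ×ˢ V)) (J ×ˢ V) (t, y) (0, a) b c := by
    intro a b
    rw [fderivWithin_congr (fun z hz => christoffel_slice h hV ht hz b c)
        (christoffel_slice h hV ht hy b c),
      fderivWithin_slice (Q := fun q => sliceChristoffel g (J ×ˢ V) q b c) (hV y hy) ht
        ((hΓ.clm_apply (differentiableWithinAt_const b)).clm_apply
          (differentiableWithinAt_const c)),
      spatialDeriv_apply,
      fderivWithin_clm_apply₂_const_apply (h.uniqueDiffOn _ ⟨ht, hy⟩) hΓ]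
  simp only [curvature, derivative, christoffel_slice h hV ht hy, sliceCurvature]

end Slices

theorem sliceCurvature_swap {E : Type*} [NormedAddCommGroup E] [NormedSpace ℝ E]
    (g : ℝ × E → E →L[ℝ] E →L[ℝ] ℝ) (S : Set (ℝ × E)) (p : ℝ × E) (a b c : E) :
    sliceCurvature g S p a b c = -sliceCurvature g S p b a c := by
  simp only [sliceCurvature]
  abel

section Ricci

theorem finrank_E3 : Module.finrank ℝ E3 = 3 := by simp

theorem IsFrame.sum_apply_single {B : E3 →L[ℝ] E3 →L[ℝ] ℝ} (hB : ∀ v w, B v w = B w v)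
    {X Y N : E3} (h : IsFrame B X Y N) (A : E3 →ₗ[ℝ] E3) :
    ∑ i : Fin 3, A (EuclideanSpace.single i 1) i = B (A X) X + B (A Y) Y + B (A N) N := by
  have sum_single (v : E3) : ∑ i : Fin 3, v i • EuclideanSpace.single i (1 : ℝ) = v := by
    ext j
    simp [Finset.sum_apply, Pi.single_apply]
  have expand_left (F : E3) : B (A F) F = ∑ i : Fin 3, B (EuclideanSpace.single i 1) F * A F i := by
    conv_lhs => rw [← sum_single (A F)]
    simp [mul_comm]
  rw [expand_left, expand_left, expand_left, ← Finset.sum_add_distrib, ← Finset.sum_add_distrib]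
  refine Finset.sum_congr rfl fun i _ => ?_
  conv_lhs => rw [h.expand finrank_E3 hB (EuclideanSpace.single i (1 : ℝ))]
  simp

theorem ricci_neg_left {G : E3 → E3 →L[ℝ] E3 →L[ℝ] ℝ} {V : Set E3} {y : E3}
    (hV : UniqueDiffWithinAt ℝ V y) (v w : E3) : ricci G V y (-v) w = -ricci G V y v w := by
  simp [ricci, curvature_neg_middle hV]

theorem ricci_neg_right {G : E3 → E3 →L[ℝ] E3 →L[ℝ] ℝ} {V : Set E3} {y : E3}
    (hV : UniqueDiffWithinAt ℝ V y) (v w : E3) : ricci G V y v (-w) = -ricci G V y v w := by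
  simp [ricci, curvature_neg_right hV]

variable {J : Set ℝ} {V : Set E3} {g : ℝ × E3 → E3 →L[ℝ] E3 →L[ℝ] ℝ} {t : ℝ} {y X Y N : E3}
  (h : IsSliceMetric g (J ×ˢ V)) (hV : UniqueDiffOn ℝ V) (ht : t ∈ J) (hy : y ∈ V)
  (hF : IsFrame (g (t, y)) X Y N)
include h hV ht hy hF

theorem ricci_slice (v w : E3) :
    ricci (fun z => g (t, z)) V y v w =
      g (t, y) (sliceCurvature g (J ×ˢ V) (t, y) X v w) X
        + g (t, y) (sliceCurvature g (J ×ˢ V) (t, y) Y v w) Y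
        + g (t, y) (sliceCurvature g (J ×ˢ V) (t, y) N v w) N := by
  let A : E3 →ₗ[ℝ] E3 :=
    { toFun := fun a => sliceCurvature g (J ×ˢ V) (t, y) a v w
      map_add' := fun a b => by
        simp only [sliceCurvature, ← spatialDeriv_apply, map_add, add_apply]
        abel
      map_smul' := fun c a => by
        simp only [sliceCurvature, ← spatialDeriv_apply, map_smul, smul_apply, RingHom.id_apply]
        module }
  simp only [ricci, curvature_slice h hV ht hy]
  exact hF.sum_apply_single (h.symm (t, y) ⟨ht, hy⟩) A

theorem ricci_slice_sub :
    ricci (fun z => g (t, z)) V y X X - ricci (fun z => g (t, z)) V y Y Y =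
      g (t, y) (sliceCurvature g (J ×ˢ V) (t, y) N Y N) Y
        - g (t, y) (sliceCurvature g (J ×ˢ V) (t, y) N X N) X := by
  have skew := h.metric_sliceCurvature_skew (p := (t, y)) ⟨ht, hy⟩
  have same (a c d : E3) : g (t, y) (sliceCurvature g (J ×ˢ V) (t, y) a a c) d = 0 := by
    simp [sliceCurvature]
  have swap := congrArg (fun x => g (t, y) x Y) (sliceCurvature_swap g (J ×ˢ V) (t, y) X Y X)
  simp only [map_neg, neg_apply] at swap
  rw [ricci_slice h hV ht hy hF, ricci_slice h hV ht hy hF, same, same]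
  linarith [skew N X X N, skew N Y Y N, skew X Y Y X]

theorem ricci_slice_add :
    ricci (fun z => g (t, z)) V y X Y + ricci (fun z => g (t, z)) V y Y X =
      -(g (t, y) (sliceCurvature g (J ×ˢ V) (t, y) N X N) Y
        + g (t, y) (sliceCurvature g (J ×ˢ V) (t, y) N Y N) X) := by
  have skew := h.metric_sliceCurvature_skew (p := (t, y)) ⟨ht, hy⟩
  have same (a c d : E3) : g (t, y) (sliceCurvature g (J ×ˢ V) (t, y) a a c) d = 0 := by
    simp [sliceCurvature]
  rw [ricci_slice h hV ht hy hF, ricci_slice h hV ht hy hF, same, same]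
  linarith [skew N X Y N, skew N Y X N, skew Y X Y Y, skew X Y X X]

end Ricci

section QuadraticCondition

variable {J : Set ℝ} {V : Set E3} {f : ℝ × E3 → ℝ} {g : ℝ × E3 → E3 →L[ℝ] E3 →L[ℝ] ℝ}
  {U : ℝ × E3 → E3} {T : ℝ × E3 → E3 →L[ℝ] E3 →L[ℝ] ℝ} {t : ℝ} {y X Y : E3}

/-- The fields on `J ×ˢ V` satisfy `EvolvesLocally`, which is stated for curried functions. -/
abbrev EvolvesOn (J : Set ℝ) (V : Set E3) (f : ℝ × E3 → ℝ) (g : ℝ × E3 → E3 →L[ℝ] E3 →L[ℝ] ℝ)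
    (U : ℝ × E3 → E3) (T : ℝ × E3 → E3 →L[ℝ] E3 →L[ℝ] ℝ) : Prop :=
  EvolvesLocally J V (fun t y => f (t, y)) (fun t y => g (t, y)) (fun t y => U (t, y))
    (fun t y => T (t, y))

theorem slicediff_eq (hV : UniqueDiffOn ℝ V) (ht : t ∈ J) (hy : y ∈ V)
    (hf : DifferentiableWithinAt ℝ f (J ×ˢ V) (t, y)) :
    slicediff V (fun t y => f (t, y)) t y = spatialDeriv f (J ×ˢ V) (t, y) :=
  fderivWithin_slice (hV y hy) ht hf

theorem slicegrad_eq (hV : UniqueDiffOn ℝ V) (ht : t ∈ J) (hy : y ∈ V)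
    (hf : DifferentiableWithinAt ℝ f (J ×ˢ V) (t, y)) :
    slicegrad V (fun t y => f (t, y)) (fun t y => g (t, y)) t y =
      sliceGradient g (J ×ˢ V) f (t, y) := by
  rw [slicegrad, slicediff_eq hV ht hy hf]
  rfl

theorem EvolvesOn.timeDeriv_metric (he : EvolvesOn J V f g U T) (h : IsSlicedSpacetime f g (J ×ˢ V))
    (hJ : UniqueDiffOn ℝ J) (hV : UniqueDiffOn ℝ V) (ht : t ∈ J) (hy : y ∈ V) (v w : E3) :
    timeDeriv g (J ×ˢ V) (t, y) v w =
      -(g (t, y) (U (t, y)) v * spatialDeriv f (J ×ˢ V) (t, y) w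
          + spatialDeriv f (J ×ˢ V) (t, y) v * g (t, y) (U (t, y)) w)
        + 2 * T (t, y) v w := by
  have hg := h.differentiableWithinAt_metric (p := (t, y)) ⟨ht, hy⟩
  have derivative := hasDerivWithinAt_time (Q := fun q => g q v w) hy
    ((hg.clm_apply (differentiableWithinAt_const v)).clm_apply (differentiableWithinAt_const w))
  rw [timeDeriv, fderivWithin_clm_apply₂_const_apply (h.uniqueDiffOn _ ⟨ht, hy⟩) hg] at derivative
  rw [← slicediff_eq hV ht hy (h.differentiableWithinAt_lapse ⟨ht, hy⟩)]
  exact (hJ t ht).eq_deriv _ derivative (he.evol_g t ht y hy v w)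

theorem EvolvesOn.isEvolving (he : EvolvesOn J V f g U T) (h : IsSlicedSpacetime f g (J ×ˢ V))
    (hU : IsUnitField g U (J ×ˢ V)) (hJ : UniqueDiffOn ℝ J) (hV : UniqueDiffOn ℝ V) :
    IsEvolving f g U (J ×ˢ V) where
  toIsSlicedSpacetime := h
  contDiffOn_field := hU.contDiffOn_field
  unit := hU.unit
  evol_field := by
    rintro ⟨t, y⟩ ⟨ht, hy⟩
    have hUd := hU.differentiableWithinAt_field (p := (t, y)) ⟨ht, hy⟩
    rw [(hJ t ht).eq_deriv _ (hasDerivWithinAt_time hy hUd) (he.evol_U t ht y hy),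
      covDeriv_slice h.toIsSliceMetric hV ht hy hUd,
      slicegrad_eq hV ht hy (h.differentiableWithinAt_lapse ⟨ht, hy⟩)]
  rate_field := by
    rintro ⟨t, y⟩ ⟨ht, hy⟩ w
    have hf := h.differentiableWithinAt_lapse (p := (t, y)) ⟨ht, hy⟩
    have tensor_field := congrArg (fun x => g (t, y) x w) (he.T_U t ht y hy)
    simp only [sharp, h.metric_inverse (p := (t, y)) ⟨ht, hy⟩, map_add, map_smul, add_apply,
      smul_apply, slicegrad_eq hV ht hy hf, slicediff_eq hV ht hy hf,
      h.metric_sliceGradient (p := (t, y)) ⟨ht, hy⟩, smul_eq_mul] at tensor_field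
    rw [he.timeDeriv_metric h hJ hV ht hy, tensor_field, hU.unit (t, y) ⟨ht, hy⟩]
    ring

theorem mixedCurv_neg_left (hS : UniqueDiffOn ℝ (J ×ˢ V)) (ht : t ∈ J) (hy : y ∈ V) (v w : E3) :
    mixedCurv J V (fun t y => f (t, y)) (fun t y => g (t, y)) (fun t y => U (t, y)) t y (-v) w =
      -mixedCurv J V (fun t y => f (t, y)) (fun t y => g (t, y)) (fun t y => U (t, y)) t y v w := by
  rw [mixedCurv, show ((0 : ℝ), -v) = -((0 : ℝ), v) by simp,
    curvature_neg_middle (hS (t, y) ⟨ht, hy⟩), map_neg, neg_apply, mixedCurv]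

theorem mixedCurv_neg_right (v w : E3) :
    mixedCurv J V (fun t y => f (t, y)) (fun t y => g (t, y)) (fun t y => U (t, y)) t y v (-w) =
      -mixedCurv J V (fun t y => f (t, y)) (fun t y => g (t, y)) (fun t y => U (t, y)) t y v w := by
  rw [mixedCurv, show ((0 : ℝ), -w) = -((0 : ℝ), w) by simp, map_neg, mixedCurv]

theorem complexify_curvTensor (h : IsSliceMetric g (J ×ˢ V)) (hV : UniqueDiffOn ℝ V) (ht : t ∈ J)
    (hy : y ∈ V) (hF : IsFrame (g (t, y)) X Y (U (t, y))) :
    complexify (curvTensor J V (fun t y => f (t, y)) (fun t y => g (t, y)) (fun t y => U (t, y))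
        t y) (X, -Y) (X, -Y) =
      ((tidalForm f g U (J ×ˢ V) (t, y) X X - tidalForm f g U (J ×ˢ V) (t, y) Y Y : ℝ) : ℂ)
        - Complex.I * ((tidalForm f g U (J ×ˢ V) (t, y) X Y
          + tidalForm f g U (J ×ˢ V) (t, y) Y X : ℝ) : ℂ) := by
  have ricci_sub := ricci_slice_sub h hV ht hy hF
  have ricci_add := ricci_slice_add h hV ht hy hF
  have mixed (v w : E3) : tidalForm f g U (J ×ˢ V) (t, y) v w =
      mixedCurv J V (fun t y => f (t, y)) (fun t y => g (t, y)) (fun t y => U (t, y)) t y v w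
        + f (t, y) * g (t, y) (sliceCurvature g (J ×ˢ V) (t, y) (U (t, y)) v (U (t, y))) w := rfl
  rw [complexify_conj_conj]
  · simp only [curvTensor, mixed]
    refine congrArg₂ (fun a b : ℝ => (a : ℂ) - Complex.I * (b : ℂ)) ?_ ?_
    · linear_combination -f (t, y) * ricci_sub
    · linear_combination -f (t, y) * ricci_add
  · intro v w
    simp only [curvTensor, ricci_neg_left (hV y hy), mixedCurv_neg_left h.uniqueDiffOn ht hy,
      mixedCurv_neg_right]
    ring
  · intro v w
    simp only [curvTensor, ricci_neg_right (hV y hy), mixedCurv_neg_left h.uniqueDiffOn ht hy,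
      mixedCurv_neg_right]
    ring

theorem complexify_tensor (he : EvolvesOn J V f g U T) (h : IsSlicedSpacetime f g (J ×ˢ V))
    (hJ : UniqueDiffOn ℝ J) (hV : UniqueDiffOn ℝ V) (ht : t ∈ J) (hy : y ∈ V)
    (hF : IsFrame (g (t, y)) X Y (U (t, y))) :
    complexify (fun v w => T (t, y) v w) (X, -Y) (X, -Y) =
      ((1 / 2 * plusPart (timeDeriv g (J ×ˢ V) (t, y)) X Y : ℝ) : ℂ)
        - Complex.I * ((1 / 2 * crossPart (timeDeriv g (J ×ˢ V) (t, y)) X Y : ℝ) : ℂ) := by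
  have symm := h.symm (t, y) ⟨ht, hy⟩
  have orth_x : g (t, y) (U (t, y)) X = 0 := (symm _ _).trans hF.xn
  have orth_y : g (t, y) (U (t, y)) Y = 0 := (symm _ _).trans hF.yn
  rw [complexify_conj_conj (by simp) (by simp)]
  congr 3
  · simp only [plusPart, he.timeDeriv_metric h hJ hV ht hy, orth_x, orth_y]
    ring
  · simp only [crossPart, he.timeDeriv_metric h hJ hV ht hy, orth_x, orth_y]
    ring

theorem rho_eq (h : IsUnitField g U (J ×ˢ V)) (hV : UniqueDiffOn ℝ V) (ht : t ∈ J) (hy : y ∈ V) :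
    rho V (fun t y => g (t, y)) (fun t y => U (t, y)) t y X Y =
      ((nablaForm g (J ×ˢ V) U (t, y) X X + nablaForm g (J ×ˢ V) U (t, y) Y Y : ℝ) : ℂ)
        + Complex.I *
          ((nablaForm g (J ×ˢ V) U (t, y) Y X - nablaForm g (J ×ˢ V) U (t, y) X Y : ℝ) : ℂ) := by
  simp only [rho, covDeriv_slice h.toIsSliceMetric hV ht hy
    (h.differentiableWithinAt_field ⟨ht, hy⟩), ← nablaForm_apply]
  exact complexify_self_conj (by simp) X Y

theorem re_im_of_quadratic_eq_zero {a b c d s r x y m n : ℝ}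
    (h : -(1 / 2) * ((a : ℂ) - Complex.I * b) * (((c : ℂ) + Complex.I * d) - 2 * s)
      + r * ((x : ℂ) - Complex.I * y) ^ 2 + ((m : ℂ) - Complex.I * n) = 0) :
    -(1 / 2) * (a * (c - 2 * s) + b * d) + r * (x ^ 2 - y ^ 2) + m = 0 ∧
      -(1 / 2) * (a * d - b * (c - 2 * s)) - 2 * r * x * y - n = 0 := by
  have split : (⟨-(1 / 2) * (a * (c - 2 * s) + b * d) + r * (x ^ 2 - y ^ 2) + m,
      -(1 / 2) * (a * d - b * (c - 2 * s)) - 2 * r * x * y - n⟩ : ℂ) = 0 := by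
    rw [Complex.mk_eq_add_mul_I]
    push_cast
    linear_combination h - (b * d / 2 + r * y ^ 2) * Complex.I_sq
  exact Complex.ext_iff.1 split

theorem EvolvesOn.quadAt (he : EvolvesOn J V f g U T) (h : IsSlicedSpacetime f g (J ×ˢ V))
    (hU : IsUnitField g U (J ×ˢ V)) (hJ : UniqueDiffOn ℝ J) (hV : UniqueDiffOn ℝ V)
    (hQ : QuadLocally J V (fun t y => f (t, y)) (fun t y => g (t, y)) (fun t y => U (t, y))
      (fun t y => T (t, y))) {p : ℝ × E3} (hp : p ∈ J ×ˢ V) : QuadAt f g U (J ×ˢ V) p := by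
  obtain ⟨t, y⟩ := p
  obtain ⟨ht, hy⟩ := hp
  intro X Y hF
  have quad := hQ t ht y hy X Y hF.xx hF.yy hF.xy hF.xn hF.yn
  rw [quadExpr, rho_eq hU hV ht hy, complexify_curvTensor h.toIsSliceMetric hV ht hy hF,
    complexify_tensor he h hJ hV ht hy hF,
    slicediff_eq hV ht hy (h.differentiableWithinAt_lapse ⟨ht, hy⟩),
    show (1 : ℂ) / (f (t, y) : ℂ) = ((1 / f (t, y) : ℝ) : ℂ) by push_cast; rfl] at quad
  obtain ⟨re, im⟩ := re_im_of_quadratic_eq_zero quad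
  exact ⟨by linear_combination re, by linear_combination im⟩

end QuadraticCondition

/-! ### Coordinate expressions -/

section Charts

variable {M : Type*} [TopologicalSpace M] [ChartedSpace E3 M] {x₀ : M} {y : E3} {J : Set ℝ}

/-- The derivative of the inverse of the chart around `x₀`. -/
def chartInvDeriv (x₀ : M) (y : E3) : E3 →L[ℝ] E3 :=
  mfderiv 𝓘(ℝ, E3) (𝓡 3) (extChartAt (𝓡 3) x₀).symm y

/-- The derivative of the chart around `x₀`, at the point with coordinates `y`. -/
def chartDeriv (x₀ : M) (y : E3) : E3 →L[ℝ] E3 :=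
  mfderiv (𝓡 3) 𝓘(ℝ, E3) (extChartAt (𝓡 3) x₀) ((extChartAt (𝓡 3) x₀).symm y)

/-- The coordinate expression, in `ℝ × E3`, of a time-dependent function. -/
abbrev timeChartFun (f : ℝ → M → ℝ) (x₀ : M) (q : ℝ × E3) : ℝ :=
  chartFun (f q.1) x₀ q.2

/-- The coordinate expression, in `ℝ × E3`, of a time-dependent vector field. -/
abbrev timeChartVec (U : ℝ → ∀ x : M, TangentSpace (𝓡 3) x) (x₀ : M) (q : ℝ × E3) : E3 :=
  chartVec (U q.1) x₀ q.2

/-- The coordinate expression, in `ℝ × E3`, of a time-dependent covariant 2-tensor field. -/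
abbrev timeChartTensor
    (B : ℝ → ∀ x : M, TangentSpace (𝓡 3) x →L[ℝ] TangentSpace (𝓡 3) x →L[ℝ] ℝ) (x₀ : M)
    (q : ℝ × E3) : E3 →L[ℝ] E3 →L[ℝ] ℝ :=
  chartTensor (B q.1) x₀ q.2

/-- The coordinate domain of `J × M` defined by the chart around `x₀`. -/
abbrev timeChartDomain (J : Set ℝ) (x₀ : M) : Set (ℝ × E3) :=
  J ×ˢ (extChartAt (𝓡 3) x₀).target

/-- The chart of `ℝ × M` defined by the chart around `x₀`. -/
abbrev timeChart (x₀ : M) (p : ℝ × M) : ℝ × E3 :=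
  (p.1, extChartAt (𝓡 3) x₀ p.2)

/-- The coordinate expression, in the chart around `x₀`, of `ℒ_U g`. -/
def chartLieForm (g : ∀ x : M, TangentSpace (𝓡 3) x →L[ℝ] TangentSpace (𝓡 3) x →L[ℝ] ℝ)
    (U : ∀ x : M, TangentSpace (𝓡 3) x) (x₀ : M) (y : E3) : E3 →L[ℝ] E3 →L[ℝ] ℝ :=
  fderiv ℝ (chartTensor g x₀) y (chartVec U x₀ y)
    + (chartTensor g x₀ y).comp (fderiv ℝ (chartVec U x₀) y)
    + ((chartTensor g x₀ y).flip.comp (fderiv ℝ (chartVec U x₀) y)).flip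

/-- The differentiability of a vector field at a point, as a section of the tangent bundle. -/
abbrev MDifferentiableFieldAt [IsManifold (𝓡 3) ∞ M] (X : ∀ x : M, TangentSpace (𝓡 3) x) (x : M) :
    Prop :=
  MDifferentiableAt (𝓡 3) ((𝓡 3).prod 𝓘(ℝ, E3)) (fun z => (⟨z, X z⟩ : TangentBundle (𝓡 3) M)) x

theorem chartVec_eq (X : ∀ x : M, TangentSpace (𝓡 3) x) (x₀ : M) (y : E3) :
    chartVec X x₀ y = chartDeriv x₀ y (X ((extChartAt (𝓡 3) x₀).symm y)) := rfl

theorem chartTensor_apply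
    (B : ∀ x : M, TangentSpace (𝓡 3) x →L[ℝ] TangentSpace (𝓡 3) x →L[ℝ] ℝ) (x₀ : M) (y v w : E3) :
    chartTensor B x₀ y v w = B ((extChartAt (𝓡 3) x₀).symm y) (chartInvDeriv x₀ y v)
      (chartInvDeriv x₀ y w) := rfl

theorem timeChart_mem {p : ℝ × M} (hp : p.1 ∈ J) (hx : p.2 ∈ (extChartAt (𝓡 3) x₀).source) :
    timeChart x₀ p ∈ timeChartDomain J x₀ :=
  ⟨hp, (extChartAt (𝓡 3) x₀).map_source hx⟩

theorem timeChartFun_timeChart {p : ℝ × M} (hx : p.2 ∈ (extChartAt (𝓡 3) x₀).source)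
    (k : ℝ → M → ℝ) : timeChartFun k x₀ (timeChart x₀ p) = k p.1 p.2 :=
  congrArg (k p.1) ((extChartAt (𝓡 3) x₀).left_inv hx)

theorem extChartAt_symm_mem_chart_source (hy : y ∈ (extChartAt (𝓡 3) x₀).target) :
    (extChartAt (𝓡 3) x₀).symm y ∈ (chartAt E3 x₀).source := by
  rw [← extChartAt_source (𝓡 3)]
  exact (extChartAt (𝓡 3) x₀).map_target hy

variable [IsManifold (𝓡 3) ∞ M]

theorem isManifold_one : IsManifold (𝓡 3) 1 M :=
  IsManifold.of_le (n := ∞) (by simp)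

theorem chartDeriv_chartInvDeriv (hy : y ∈ (extChartAt (𝓡 3) x₀).target) (v : E3) :
    chartDeriv x₀ y (chartInvDeriv x₀ y v) = v := by
  have := isManifold_one (M := M)
  have comp_eq_id := mfderiv_extChartAt_comp_mfderivWithin_extChartAt_symm (I := 𝓡 3) hy
  rw [ModelWithCorners.Boundaryless.range_eq_univ, mfderivWithin_univ] at comp_eq_id
  exact congrArg (fun L : E3 →L[ℝ] E3 => L v) comp_eq_id

theorem chartInvDeriv_chartDeriv (hy : y ∈ (extChartAt (𝓡 3) x₀).target) (v : E3) :
    chartInvDeriv x₀ y (chartDeriv x₀ y v) = v := by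
  have := isManifold_one (M := M)
  have comp_eq_id := mfderivWithin_extChartAt_symm_comp_mfderiv_extChartAt (I := 𝓡 3) hy
  rw [ModelWithCorners.Boundaryless.range_eq_univ, mfderivWithin_univ] at comp_eq_id
  exact congrArg (fun L : E3 →L[ℝ] E3 => L v) comp_eq_id

theorem chartInvDeriv_ne_zero (hy : y ∈ (extChartAt (𝓡 3) x₀).target) {v : E3} (hv : v ≠ 0) :
    chartInvDeriv x₀ y v ≠ 0 := fun h => hv <| by
  rw [← chartDeriv_chartInvDeriv hy v, h, map_zero]

theorem chartInvDeriv_chartVec (X : ∀ x : M, TangentSpace (𝓡 3) x)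
    (hy : y ∈ (extChartAt (𝓡 3) x₀).target) :
    chartInvDeriv x₀ y (chartVec X x₀ y) = X ((extChartAt (𝓡 3) x₀).symm y) := by
  rw [chartVec_eq]
  exact chartInvDeriv_chartDeriv hy _

theorem chartTensor_chartVec
    (B : ∀ x : M, TangentSpace (𝓡 3) x →L[ℝ] TangentSpace (𝓡 3) x →L[ℝ] ℝ)
    (X Y : ∀ x : M, TangentSpace (𝓡 3) x) (hy : y ∈ (extChartAt (𝓡 3) x₀).target) :
    chartTensor B x₀ y (chartVec X x₀ y) (chartVec Y x₀ y) =
      B ((extChartAt (𝓡 3) x₀).symm y) (X ((extChartAt (𝓡 3) x₀).symm y))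
        (Y ((extChartAt (𝓡 3) x₀).symm y)) := by
  rw [chartTensor_apply, chartInvDeriv_chartVec X hy, chartInvDeriv_chartVec Y hy]

theorem mk_mem_trivializationAt_source (hy : y ∈ (extChartAt (𝓡 3) x₀).target) (v : E3) :
    (⟨(extChartAt (𝓡 3) x₀).symm y, v⟩ : TangentBundle (𝓡 3) M) ∈
      (trivializationAt E3 (TangentSpace (𝓡 3)) x₀).source := by
  rw [Bundle.Trivialization.mem_source]
  simpa using extChartAt_symm_mem_chart_source hy

theorem trivializationAt_snd (hy : y ∈ (extChartAt (𝓡 3) x₀).target) (v : E3) :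
    (trivializationAt E3 (TangentSpace (𝓡 3)) x₀
      (⟨(extChartAt (𝓡 3) x₀).symm y, v⟩ : TangentBundle (𝓡 3) M)).2 = chartDeriv x₀ y v := by
  have := isManifold_one (M := M)
  have hx := extChartAt_symm_mem_chart_source hy
  have trivialization_eq : (trivializationAt E3 (TangentSpace (𝓡 3)) x₀).continuousLinearMapAt ℝ
      ((extChartAt (𝓡 3) x₀).symm y) v = chartDeriv x₀ y v :=
    congrArg (fun L : E3 →L[ℝ] E3 => L v)
      (TangentBundle.continuousLinearMapAt_trivializationAt (I := 𝓡 3) hx)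
  rw [← trivialization_eq, Bundle.Trivialization.continuousLinearMapAt_apply,
    Bundle.Trivialization.coe_linearMapAt_of_mem]
  simpa using hx

theorem contMDiffOn_prod_extChartAt_symm (J : Set ℝ) (x₀ : M) :
    ContMDiffOn 𝓘(ℝ, ℝ × E3) (𝓘(ℝ, ℝ).prod (𝓡 3)) ∞
      (fun q : ℝ × E3 => (q.1, (extChartAt (𝓡 3) x₀).symm q.2)) (timeChartDomain J x₀) :=
  contDiff_fst.contMDiff.contMDiffOn.prodMk
    ((contMDiffOn_extChartAt_symm x₀).comp contDiff_snd.contMDiff.contMDiffOn fun _ hq => hq.2)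

theorem contDiffOn_timeChartFun {f : ℝ → M → ℝ}
    (hf : ContMDiffOn (𝓘(ℝ, ℝ).prod (𝓡 3)) 𝓘(ℝ, ℝ) ∞ (fun p : ℝ × M => f p.1 p.2) (J ×ˢ univ))
    (x₀ : M) : ContDiffOn ℝ ∞ (timeChartFun f x₀) (timeChartDomain J x₀) := by
  rw [← contMDiffOn_iff_contDiffOn]
  exact hf.comp (contMDiffOn_prod_extChartAt_symm J x₀) fun q hq => ⟨hq.1, mem_univ _⟩

theorem contDiffOn_timeChartVec {U : ℝ → ∀ x : M, TangentSpace (𝓡 3) x}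
    (hU : ContMDiffOn (𝓘(ℝ, ℝ).prod (𝓡 3)) ((𝓡 3).prod 𝓘(ℝ, E3)) ∞
      (fun p : ℝ × M => (⟨p.2, U p.1 p.2⟩ : TangentBundle (𝓡 3) M)) (J ×ˢ univ)) (x₀ : M) :
    ContDiffOn ℝ ∞ (timeChartVec U x₀) (timeChartDomain J x₀) := by
  have trivialized := ((trivializationAt E3 (TangentSpace (𝓡 3)) x₀).contMDiffOn_iff (IB := 𝓡 3)
    fun q hq => mk_mem_trivializationAt_source hq.2 _).1
      (hU.comp (contMDiffOn_prod_extChartAt_symm J x₀) fun q hq => ⟨hq.1, mem_univ _⟩)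
  exact contMDiffOn_iff_contDiffOn.1
    (trivialized.2.congr fun q hq => (trivializationAt_snd hq.2 _).symm)

theorem contMDiffOn_chartInvDeriv (J : Set ℝ) (x₀ : M) (v : E3) :
    ContMDiffOn 𝓘(ℝ, ℝ × E3) ((𝓡 3).prod 𝓘(ℝ, E3)) ∞
      (fun q : ℝ × E3 => (⟨(extChartAt (𝓡 3) x₀).symm q.2, chartInvDeriv x₀ q.2 v⟩ :
        TangentBundle (𝓡 3) M)) (timeChartDomain J x₀) := by
  refine ((trivializationAt E3 (TangentSpace (𝓡 3)) x₀).contMDiffOn_iff (IB := 𝓡 3)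
    fun q hq => mk_mem_trivializationAt_source hq.2 _).2
      ⟨contMDiff_snd.comp_contMDiffOn (contMDiffOn_prod_extChartAt_symm J x₀),
        (contMDiffOn_const (c := v)).congr fun q hq => ?_⟩
  rw [trivializationAt_snd hq.2, chartDeriv_chartInvDeriv hq.2]

theorem contDiffOn_timeChartTensor
    {g : ℝ → ∀ x : M, TangentSpace (𝓡 3) x →L[ℝ] TangentSpace (𝓡 3) x →L[ℝ] ℝ}
    (hg : ContMDiffOn (𝓘(ℝ, ℝ).prod (𝓡 3)) ((𝓡 3).prod 𝓘(ℝ, E3 →L[ℝ] E3 →L[ℝ] ℝ)) ∞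
      (fun p : ℝ × M => Bundle.TotalSpace.mk' (E3 →L[ℝ] E3 →L[ℝ] ℝ)
        (E := fun x : M => TangentSpace (𝓡 3) x →L[ℝ] TangentSpace (𝓡 3) x →L[ℝ] ℝ)
        p.2 (g p.1 p.2)) (J ×ˢ univ)) (x₀ : M) :
    ContDiffOn ℝ ∞ (timeChartTensor g x₀) (timeChartDomain J x₀) := by
  refine contDiffOn_clm_apply.2 fun v => contDiffOn_clm_apply.2 fun w => ?_
  have smooth_section : ContMDiffOn 𝓘(ℝ, ℝ × E3) ((𝓡 3).prod 𝓘(ℝ)) ∞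
      (fun q : ℝ × E3 => Bundle.TotalSpace.mk' ℝ (E := Bundle.Trivial M ℝ)
        ((extChartAt (𝓡 3) x₀).symm q.2)
        (g q.1 ((extChartAt (𝓡 3) x₀).symm q.2) (chartInvDeriv x₀ q.2 v) (chartInvDeriv x₀ q.2 w)))
      (timeChartDomain J x₀) :=
    ContMDiffOn.clm_bundle_apply₂ (F₁ := E3) (F₂ := E3)
      (hg.comp (contMDiffOn_prod_extChartAt_symm J x₀) fun q hq => ⟨hq.1, mem_univ _⟩)
      (contMDiffOn_chartInvDeriv J x₀ v) (contMDiffOn_chartInvDeriv J x₀ w)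
  exact contMDiffOn_iff_contDiffOn.1 fun q hq =>
    (Bundle.contMDiffWithinAt_totalSpace.1 (smooth_section q hq)).2

theorem differentiableAt_chartVec {X : ∀ x : M, TangentSpace (𝓡 3) x}
    (hy : y ∈ (extChartAt (𝓡 3) x₀).target)
    (hX : MDifferentiableFieldAt X ((extChartAt (𝓡 3) x₀).symm y)) :
    DifferentiableAt ℝ (chartVec X x₀) y := by
  have target_mem_nhds := (isOpen_extChartAt_target x₀).mem_nhds hy
  have differentiable_symm : MDifferentiableAt 𝓘(ℝ, E3) (𝓡 3) (extChartAt (𝓡 3) x₀).symm y :=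
    ((contMDiffOn_extChartAt_symm (n := ∞) x₀ y hy).contMDiffAt
      target_mem_nhds).mdifferentiableAt (by simp)
  have trivialized :=
    ((trivializationAt E3 (TangentSpace (𝓡 3)) x₀).mdifferentiableAt_totalSpace_iff (𝓡 3)
      (fun z => ⟨(extChartAt (𝓡 3) x₀).symm z, X ((extChartAt (𝓡 3) x₀).symm z)⟩)
      (mk_mem_trivializationAt_source hy _)).1 (hX.comp y differentiable_symm)
  rw [← mdifferentiableAt_iff_differentiableAt]
  refine trivialized.2.congr_of_eventuallyEq ?_
  filter_upwards [target_mem_nhds] with z hz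
  exact (trivializationAt_snd hz _).symm

theorem mpullback_eq_chartVec (X : ∀ x : M, TangentSpace (𝓡 3) x)
    (hy : y ∈ (extChartAt (𝓡 3) x₀).target) :
    VectorField.mpullback 𝓘(ℝ, E3) (𝓡 3) (extChartAt (𝓡 3) x₀).symm X y = chartVec X x₀ y := by
  have inverse_eq : (chartInvDeriv x₀ y).inverse = chartDeriv x₀ y :=
    ContinuousLinearMap.inverse_eq (ContinuousLinearMap.ext (chartInvDeriv_chartDeriv hy))
      (ContinuousLinearMap.ext (chartDeriv_chartInvDeriv hy))
  rw [VectorField.mpullback_apply, chartVec_eq, ← inverse_eq]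
  rfl

theorem mlieBracket_eq_lieBracket {𝕜 : Type*} [NontriviallyNormedField 𝕜] {E : Type*}
    [NormedAddCommGroup E] [NormedSpace 𝕜 E] (V W : ∀ y : E, TangentSpace 𝓘(𝕜, E) y) :
    VectorField.mlieBracket 𝓘(𝕜, E) V W = VectorField.lieBracket 𝕜 V W := by
  rw [← VectorField.mlieBracketWithin_univ, VectorField.mlieBracketWithin_eq_lieBracketWithin]
  exact VectorField.lieBracketWithin_univ

theorem chartVec_mlieBracket {X Y : ∀ x : M, TangentSpace (𝓡 3) x}
    (hy : y ∈ (extChartAt (𝓡 3) x₀).target)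
    (hX : MDifferentiableFieldAt X ((extChartAt (𝓡 3) x₀).symm y))
    (hY : MDifferentiableFieldAt Y ((extChartAt (𝓡 3) x₀).symm y)) :
    chartVec (VectorField.mlieBracket (𝓡 3) X Y) x₀ y =
      fderiv ℝ (chartVec Y x₀) y (chartVec X x₀ y)
        - fderiv ℝ (chartVec X x₀) y (chartVec Y x₀ y) := by
  have hI : IsManifold (𝓡 3) (minSmoothness ℝ 2) M :=
    IsManifold.of_le (n := ∞) (by simpa using ENat.LEInfty.out)
  have target_mem_nhds := (isOpen_extChartAt_target x₀).mem_nhds hy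
  have pullback_bracket := VectorField.mpullback_mlieBracket hX hY
    ((contMDiffOn_extChartAt_symm (n := ∞) x₀ y hy).contMDiffAt target_mem_nhds)
    (by simpa using ENat.LEInfty.out)
  rw [mpullback_eq_chartVec _ hy] at pullback_bracket
  have pullback_eventuallyEq (Z : ∀ x : M, TangentSpace (𝓡 3) x) :
      VectorField.mpullback 𝓘(ℝ, E3) (𝓡 3) (extChartAt (𝓡 3) x₀).symm Z =ᶠ[nhds y]
        chartVec Z x₀ := by
    filter_upwards [target_mem_nhds] with z hz
    exact mpullback_eq_chartVec Z hz
  exact pullback_bracket.trans ((Filter.EventuallyEq.mlieBracket_vectorField_eq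
    (pullback_eventuallyEq X) (pullback_eventuallyEq Y)).trans
      (congrFun (mlieBracket_eq_lieBracket _ _) y))

theorem mvfderiv_chart {h : M → ℝ} (hy : y ∈ (extChartAt (𝓡 3) x₀).target)
    (hh : DifferentiableAt ℝ (chartFun h x₀) y) (X : ∀ x : M, TangentSpace (𝓡 3) x) :
    mvfderiv (𝓡 3) h ((extChartAt (𝓡 3) x₀).symm y) (X ((extChartAt (𝓡 3) x₀).symm y)) =
      fderiv ℝ (chartFun h x₀) y (chartVec X x₀ y) := by
  have := isManifold_one (M := M)
  have differentiable_chart := mdifferentiableAt_extChartAt (I := 𝓡 3)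
    (extChartAt_symm_mem_chart_source hy)
  have deriv_chartFun : HasFDerivAt (chartFun h x₀) (fderiv ℝ (chartFun h x₀) y)
      (extChartAt (𝓡 3) x₀ ((extChartAt (𝓡 3) x₀).symm y)) := by
    rw [(extChartAt (𝓡 3) x₀).right_inv hy]
    exact hh.hasFDerivAt
  have deriv_comp := deriv_chartFun.hasMFDerivAt.comp _ differentiable_chart.hasMFDerivAt
  have eq_comp : h =ᶠ[nhds ((extChartAt (𝓡 3) x₀).symm y)]
      chartFun h x₀ ∘ extChartAt (𝓡 3) x₀ := by
    filter_upwards [(isOpen_extChartAt_source x₀).mem_nhds ((extChartAt (𝓡 3) x₀).map_target hy)]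
      with z hz
    simp only [Function.comp_apply, chartFun, (extChartAt (𝓡 3) x₀).left_inv hz]
  rw [mvfderiv, ContinuousLinearMap.comp_apply,
    (deriv_comp.congr_of_eventuallyEq eq_comp).mfderiv]
  rfl

theorem lieDerivMetric_extChartAt_symm
    {g : ∀ x : M, TangentSpace (𝓡 3) x →L[ℝ] TangentSpace (𝓡 3) x →L[ℝ] ℝ}
    {U X Y : ∀ x : M, TangentSpace (𝓡 3) x} (hy : y ∈ (extChartAt (𝓡 3) x₀).target)
    (hg : DifferentiableAt ℝ (chartTensor g x₀) y)
    (hU : MDifferentiableFieldAt U ((extChartAt (𝓡 3) x₀).symm y))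
    (hX : MDifferentiableFieldAt X ((extChartAt (𝓡 3) x₀).symm y))
    (hY : MDifferentiableFieldAt Y ((extChartAt (𝓡 3) x₀).symm y)) :
    lieDerivMetric g U X Y ((extChartAt (𝓡 3) x₀).symm y) =
      chartLieForm g U x₀ y (chartVec X x₀ y) (chartVec Y x₀ y) := by
  have dX := differentiableAt_chartVec hy hX
  have dY := differentiableAt_chartVec hy hY
  have chart_pairing : chartFun (fun z => g z (X z) (Y z)) x₀ =ᶠ[nhds y]
      fun z => chartTensor g x₀ z (chartVec X x₀ z) (chartVec Y x₀ z) := by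
    filter_upwards [(isOpen_extChartAt_target x₀).mem_nhds hy] with z hz
    exact (chartTensor_chartVec g X Y hz).symm
  have leibniz := fderivWithin_clm_apply₂_apply (uniqueDiffWithinAt_univ (x := y))
    hg.differentiableWithinAt dX.differentiableWithinAt dY.differentiableWithinAt (chartVec U x₀ y)
  simp only [fderivWithin_univ] at leibniz
  rw [lieDerivMetric, mvfderiv_chart hy
      (((hg.clm_apply dX).clm_apply dY).congr_of_eventuallyEq chart_pairing) U,
    chart_pairing.fderiv_eq, leibniz, ← chartTensor_chartVec g _ _ hy,
    ← chartTensor_chartVec g _ _ hy, chartVec_mlieBracket hy hU hX, chartVec_mlieBracket hy hU hY]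
  simp only [chartLieForm, map_sub, sub_apply, add_apply, ContinuousLinearMap.comp_apply,
    ContinuousLinearMap.flip_apply]
  ring

end Charts

section ChartFields

variable {M : Type*} [TopologicalSpace M] [ChartedSpace E3 M] [IsManifold (𝓡 3) ∞ M]
  {J : Set ℝ} {f : ℝ → M → ℝ}
  {g : ℝ → ∀ x : M, TangentSpace (𝓡 3) x →L[ℝ] TangentSpace (𝓡 3) x →L[ℝ] ℝ}
  {U : ℝ → ∀ x : M, TangentSpace (𝓡 3) x}
  {T : ℝ → ∀ x : M, TangentSpace (𝓡 3) x →L[ℝ] TangentSpace (𝓡 3) x →L[ℝ] ℝ}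

theorem uniqueDiffOn_of_ordConnected (hJ : J.OrdConnected) (hJ' : J.Nontrivial) :
    UniqueDiffOn ℝ J :=
  uniqueDiffOn_convex hJ.convex (hJ.convex.nontrivial_iff_nonempty_interior.1 hJ')

theorem subset_closure_interior_prod {E : Type*} [TopologicalSpace E] {V : Set E}
    (hJ : J.OrdConnected) (hJ' : J.Nontrivial) (hV : IsOpen V) :
    J ×ˢ V ⊆ closure (interior (J ×ˢ V)) := by
  rw [interior_prod_eq, closure_prod_eq, hV.interior_eq]
  have convex_J := hJ.convex (𝕜 := ℝ)
  have closure_eq := convex_J.closure_interior_eq_closure_of_nonempty_interior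
    (convex_J.nontrivial_iff_nonempty_interior.1 hJ')
  exact prod_mono (subset_closure.trans closure_eq.ge) subset_closure

theorem fderiv_slice {F : Type*} [NormedAddCommGroup F] [NormedSpace ℝ F] {Q : ℝ × E3 → F}
    {V : Set E3} {t : ℝ} {y : E3} (hV : IsOpen V) (ht : t ∈ J) (hy : y ∈ V)
    (hQ : DifferentiableWithinAt ℝ Q (J ×ˢ V) (t, y)) :
    fderiv ℝ (fun z => Q (t, z)) y = spatialDeriv Q (J ×ˢ V) (t, y) := by
  rw [← fderivWithin_of_isOpen hV hy, fderivWithin_slice (hV.uniqueDiffWithinAt hy) ht hQ]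

namespace IsEvolvingTriple

variable (h : IsEvolvingTriple J f g U)
include h

theorem isUnitField (hJ : J.OrdConnected) (hJ' : J.Nontrivial) (x₀ : M) :
    IsUnitField (timeChartTensor g x₀) (timeChartVec U x₀) (timeChartDomain J x₀) where
  uniqueDiffOn :=
    (uniqueDiffOn_of_ordConnected hJ hJ').prod (isOpen_extChartAt_target x₀).uniqueDiffOn
  subset_closure_interior := subset_closure_interior_prod hJ hJ' (isOpen_extChartAt_target x₀)
  contDiffOn_metric := contDiffOn_timeChartTensor h.smooth_g x₀
  symm p hp _ _ := by
    rw [timeChartTensor, chartTensor_apply, chartTensor_apply]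
    exact h.symm p.1 hp.1 _ _ _
  pos p hp _ hv := by
    rw [timeChartTensor, chartTensor_apply]
    exact h.pos p.1 hp.1 _ _ (chartInvDeriv_ne_zero hp.2 hv)
  contDiffOn_field := contDiffOn_timeChartVec h.smooth_U x₀
  unit p hp := (chartTensor_chartVec _ _ _ hp.2).trans (h.unit p.1 hp.1 _)

theorem isSlicedSpacetime (hJ : J.OrdConnected) (hJ' : J.Nontrivial) (x₀ : M) :
    IsSlicedSpacetime (timeChartFun f x₀) (timeChartTensor g x₀) (timeChartDomain J x₀) where
  toIsSliceMetric := (h.isUnitField hJ hJ' x₀).toIsSliceMetric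
  contDiffOn_lapse := contDiffOn_timeChartFun h.smooth_f x₀
  lapse_ne_zero p hp := h.f_ne p.1 hp.1 _

theorem isEvolving (he : Evolves J f g U T) (hJ : J.OrdConnected) (hJ' : J.Nontrivial) (x₀ : M) :
    IsEvolving (timeChartFun f x₀) (timeChartTensor g x₀) (timeChartVec U x₀)
      (timeChartDomain J x₀) :=
  EvolvesOn.isEvolving (T := timeChartTensor T x₀) (he x₀) (h.isSlicedSpacetime hJ hJ' x₀)
    (h.isUnitField hJ hJ' x₀) (uniqueDiffOn_of_ordConnected hJ hJ')
    (isOpen_extChartAt_target x₀).uniqueDiffOn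

theorem quadAt (he : Evolves J f g U T) (hQ : QuadCondition J f g U T) (hJ : J.OrdConnected)
    (hJ' : J.Nontrivial) (x₀ : M) {p : ℝ × E3} (hp : p ∈ timeChartDomain J x₀) :
    QuadAt (timeChartFun f x₀) (timeChartTensor g x₀) (timeChartVec U x₀)
      (timeChartDomain J x₀) p :=
  EvolvesOn.quadAt (T := timeChartTensor T x₀) (he x₀) (h.isSlicedSpacetime hJ hJ' x₀)
    (h.isUnitField hJ hJ' x₀) (uniqueDiffOn_of_ordConnected hJ hJ')
    (isOpen_extChartAt_target x₀).uniqueDiffOn (hQ x₀) hp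

theorem mdifferentiableFieldAt {t : ℝ} (ht : t ∈ J) (x : M) : MDifferentiableFieldAt (U t) x :=
  (contMDiffOn_univ.1 (h.smooth_U.comp (contMDiffOn_univ.2 (contMDiff_const.prodMk contMDiff_id))
    fun _ _ => ⟨ht, mem_univ _⟩)).contMDiffAt.mdifferentiableAt (by simp)

end IsEvolvingTriple

end ChartFields

/-! ### Integral curves of `∂_t + fU` -/

section AutonomousFlow

variable {𝕜 D : Type*} [NontriviallyNormedField 𝕜] [NormedAddCommGroup D] [NormedSpace 𝕜 D]
  {F : D → D} {S : Set D} {c : 𝕜 → D} {s : Set 𝕜} {τ : 𝕜}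

theorem contDiffOn_of_hasDerivWithinAt_comp {n : ℕ} (hs : UniqueDiffOn 𝕜 s)
    (hF : ContDiffOn 𝕜 n F S) (hc : MapsTo c s S)
    (hd : ∀ r ∈ s, HasDerivWithinAt c (F (c r)) s r) : ContDiffOn 𝕜 (n + 1) c s := by
  have differentiable : DifferentiableOn 𝕜 c s := fun r hr => (hd r hr).differentiableWithinAt
  have contDiff_of_velocity {k : ℕ} (hF : ContDiffOn 𝕜 k F S) (hk : ContDiffOn 𝕜 k c s) :
      ContDiffOn 𝕜 (k + 1) c s :=
    (contDiffOn_succ_iff_derivWithin hs).2 ⟨differentiable, by simp,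
      (hF.comp hk hc).congr fun r hr => (hd r hr).derivWithin (hs r hr)⟩
  induction n with
  | zero => exact contDiff_of_velocity hF (contDiffOn_zero.2 differentiable.continuousOn)
  | succ k ih =>
    exact contDiff_of_velocity hF (by exact_mod_cast ih (hF.of_le (by norm_cast; omega)))

theorem derivWithin_derivWithin_of_hasDerivWithinAt_comp (hs : UniqueDiffOn 𝕜 s)
    (hc : MapsTo c s S) (hd : ∀ r ∈ s, HasDerivWithinAt c (F (c r)) s r) (hτ : τ ∈ s)
    (hF : DifferentiableWithinAt 𝕜 F S (c τ)) :
    derivWithin (derivWithin c s) s τ = fderivWithin 𝕜 F S (c τ) (F (c τ)) := by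
  rw [derivWithin_congr (f := F ∘ c) (fun r hr => (hd r hr).derivWithin (hs r hr))
    ((hd τ hτ).derivWithin (hs τ hτ))]
  exact (hF.hasFDerivWithinAt.comp_hasDerivWithinAt τ (hd τ hτ) hc).derivWithin (hs τ hτ)

end AutonomousFlow

section Geodesics

variable {M : Type*} [TopologicalSpace M] [ChartedSpace E3 M] {J : Set ℝ} {f : ℝ → M → ℝ}
  {g : ℝ → ∀ x : M, TangentSpace (𝓡 3) x →L[ℝ] TangentSpace (𝓡 3) x →L[ℝ] ℝ}
  {U : ℝ → ∀ x : M, TangentSpace (𝓡 3) x}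
  {T : ℝ → ∀ x : M, TangentSpace (𝓡 3) x →L[ℝ] TangentSpace (𝓡 3) x →L[ℝ] ℝ}
  {γ : ℝ → ℝ × M} {s : Set ℝ} {τ : ℝ} {x₀ : M}

/-- The coordinate expression, in `ℝ × E3`, of the field `∂_t + fU`. -/
abbrev chartNullField (f : ℝ → M → ℝ) (U : ℝ → ∀ x : M, TangentSpace (𝓡 3) x) (x₀ : M)
    (q : ℝ × E3) : ℝ × E3 :=
  (1, timeChartFun f x₀ q • timeChartVec U x₀ q)

/-- The coordinate expression of a curve in `ℝ × M`. -/
abbrev chartCurve (γ : ℝ → ℝ × M) (x₀ : M) (r : ℝ) : ℝ × E3 :=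
  timeChart x₀ (γ r)

theorem exists_isOpen_mapsTo_chart_source (hγ : ContinuousOn γ s) (hτ : τ ∈ s)
    (hx : (γ τ).2 ∈ (extChartAt (𝓡 3) x₀).source) :
    ∃ O : Set ℝ, IsOpen O ∧ τ ∈ O ∧ ∀ r ∈ s ∩ O, (γ r).2 ∈ (extChartAt (𝓡 3) x₀).source := by
  obtain ⟨O, hO, hτO, hsub⟩ := mem_nhdsWithin.1
    ((hγ.snd τ hτ).preimage_mem_nhdsWithin ((isOpen_extChartAt_source x₀).mem_nhds hx))
  exact ⟨O, hO, hτO, fun r hr => hsub ⟨hr.2, hr.1⟩⟩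

section IntegralCurve

variable (hγ : IsMIntegralCurveOn (I := 𝓘(ℝ, ℝ).prod (𝓡 3)) γ (nullField f U) s)
include hγ

theorem hasDerivWithinAt_time_of_integralCurve (hτ : τ ∈ s) :
    HasDerivWithinAt (fun r => (γ r).1) 1 s τ := by
  have deriv_comp : HasFDerivWithinAt (fun r => (γ r).1) ((ContinuousLinearMap.fst ℝ ℝ E3).comp
      ((1 : ℝ →L[ℝ] ℝ).smulRight ((1 : ℝ), (f (γ τ).1 (γ τ).2 • U (γ τ).1 (γ τ).2 : E3)))) s τ :=
    ((hasMFDerivAt_fst (I := 𝓘(ℝ, ℝ)) (I' := 𝓡 3) (γ τ)).comp_hasMFDerivWithinAt τ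
      (hγ τ hτ)).hasFDerivWithinAt
  exact deriv_comp.hasDerivWithinAt.congr_deriv (by simp)

omit hγ in
theorem hasDerivWithinAt_of_comp_snd {c : ℝ → E3} {L : E3 →L[ℝ] E3} {v : E3}
    (hc : HasFDerivWithinAt c (L.comp ((ContinuousLinearMap.snd ℝ ℝ E3).comp
      ((1 : ℝ →L[ℝ] ℝ).smulRight ((1 : ℝ), v)))) s τ) : HasDerivWithinAt c (L v) s τ :=
  hc.hasDerivWithinAt.congr_deriv (by simp)

variable [IsManifold (𝓡 3) ∞ M]

theorem hasDerivWithinAt_chartCurve (hτ : τ ∈ s)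
    (hx : (γ τ).2 ∈ (extChartAt (𝓡 3) x₀).source) :
    HasDerivWithinAt (chartCurve γ x₀) (chartNullField f U x₀ (chartCurve γ x₀ τ)) s τ := by
  have := isManifold_one (M := M)
  have left_inv := (extChartAt (𝓡 3) x₀).left_inv hx
  have differentiable_chart : MDifferentiableAt (𝓡 3) 𝓘(ℝ, E3) (extChartAt (𝓡 3) x₀) (γ τ).2 :=
    mdifferentiableAt_extChartAt (by rwa [← extChartAt_source (𝓡 3)])
  have chart_deriv : HasFDerivWithinAt (fun r => extChartAt (𝓡 3) x₀ (γ r).2)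
      ((mfderiv (𝓡 3) 𝓘(ℝ, E3) (extChartAt (𝓡 3) x₀) (γ τ).2 : E3 →L[ℝ] E3).comp
        ((ContinuousLinearMap.snd ℝ ℝ E3).comp ((1 : ℝ →L[ℝ] ℝ).smulRight
          ((1 : ℝ), (f (γ τ).1 (γ τ).2 • U (γ τ).1 (γ τ).2 : E3))))) s τ :=
    (differentiable_chart.hasMFDerivAt.comp_hasMFDerivWithinAt τ
      ((hasMFDerivAt_snd (I := 𝓘(ℝ, ℝ)) (I' := 𝓡 3) (γ τ)).comp_hasMFDerivWithinAt τ
        (hγ τ hτ))).hasFDerivWithinAt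
  refine ((hasDerivWithinAt_time_of_integralCurve hγ hτ).prodMk
    (hasDerivWithinAt_of_comp_snd chart_deriv)).congr_deriv ?_
  rw [chartNullField, timeChartFun_timeChart hx, timeChartVec, chartVec, left_inv]
  have smul_eq (L : E3 →L[ℝ] E3) (a : ℝ) (v : E3) : ((1 : ℝ), L (a • v)) = (1, a • L v) := by simp
  exact smul_eq _ _ _

theorem hasDerivWithinAt_comp_of_integralCurve (hγJ : ∀ r ∈ s, (γ r).1 ∈ J) (hτ : τ ∈ s)
    (hx : (γ τ).2 ∈ (extChartAt (𝓡 3) x₀).source) {k : ℝ → M → ℝ}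
    (hk : DifferentiableWithinAt ℝ (timeChartFun k x₀) (timeChartDomain J x₀)
      (chartCurve γ x₀ τ)) :
    HasDerivWithinAt (fun r => k (γ r).1 (γ r).2)
      (fderivWithin ℝ (timeChartFun k x₀) (timeChartDomain J x₀) (chartCurve γ x₀ τ)
        (chartNullField f U x₀ (chartCurve γ x₀ τ))) s τ := by
  obtain ⟨O, hO, hτO, hsource⟩ :=
    exists_isOpen_mapsTo_chart_source hγ.continuousOn hτ hx
  have chart_deriv := hk.hasFDerivWithinAt.comp_hasDerivWithinAt τ
    ((hasDerivWithinAt_chartCurve hγ hτ hx).mono inter_subset_left)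
    fun r hr => timeChart_mem (hγJ r hr.1) (hsource r hr)
  rw [← hasDerivWithinAt_inter (hO.mem_nhds hτO)]
  exact chart_deriv.congr_of_mem (fun r hr => (timeChartFun_timeChart (hsource r hr) k).symm)
    ⟨hτ, hτO⟩

theorem exists_isOpen_chartCurve (hγJ : ∀ r ∈ s, (γ r).1 ∈ J) (hτ : τ ∈ s)
    (hx : (γ τ).2 ∈ (extChartAt (𝓡 3) x₀).source) :
    ∃ O : Set ℝ, IsOpen O ∧ τ ∈ O ∧ MapsTo (chartCurve γ x₀) (s ∩ O) (timeChartDomain J x₀) ∧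
      ∀ r ∈ s ∩ O, HasDerivWithinAt (chartCurve γ x₀)
        (chartNullField f U x₀ (chartCurve γ x₀ r)) (s ∩ O) r := by
  obtain ⟨O, hO, hτO, hsource⟩ := exists_isOpen_mapsTo_chart_source hγ.continuousOn hτ hx
  exact ⟨O, hO, hτO, fun r hr => timeChart_mem (hγJ r hr.1) (hsource r hr), fun r hr =>
    (hasDerivWithinAt_chartCurve hγ hr.1 (hsource r hr)).mono inter_subset_left⟩

end IntegralCurve

namespace IsEvolvingTriple

variable [IsManifold (𝓡 3) ∞ M] (h : IsEvolvingTriple J f g U)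
include h

theorem contDiffOn_chartNullField (x₀ : M) :
    ContDiffOn ℝ ∞ (chartNullField f U x₀) (timeChartDomain J x₀) :=
  contDiffOn_const.prodMk
    ((contDiffOn_timeChartFun h.smooth_f x₀).smul (contDiffOn_timeChartVec h.smooth_U x₀))

variable (hγ : IsMIntegralCurveOn (I := 𝓘(ℝ, ℝ).prod (𝓡 3)) γ (nullField f U) s)
  (hγJ : ∀ r ∈ s, (γ r).1 ∈ J) (hs : UniqueDiffOn ℝ s)
include hγ hγJ hs

theorem contDiffWithinAt_chartCurve (hτ : τ ∈ s)
    (hx : (γ τ).2 ∈ (extChartAt (𝓡 3) x₀).source) :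
    ContDiffWithinAt ℝ 2 (chartCurve γ x₀) s τ := by
  obtain ⟨O, hO, hτO, hmaps, hderiv⟩ := exists_isOpen_chartCurve hγ hγJ hτ hx
  have smooth := contDiffOn_of_hasDerivWithinAt_comp (n := 1) (hs.inter hO)
    ((h.contDiffOn_chartNullField x₀).of_le (by simp)) hmaps hderiv τ ⟨hτ, hτO⟩
  rw [← contDiffWithinAt_inter (hO.mem_nhds hτO)]
  exact smooth.of_le (by norm_num)

theorem derivWithin_derivWithin_chartCurve (hτ : τ ∈ s)
    (hx : (γ τ).2 ∈ (extChartAt (𝓡 3) x₀).source) :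
    derivWithin (derivWithin (chartCurve γ x₀) s) s τ =
      fderivWithin ℝ (chartNullField f U x₀) (timeChartDomain J x₀) (chartCurve γ x₀ τ)
        (chartNullField f U x₀ (chartCurve γ x₀ τ)) := by
  obtain ⟨O, hO, hτO, hmaps, hderiv⟩ := exists_isOpen_chartCurve hγ hγJ hτ hx
  calc derivWithin (derivWithin (chartCurve γ x₀) s) s τ
      = derivWithin (derivWithin (chartCurve γ x₀) s) (s ∩ O) τ :=
        (derivWithin_inter (hO.mem_nhds hτO)).symm
    _ = derivWithin (derivWithin (chartCurve γ x₀) (s ∩ O)) (s ∩ O) τ :=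
        derivWithin_congr (fun r hr => (derivWithin_inter (hO.mem_nhds hr.2)).symm)
          (derivWithin_inter (hO.mem_nhds hτO)).symm
    _ = _ := derivWithin_derivWithin_of_hasDerivWithinAt_comp (hs.inter hO) hmaps hderiv ⟨hτ, hτO⟩
      ((h.contDiffOn_chartNullField x₀).differentiableOn (by simp) _ (hmaps ⟨hτ, hτO⟩))

theorem contDiffOn_lapse_of_integralCurve : ContDiffOn ℝ 1 (fun r => f (γ r).1 (γ r).2) s := by
  intro τ hτ
  have hx := mem_extChartAt_source (I := 𝓡 3) (γ τ).2
  obtain ⟨O, hO, hτO, hsource⟩ := exists_isOpen_mapsTo_chart_source hγ.continuousOn hτ hx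
  have smooth_curve := (h.contDiffWithinAt_chartCurve hγ hγJ hs hτ hx).of_le
    (m := 1) (by norm_num)
  have smooth_comp := (((contDiffOn_timeChartFun h.smooth_f (γ τ).2).of_le (by simp)) _
    (timeChart_mem (hγJ τ hτ) hx)).comp τ (smooth_curve.mono inter_subset_left)
    fun r hr => timeChart_mem (hγJ r hr.1) (hsource r hr)
  rw [← contDiffWithinAt_inter (hO.mem_nhds hτO)]
  exact smooth_comp.congr_of_mem
    (fun r hr => (timeChartFun_timeChart (hsource r hr) f).symm) ⟨hτ, hτO⟩

omit hγ hγJ hs in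
theorem lorentzMetric_chartNullField (hJ : J.OrdConnected) (hJ' : J.Nontrivial) {q : ℝ × E3}
    (hq : q ∈ timeChartDomain J x₀) :
    lorentzMetric (timeChartFun f x₀) (timeChartTensor g x₀) q (chartNullField f U x₀ q)
      (chartNullField f U x₀ q) = 0 := by
  rw [lorentzMetric_apply, map_smul, map_smul, smul_apply, (h.isUnitField hJ hJ' x₀).unit q hq]
  simp only [smul_eq_mul]
  ring

theorem isNullGeodesicOn (he : Evolves J f g U T) (hJ : J.OrdConnected) (hJ' : J.Nontrivial) :
    IsNullGeodesicOn J f g γ s := by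
  have smooth_lapse := h.contDiffOn_lapse_of_integralCurve hγ hγJ hs
  refine ⟨fun τ => derivWithin (fun r => f (γ r).1 (γ r).2) s τ / f (γ τ).1 (γ τ).2,
    (smooth_lapse.continuousOn_derivWithin hs le_rfl).div smooth_lapse.continuousOn
      fun τ hτ => h.f_ne _ (hγJ τ hτ) _, fun x₀ τ hτ hx => ?_⟩
  intro c c' G
  have mem_domain := timeChart_mem (hγJ τ hτ) hx
  have velocity : c' τ = chartNullField f U x₀ (c τ) :=
    (hasDerivWithinAt_chartCurve hγ hτ hx).derivWithin (hs τ hτ)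
  have acceleration : derivWithin c' s τ = fderivWithin ℝ (chartNullField f U x₀)
      (timeChartDomain J x₀) (c τ) (chartNullField f U x₀ (c τ)) :=
    h.derivWithin_derivWithin_chartCurve hγ hγJ hs hτ hx
  have lapse_rate := (hasDerivWithinAt_comp_of_integralCurve hγ hγJ hτ hx
    ((h.isSlicedSpacetime hJ hJ' x₀).differentiableWithinAt_lapse mem_domain)).derivWithin (hs τ hτ)
  refine ⟨h.contDiffWithinAt_chartCurve hγ hγJ hs hτ hx, ?_, ?_, ?_⟩
  · rw [velocity]
    exact fun eq_zero => one_ne_zero (congrArg Prod.fst eq_zero)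
  · rw [velocity]
    exact h.lorentzMetric_chartNullField hJ hJ' mem_domain
  · beta_reduce
    rw [velocity, acceleration, lapse_rate, ← timeChartFun_timeChart hx f]
    exact (h.isEvolving he hJ hJ' x₀).nabla_nullField mem_domain

end IsEvolvingTriple

end Geodesics

/-! ### The shear of a unit vector field -/

section ShearOfField

variable {M : Type*} [TopologicalSpace M] [ChartedSpace E3 M]
  {g : ∀ x : M, TangentSpace (𝓡 3) x →L[ℝ] TangentSpace (𝓡 3) x →L[ℝ] ℝ}
  {U X Y : ∀ x : M, TangentSpace (𝓡 3) x} {A : Set M} {x x₀ : M} {y : E3}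

/-- The Lie derivative `ℒ_U g` as a bilinear form on the tangent space at `x`. -/
def lieDerivForm (g : ∀ x : M, TangentSpace (𝓡 3) x →L[ℝ] TangentSpace (𝓡 3) x →L[ℝ] ℝ)
    (U : ∀ x : M, TangentSpace (𝓡 3) x) (x : M) : E3 →L[ℝ] E3 →L[ℝ] ℝ :=
  (chartLieForm g U x (extChartAt (𝓡 3) x x)).bilinearComp (chartDeriv x (extChartAt (𝓡 3) x x))
    (chartDeriv x (extChartAt (𝓡 3) x x))

/-- The squared shear of the unit vector field `U` at `x`: it vanishes if and only if `ℒ_U g` is a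
multiple of `g` on the plane orthogonal to `U`. -/
def squaredShear (g : ∀ x : M, TangentSpace (𝓡 3) x →L[ℝ] TangentSpace (𝓡 3) x →L[ℝ] ℝ)
    (U : ∀ x : M, TangentSpace (𝓡 3) x) (x : M) : ℝ :=
  orthogonalShear (E := E3) (g x) (U x) (lieDerivForm g U x)

theorem lieDerivMetric_symm (hg : ∀ x v w, g x v w = g x w v) :
    lieDerivMetric g U X Y x = lieDerivMetric g U Y X x := by
  have pairing_symm : (fun z => g z (X z) (Y z)) = fun z => g z (Y z) (X z) :=
    funext fun z => hg z _ _
  rw [lieDerivMetric, lieDerivMetric, pairing_symm, hg x (X x), hg x _ (Y x)]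
  ring

variable [IsManifold (𝓡 3) ∞ M]

theorem exists_mdifferentiableFieldAt_eq (x : M) (v : E3) :
    ∃ X : ∀ x : M, TangentSpace (𝓡 3) x, MDifferentiableFieldAt X x ∧ X x = v := by
  let v' : E3 := chartDeriv x (extChartAt (𝓡 3) x x) v
  refine ⟨fun z => chartInvDeriv x (extChartAt (𝓡 3) x z) v', ?_,
    chartInvDeriv_chartDeriv (mem_extChartAt_target x) v⟩
  have smooth_chart : ContMDiffOn (𝓡 3) 𝓘(ℝ, ℝ × E3) ∞
      (fun z : M => ((0 : ℝ), extChartAt (𝓡 3) x z)) (extChartAt (𝓡 3) x).source := by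
    rw [extChartAt_source]
    exact contMDiffOn_const.prodMk_space contMDiffOn_extChartAt
  have mk_congr (z z' : M) (h : z = z') (a : E3) :
      (⟨z, a⟩ : TangentBundle (𝓡 3) M) = ⟨z', a⟩ := by
    subst h
    rfl
  have smooth_field : ContMDiffOn (𝓡 3) ((𝓡 3).prod 𝓘(ℝ, E3)) ∞
      (fun z => (⟨z, chartInvDeriv x (extChartAt (𝓡 3) x z) v'⟩ : TangentBundle (𝓡 3) M))
      (extChartAt (𝓡 3) x).source :=
    ((contMDiffOn_chartInvDeriv univ x v').comp smooth_chart fun z hz =>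
      ⟨mem_univ _, (extChartAt (𝓡 3) x).map_source hz⟩).congr fun z hz =>
        mk_congr _ _ ((extChartAt (𝓡 3) x).left_inv hz).symm _
  exact (smooth_field.contMDiffAt (extChartAt_source_mem_nhds x)).mdifferentiableAt (by simp)

/-- `g` is a Riemannian metric and `U` a unit vector field, both differentiable. -/
structure IsRiemannianUnitField
    (g : ∀ x : M, TangentSpace (𝓡 3) x →L[ℝ] TangentSpace (𝓡 3) x →L[ℝ] ℝ)
    (U : ∀ x : M, TangentSpace (𝓡 3) x) : Prop where
  symm : ∀ x v w, g x v w = g x w v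
  pos : ∀ x v, v ≠ 0 → 0 < g x v v
  unit : ∀ x, g x (U x) (U x) = 1
  differentiable_metric : ∀ x₀, ∀ y ∈ (extChartAt (𝓡 3) x₀).target,
    DifferentiableAt ℝ (chartTensor g x₀) y
  differentiable_field : ∀ x, MDifferentiableFieldAt U x

namespace IsRiemannianUnitField

variable (h : IsRiemannianUnitField g U)
include h

theorem exists_isFrame (x : M) : ∃ X Y : E3, IsFrame (E := E3) (g x) X Y (U x) :=
  SlicedSpacetime.exists_isFrame (E := E3) (by simp) (h.symm x) (h.pos x) (h.unit x)

theorem chartLieForm_apply (hy : y ∈ (extChartAt (𝓡 3) x₀).target)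
    (hX : MDifferentiableFieldAt X ((extChartAt (𝓡 3) x₀).symm y))
    (hY : MDifferentiableFieldAt Y ((extChartAt (𝓡 3) x₀).symm y)) :
    chartLieForm g U x₀ y (chartVec X x₀ y) (chartVec Y x₀ y) =
      lieDerivMetric g U X Y ((extChartAt (𝓡 3) x₀).symm y) :=
  (lieDerivMetric_extChartAt_symm hy (h.differentiable_metric x₀ y hy)
    (h.differentiable_field _) hX hY).symm

theorem lieDerivForm_apply (hX : MDifferentiableFieldAt X x) (hY : MDifferentiableFieldAt Y x) :
    lieDerivForm g U x (X x) (Y x) = lieDerivMetric g U X Y x := by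
  have symm_self := extChartAt_to_inv (I := 𝓡 3) x
  have chart_eq := h.chartLieForm_apply (X := X) (Y := Y) (mem_extChartAt_target x)
    (by rwa [symm_self]) (by rwa [symm_self])
  rw [chartVec_eq, chartVec_eq, symm_self] at chart_eq
  exact chart_eq

theorem lieDerivForm_symm (x : M) (v w : E3) :
    lieDerivForm g U x v w = lieDerivForm g U x w v := by
  obtain ⟨X, hX, rfl⟩ := exists_mdifferentiableFieldAt_eq x v
  obtain ⟨Y, hY, rfl⟩ := exists_mdifferentiableFieldAt_eq x w
  exact (h.lieDerivForm_apply hX hY).trans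
    ((lieDerivMetric_symm h.symm).trans (h.lieDerivForm_apply hY hX).symm)

theorem chartLieForm_eq (hy : y ∈ (extChartAt (𝓡 3) x₀).target) (v w : E3) :
    chartLieForm g U x₀ y v w =
      lieDerivForm g U ((extChartAt (𝓡 3) x₀).symm y) (chartInvDeriv x₀ y v)
        (chartInvDeriv x₀ y w) := by
  obtain ⟨X, hX, X_eq⟩ :=
    exists_mdifferentiableFieldAt_eq ((extChartAt (𝓡 3) x₀).symm y) (chartInvDeriv x₀ y v)
  obtain ⟨Y, hY, Y_eq⟩ :=
    exists_mdifferentiableFieldAt_eq ((extChartAt (𝓡 3) x₀).symm y) (chartInvDeriv x₀ y w)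
  have chart_eq := h.chartLieForm_apply hy hX hY
  rw [chartVec_eq, chartVec_eq, X_eq, Y_eq, chartDeriv_chartInvDeriv hy,
    chartDeriv_chartInvDeriv hy, ← h.lieDerivForm_apply hX hY, X_eq, Y_eq] at chart_eq
  exact chart_eq

theorem squaredShear_eq {X Y : E3} (hF : IsFrame (E := E3) (g x) X Y (U x)) :
    squaredShear g U x = shearNorm (lieDerivForm g U x) X Y :=
  hF.orthogonalShear_eq finrank_E3 (h.symm x) _

theorem squaredShear_nonneg (x : M) : 0 ≤ squaredShear g U x := by
  obtain ⟨X, Y, hF⟩ := h.exists_isFrame x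
  rw [h.squaredShear_eq hF]
  exact shearNorm_nonneg _ _ _

theorem squaredShear_eq_chart (hy : y ∈ (extChartAt (𝓡 3) x₀).target) {X Y : E3}
    (hF : IsFrame (chartTensor g x₀ y) X Y (chartVec U x₀ y)) :
    squaredShear g U ((extChartAt (𝓡 3) x₀).symm y) = shearNorm (chartLieForm g U x₀ y) X Y := by
  have U_eq := chartInvDeriv_chartVec U hy
  have hF' : IsFrame (E := E3) (g ((extChartAt (𝓡 3) x₀).symm y)) (chartInvDeriv x₀ y X)
      (chartInvDeriv x₀ y Y) (U ((extChartAt (𝓡 3) x₀).symm y)) := by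
    rw [← U_eq]
    exact ⟨hF.xx, hF.yy, hF.nn, hF.xy, hF.xn, hF.yn⟩
  simp only [h.squaredShear_eq hF', shearNorm, plusPart, crossPart, h.chartLieForm_eq hy]

theorem isTangentToConformalFoliationOn_iff :
    IsTangentToConformalFoliationOn g U A ↔ ∀ x ∈ A, squaredShear g U x = 0 := by
  constructor
  · rintro ⟨a, ha⟩ x hx
    obtain ⟨X, Y, hF⟩ := h.exists_isFrame x
    refine (h.squaredShear_eq hF).trans
      (hF.shearNorm_eq_zero (a := a x) (h.symm x) fun v w hv hw => ?_)
    obtain ⟨V, hV, rfl⟩ := exists_mdifferentiableFieldAt_eq x v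
    obtain ⟨W, hW, rfl⟩ := exists_mdifferentiableFieldAt_eq x w
    exact (h.lieDerivForm_apply hV hW).trans
      (ha x hx V W hV hW ((h.symm x _ _).trans hv) ((h.symm x _ _).trans hw))
  · intro shear_eq_zero
    choose X Y hF using h.exists_isFrame
    refine ⟨fun x => lieDerivForm g U x (X x) (X x), fun x hx P Q hP hQ hPU hQU => ?_⟩
    rw [← h.lieDerivForm_apply hP hQ]
    exact (hF x).apply_eq_of_shearNorm_eq_zero finrank_E3 (h.symm x) (h.lieDerivForm_symm x)
      ((h.squaredShear_eq (hF x)).symm.trans (shear_eq_zero x hx)) ((h.symm x _ _).trans hPU)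
      ((h.symm x _ _).trans hQU)

end IsRiemannianUnitField

end ShearOfField

section ShearOfTriple

variable {M : Type*} [TopologicalSpace M] [ChartedSpace E3 M] [IsManifold (𝓡 3) ∞ M]
  {J : Set ℝ} {f : ℝ → M → ℝ}
  {g : ℝ → ∀ x : M, TangentSpace (𝓡 3) x →L[ℝ] TangentSpace (𝓡 3) x →L[ℝ] ℝ}
  {U : ℝ → ∀ x : M, TangentSpace (𝓡 3) x} {x₀ : M} {q : ℝ × E3}

/-- The squared shear of `U_t` with respect to `g_t`. -/
abbrev timeShear (g : ℝ → ∀ x : M, TangentSpace (𝓡 3) x →L[ℝ] TangentSpace (𝓡 3) x →L[ℝ] ℝ)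
    (U : ℝ → ∀ x : M, TangentSpace (𝓡 3) x) (t : ℝ) (x : M) : ℝ :=
  squaredShear (g t) (U t) x

namespace IsEvolvingTriple

variable (h : IsEvolvingTriple J f g U)
include h

theorem chartLieForm_eq_lieForm (hJ : J.OrdConnected) (hJ' : J.Nontrivial)
    (hq : q ∈ timeChartDomain J x₀) :
    chartLieForm (g q.1) (U q.1) x₀ q.2 =
      lieForm (timeChartTensor g x₀) (timeChartDomain J x₀) (timeChartVec U x₀) q := by
  have hS := h.isUnitField hJ hJ' x₀
  have hV := isOpen_extChartAt_target (I := 𝓡 3) x₀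
  rw [chartLieForm, lieForm, ← fderiv_slice hV hq.1 hq.2 (hS.differentiableWithinAt_metric hq),
    ← fderiv_slice hV hq.1 hq.2 (hS.differentiableWithinAt_field hq)]

theorem isRiemannianUnitField (hJ : J.OrdConnected) (hJ' : J.Nontrivial) {t : ℝ} (ht : t ∈ J) :
    IsRiemannianUnitField (g t) (U t) where
  symm := h.symm t ht
  pos := h.pos t ht
  unit := h.unit t ht
  differentiable_metric x₀ y hy :=
    have differentiable := (h.isUnitField hJ hJ' x₀).differentiableWithinAt_metric (p := (t, y))
    have differentiable_mk := (hasFDerivAt_prodMk_right (𝕜 := ℝ) t y).differentiableAt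
    ((differentiable ⟨ht, hy⟩).comp y differentiable_mk.differentiableWithinAt
      fun _ hz => ⟨ht, hz⟩).differentiableAt
        ((isOpen_extChartAt_target (I := 𝓡 3) x₀).mem_nhds hy)
  differentiable_field := h.mdifferentiableFieldAt ht

theorem timeShear_eq_shearNorm (hJ : J.OrdConnected) (hJ' : J.Nontrivial)
    (hq : q ∈ timeChartDomain J x₀) {X Y : E3}
    (hF : IsFrame (timeChartTensor g x₀ q) X Y (timeChartVec U x₀ q)) :
    timeChartFun (timeShear g U) x₀ q =
      shearNorm (lieForm (timeChartTensor g x₀) (timeChartDomain J x₀) (timeChartVec U x₀) q)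
        X Y := by
  rw [← h.chartLieForm_eq_lieForm hJ hJ' hq]
  exact (h.isRiemannianUnitField hJ hJ' hq.1).squaredShear_eq_chart hq.2 hF

end IsEvolvingTriple

end ShearOfTriple

/-! ### Propagation of the vanishing of the shear -/

section DifferentialInequality

variable {w d : ℝ → ℝ} {t C d' : ℝ}

theorem hasDerivWithinAt_exp_mul {s : Set ℝ} (hw : HasDerivWithinAt w d' s t) :
    HasDerivWithinAt (fun r => Real.exp (-C * r) * w r) (Real.exp (-C * t) * (d' - C * w t)) s t :=
  have exp_deriv : HasDerivAt (fun r => Real.exp (-C * r)) (Real.exp (-C * t) * -C) t := by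
    simpa using ((hasDerivAt_id t).const_mul (-C)).exp
  (exp_deriv.hasDerivWithinAt.mul hw).congr_deriv (by ring)

theorem nonpos_of_hasDerivWithinAt_le (ht : 0 ≤ t)
    (hd : ∀ τ ∈ Icc 0 t, HasDerivWithinAt w (d τ) (Icc 0 t) τ)
    (hle : ∀ τ ∈ Icc 0 t, d τ ≤ C * w τ) (h0 : w 0 ≤ 0) : w t ≤ 0 := by
  have weighted_deriv (τ : ℝ) (hτ : τ ∈ Icc 0 t) := hasDerivWithinAt_exp_mul (C := C) (hd τ hτ)
  have antitone : AntitoneOn (fun r => Real.exp (-C * r) * w r) (Icc 0 t) :=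
    antitoneOn_of_hasDerivWithinAt_nonpos (convex_Icc 0 t)
      (fun τ hτ => (weighted_deriv τ hτ).continuousWithinAt)
      (fun τ hτ => (weighted_deriv τ (interior_subset hτ)).mono interior_subset)
      fun τ hτ => mul_nonpos_of_nonneg_of_nonpos (Real.exp_pos _).le
        (sub_nonpos.2 (hle τ (interior_subset hτ)))
  have weighted_le : Real.exp (-C * t) * w t ≤ w 0 := by
    simpa using antitone ⟨le_rfl, ht⟩ ⟨ht, le_rfl⟩ ht
  exact nonpos_of_mul_nonpos_right (weighted_le.trans h0) (Real.exp_pos _)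

theorem mul_le_of_isMaxOn_exp_mul (ht : 0 < t) (hd : HasDerivWithinAt w d' (Icc 0 t) t)
    (hmax : IsMaxOn (fun r => Real.exp (-C * r) * w r) (Icc 0 t) t) : C * w t ≤ d' := by
  have backward_deriv_nonpos := hmax.localize.hasFDerivWithinAt_nonpos
    (hasDerivWithinAt_exp_mul hd).hasFDerivWithinAt
    (mem_posTangentConeAt_of_segment_subset (y := -t) (by
      rw [add_neg_cancel, segment_symm, segment_eq_Icc ht.le]))
  have deriv_nonneg : 0 ≤ t * (Real.exp (-C * t) * (d' - C * w t)) := by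
    simpa using backward_deriv_nonpos
  exact sub_nonneg.1 (nonneg_of_mul_nonneg_right (nonneg_of_mul_nonneg_right deriv_nonneg ht)
    (Real.exp_pos _))

end DifferentialInequality

section Growth

variable {M : Type*} [TopologicalSpace M] [ChartedSpace E3 M] {J : Set ℝ} {f : ℝ → M → ℝ}
  {U : ℝ → ∀ x : M, TangentSpace (𝓡 3) x}
  {W : ℝ → M → ℝ} {t C D : ℝ} {x₀ : M} {q : ℝ × M}

/-- In the chart around `x₀`, the function `W` is differentiable at `q` and its derivative along
`∂_t + fU` is at most `C W`. -/
structure GrowthAt (J : Set ℝ) (f : ℝ → M → ℝ) (U : ℝ → ∀ x : M, TangentSpace (𝓡 3) x)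
    (W : ℝ → M → ℝ) (C : ℝ) (x₀ : M) (q : ℝ × M) : Prop where
  mem_source : q.2 ∈ (extChartAt (𝓡 3) x₀).source
  differentiable :
    DifferentiableWithinAt ℝ (timeChartFun W x₀) (timeChartDomain J x₀) (timeChart x₀ q)
  le : fderivWithin ℝ (timeChartFun W x₀) (timeChartDomain J x₀) (timeChart x₀ q)
    (chartNullField f U x₀ (timeChart x₀ q)) ≤ C * W q.1 q.2

theorem eventually_mem_extChartAt_source {S : Set (ℝ × M)}
    (hx : q.2 ∈ (extChartAt (𝓡 3) x₀).source) :
    ∀ᶠ p in nhdsWithin q S, p.2 ∈ (extChartAt (𝓡 3) x₀).source :=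
  mem_nhdsWithin_of_mem_nhds (continuous_snd.continuousAt.preimage_mem_nhds
    ((isOpen_extChartAt_source x₀).mem_nhds hx))

theorem tendsto_timeChart (hx : q.2 ∈ (extChartAt (𝓡 3) x₀).source) :
    Filter.Tendsto (timeChart x₀) (nhdsWithin q (J ×ˢ univ))
      (nhdsWithin (timeChart x₀ q) (timeChartDomain J x₀)) := by
  have continuousAt_timeChart : ContinuousAt (timeChart x₀) q :=
    continuousAt_fst.prodMk ((continuousAt_extChartAt' hx).comp continuousAt_snd)
  refine tendsto_nhdsWithin_iff.2 ⟨continuousAt_timeChart.continuousWithinAt, ?_⟩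
  filter_upwards [eventually_mem_extChartAt_source hx, self_mem_nhdsWithin] with p hp hpJ
  exact timeChart_mem hpJ.1 hp

namespace GrowthAt

theorem mono (hG : GrowthAt J f U W C x₀ q) (hCD : C ≤ D) (hW : 0 ≤ W q.1 q.2) :
    GrowthAt J f U W D x₀ q :=
  ⟨hG.mem_source, hG.differentiable, hG.le.trans (mul_le_mul_of_nonneg_right hCD hW)⟩

theorem continuousWithinAt (hG : GrowthAt J f U W C x₀ q) :
    ContinuousWithinAt (fun p : ℝ × M => W p.1 p.2) (J ×ˢ univ) q := by
  have chart_tendsto :=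
    hG.differentiable.continuousWithinAt.tendsto.comp (tendsto_timeChart hG.mem_source)
  rw [timeChartFun_timeChart hG.mem_source] at chart_tendsto
  refine chart_tendsto.congr' ?_
  filter_upwards [eventually_mem_extChartAt_source hG.mem_source] with p hp
  exact timeChartFun_timeChart hp W

theorem mul_le_of_isMaxOn (hG : GrowthAt J f U W C x₀ q) (hJ : J.OrdConnected) (h0J : 0 ∈ J)
    (hq : q.1 ∈ J) (hq0 : 0 < q.1) (hslice : ∀ x, W q.1 x ≤ W q.1 q.2)
    (htime : IsMaxOn (fun r => Real.exp (-D * r) * W r q.2) (Icc 0 q.1) q.1) :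
    D * W q.1 q.2 ≤ C * W q.1 q.2 := by
  have left_inv := (extChartAt (𝓡 3) x₀).left_inv hG.mem_source
  have mem_target := (extChartAt (𝓡 3) x₀).map_source hG.mem_source
  have spatialDeriv_eq_zero :
      spatialDeriv (timeChartFun W x₀) (timeChartDomain J x₀) (timeChart x₀ q) = 0 := by
    rw [← fderiv_slice (isOpen_extChartAt_target x₀) hq mem_target hG.differentiable]
    refine IsLocalMax.fderiv_eq_zero (Filter.Eventually.of_forall fun z => ?_)
    simp only [timeChartFun, chartFun, left_inv]
    exact hslice _
  have time_deriv := hasDerivWithinAt_time mem_target hG.differentiable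
  simp only [timeChartFun, chartFun, left_inv] at time_deriv
  have growth_le := hG.le
  rw [chartNullField, fderivWithin_eq_time_add_spatial, spatialDeriv_eq_zero, one_smul, zero_apply,
    add_zero] at growth_le
  exact (mul_le_of_isMaxOn_exp_mul hq0 (time_deriv.mono (hJ.out h0J hq)) htime).trans growth_le

/-- The maximum principle: at a positive maximum of `exp (-(C + 1) t) W` the derivative of `W` along
`U` vanishes, so `W` would grow at a rate of at least `C + 1`. -/
theorem nonpos_of_compactSpace [CompactSpace M] (hJ : J.OrdConnected) (h0J : 0 ∈ J) (ht : t ∈ J)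
    (ht0 : 0 ≤ t) (hG : ∀ q ∈ Icc 0 t ×ˢ univ, ∃ x₀, GrowthAt J f U W C x₀ q)
    (h0 : ∀ x, W 0 x ≤ 0) (x : M) : W t x ≤ 0 := by
  have time_subset : Icc 0 t ⊆ J := hJ.out h0J ht
  have continuous_weighted : ContinuousOn
      (fun q : ℝ × M => Real.exp (-(C + 1) * q.1) * W q.1 q.2) (Icc 0 t ×ˢ univ) := by
    refine ContinuousOn.mul (by fun_prop) fun q hq => ?_
    obtain ⟨x₀, hGq⟩ := hG q hq
    exact hGq.continuousWithinAt.mono (prod_mono_left time_subset)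
  obtain ⟨q, hq, hmax⟩ := (isCompact_Icc.prod isCompact_univ).exists_isMaxOn
    ⟨(t, x), ⟨ht0, le_rfl⟩, mem_univ _⟩ continuous_weighted
  have max_nonpos : W q.1 q.2 ≤ 0 := by
    rcases hq.1.1.eq_or_lt with hq0 | hq0
    · rw [← hq0]
      exact h0 _
    · obtain ⟨x₀, hGq⟩ := hG q hq
      have rate_le := hGq.mul_le_of_isMaxOn (D := C + 1) hJ h0J (time_subset hq.1) hq0
        (fun z => le_of_mul_le_mul_left (hmax (a := (q.1, z)) ⟨hq.1, mem_univ _⟩) (Real.exp_pos _))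
        (fun r hr => hmax (a := (r, q.2)) ⟨⟨hr.1, hr.2.trans hq.1.2⟩, mem_univ _⟩)
      linarith
  have weighted_nonpos : Real.exp (-(C + 1) * t) * W t x ≤ 0 :=
    (hmax (a := (t, x)) ⟨⟨ht0, le_rfl⟩, mem_univ _⟩).trans
      (mul_nonpos_of_nonneg_of_nonpos (Real.exp_pos _).le max_nonpos)
  exact nonpos_of_mul_nonpos_right weighted_nonpos (Real.exp_pos _)

variable [IsManifold (𝓡 3) ∞ M]

theorem nonpos_of_integralCurve {γ : ℝ → ℝ × M} (ht : 0 ≤ t)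
    (hγ : IsMIntegralCurveOn (I := 𝓘(ℝ, ℝ).prod (𝓡 3)) γ (nullField f U) (Icc 0 t))
    (hγJ : ∀ r ∈ Icc 0 t, (γ r).1 ∈ J)
    (hG : ∀ r ∈ Icc 0 t, ∃ x₀, GrowthAt J f U W C x₀ (γ r))
    (h0 : W (γ 0).1 (γ 0).2 ≤ 0) : W (γ t).1 (γ t).2 ≤ 0 := by
  have : Nonempty M := ⟨(γ 0).2⟩
  choose! x₀ hG using hG
  exact nonpos_of_hasDerivWithinAt_le ht (fun r hr => hasDerivWithinAt_comp_of_integralCurve hγ hγJ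
    hr (hG r hr).mem_source (hG r hr).differentiable) (fun r hr => (hG r hr).le) h0

end GrowthAt

theorem fst_of_integralCurve {γ : ℝ → ℝ × M}
    (hγ : IsMIntegralCurveOn (I := 𝓘(ℝ, ℝ).prod (𝓡 3)) γ (nullField f U) (Icc 0 t))
    (h0 : (γ 0).1 = 0) {τ : ℝ} (hτ : τ ∈ Icc 0 t) : (γ τ).1 = τ := by
  have drift_deriv (r : ℝ) (hr : r ∈ Icc 0 t) :
      HasDerivWithinAt (fun r => (γ r).1 - r) 0 (Icc 0 t) r :=
    ((hasDerivWithinAt_time_of_integralCurve hγ hr).sub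
      (hasDerivWithinAt_id r _)).congr_deriv (sub_self _)
  have drift_norm_le := (convex_Icc 0 t).norm_image_sub_le_of_norm_hasDerivWithin_le drift_deriv
    (fun _ _ => norm_zero.le) ⟨le_rfl, hτ.1.trans hτ.2⟩ hτ
  rw [zero_mul, norm_le_zero_iff, h0, sub_zero, sub_zero, sub_eq_zero] at drift_norm_le
  exact drift_norm_le

end Growth

section ShearOfTriple

variable {M : Type*} [TopologicalSpace M] [ChartedSpace E3 M] [IsManifold (𝓡 3) ∞ M]
  {J : Set ℝ} {f : ℝ → M → ℝ}
  {g : ℝ → ∀ x : M, TangentSpace (𝓡 3) x →L[ℝ] TangentSpace (𝓡 3) x →L[ℝ] ℝ}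
  {U : ℝ → ∀ x : M, TangentSpace (𝓡 3) x}
  {T : ℝ → ∀ x : M, TangentSpace (𝓡 3) x →L[ℝ] TangentSpace (𝓡 3) x →L[ℝ] ℝ} {t : ℝ} {x : M}

namespace IsEvolvingTriple

variable (h : IsEvolvingTriple J f g U) (he : Evolves J f g U T) (hQ : QuadCondition J f g U T)
  (hJ : J.OrdConnected) (hJ' : J.Nontrivial)

include h hJ hJ' in
theorem timeShear_nonneg (ht : t ∈ J) (x : M) : 0 ≤ timeShear g U t x :=
  (h.isRiemannianUnitField hJ hJ' ht).squaredShear_nonneg x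

include h he hQ hJ hJ'

theorem eventually_growthAt (ht : t ∈ J) (x₀ : M) :
    ∃ C, ∀ᶠ q in nhdsWithin (t, x₀) (J ×ˢ univ), GrowthAt J f U (timeShear g U) C x₀ q := by
  have hx₀ := mem_extChartAt_source (I := 𝓡 3) x₀
  obtain ⟨C, hC⟩ := (h.isEvolving he hJ hJ' x₀).exists_eventually_shear_le finrank_E3
    (fun _ hp => h.quadAt he hQ hJ hJ' x₀ hp)
    (fun _ hq _ _ hF => h.timeShear_eq_shearNorm hJ hJ' hq hF)
    (timeChart_mem (p := (t, x₀)) ht hx₀)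
  refine ⟨C, ?_⟩
  filter_upwards [(tendsto_timeChart hx₀).eventually hC, eventually_mem_extChartAt_source hx₀]
    with q hq mem_source
  rw [timeChartFun_timeChart mem_source (timeShear g U)] at hq
  exact ⟨mem_source, hq.1, hq.2⟩

theorem exists_growthAt {K : Set (ℝ × M)} (hK : IsCompact K) (hKJ : K ⊆ J ×ˢ univ) :
    ∃ C, ∀ q ∈ K, ∃ x₀, GrowthAt J f U (timeShear g U) C x₀ q := by
  suffices ∃ C, ∀ q ∈ K, q.1 ∈ J → ∃ x₀, GrowthAt J f U (timeShear g U) C x₀ q by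
    obtain ⟨C, hC⟩ := this
    exact ⟨C, fun q hq => hC q hq (hKJ hq).1⟩
  refine hK.induction_on
    (p := fun K => ∃ C, ∀ q ∈ K, q.1 ∈ J → ∃ x₀, GrowthAt J f U (timeShear g U) C x₀ q)
    ⟨0, by simp⟩ ?_ ?_ ?_
  · rintro A B hAB ⟨C, hC⟩
    exact ⟨C, fun q hq => hC q (hAB hq)⟩
  · rintro A B ⟨C, hC⟩ ⟨D, hD⟩
    refine ⟨max C D, ?_⟩
    rintro q (hq | hq) hqJ
    · obtain ⟨x₀, hG⟩ := hC q hq hqJ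
      exact ⟨x₀, hG.mono (le_max_left _ _) (h.timeShear_nonneg hJ hJ' hqJ _)⟩
    · obtain ⟨x₀, hG⟩ := hD q hq hqJ
      exact ⟨x₀, hG.mono (le_max_right _ _) (h.timeShear_nonneg hJ hJ' hqJ _)⟩
  · rintro ⟨t, x₀⟩ hq
    obtain ⟨C, hC⟩ := h.eventually_growthAt he hQ hJ hJ' (hKJ hq).1 x₀
    exact ⟨_, nhdsWithin_mono _ hKJ hC, C, fun q hq _ => ⟨x₀, hq⟩⟩

variable (h0J : 0 ∈ J) (h0 : ∀ x, timeShear g U 0 x = 0) (ht : t ∈ J) (ht0 : 0 ≤ t)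
include h0J h0 ht ht0

theorem timeShear_eq_zero_of_mem_reachedAt (hx : x ∈ reachedAt f U t) :
    timeShear g U t x = 0 := by
  obtain ⟨γ, hγ, hγ0, hγt⟩ := hx
  have hγJ (r : ℝ) (hr : r ∈ Icc 0 t) : (γ r).1 ∈ J := by
    rw [fst_of_integralCurve hγ hγ0 hr]
    exact hJ.out h0J ht hr
  obtain ⟨C, hC⟩ := h.exists_growthAt he hQ hJ hJ'
    (isCompact_Icc.image_of_continuousOn hγ.continuousOn)
    (image_subset_iff.2 fun r hr => ⟨hγJ r hr, mem_univ _⟩)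
  have shear_nonpos := GrowthAt.nonpos_of_integralCurve ht0 hγ hγJ
    (fun r hr => hC (γ r) (mem_image_of_mem γ hr)) (by rw [hγ0, h0])
  rw [hγt] at shear_nonpos
  exact shear_nonpos.antisymm (h.timeShear_nonneg hJ hJ' ht x)

theorem timeShear_eq_zero_of_compactSpace [CompactSpace M] (x : M) : timeShear g U t x = 0 := by
  obtain ⟨C, hC⟩ := h.exists_growthAt he hQ hJ hJ' (isCompact_Icc.prod isCompact_univ)
    (prod_mono_left (hJ.out h0J ht))
  exact (GrowthAt.nonpos_of_compactSpace hJ h0J ht ht0 hC (fun x => (h0 x).le) x).antisymm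
    (h.timeShear_nonneg hJ hJ' ht x)

end IsEvolvingTriple

end ShearOfTriple

end SlicedSpacetime

end

theorem mainTheorem1 {M : Type*} [TopologicalSpace M] [T2Space M] [SecondCountableTopology M]
    [ChartedSpace E3 M] [IsManifold (𝓡 3) ∞ M]
    (J : Set ℝ) (hJ : J.OrdConnected) (hJ' : J.Nontrivial)
    (f : ℝ → M → ℝ)
    (g : ℝ → ∀ x : M, TangentSpace (𝓡 3) x →L[ℝ] TangentSpace (𝓡 3) x →L[ℝ] ℝ)
    (U : ℝ → ∀ x : M, TangentSpace (𝓡 3) x)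
    (T : ℝ → ∀ x : M, TangentSpace (𝓡 3) x →L[ℝ] TangentSpace (𝓡 3) x →L[ℝ] ℝ)
    (htriple : IsEvolvingTriple J f g U)
    (hevol : Evolves J f g U T) :
    (∀ (γ : ℝ → ℝ × M) (s : Set ℝ), s.OrdConnected → s.Nontrivial →
      (∀ τ ∈ s, (γ τ).1 ∈ J) →
      IsMIntegralCurveOn (I := 𝓘(ℝ, ℝ).prod (𝓡 3)) γ (nullField f U) s →
      IsNullGeodesicOn J f g γ s) ∧
    (QuadCondition J f g U T → 0 ∈ J →
      IsTangentToConformalFoliationOn (g 0) (U 0) univ →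
      ∀ t ∈ J, 0 ≤ t →
        IsTangentToConformalFoliationOn (g t) (U t) (reachedAt f U t) ∧
        (CompactSpace M → IsTangentToConformalFoliationOn (g t) (U t) univ)) := by
  refine ⟨fun γ s hs hs' hsJ hγ => htriple.isNullGeodesicOn hγ hsJ
    (uniqueDiffOn_of_ordConnected hs hs') hevol hJ hJ', fun hquad h0J hconformal t ht ht0 => ?_⟩
  have initial_shear (x : M) : timeShear g U 0 x = 0 :=
    (htriple.isRiemannianUnitField hJ hJ' h0J).isTangentToConformalFoliationOn_iff.1 hconformal x
      (mem_univ x)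
  have conformal_iff (A : Set M) :=
    (htriple.isRiemannianUnitField hJ hJ' ht).isTangentToConformalFoliationOn_iff (A := A)
  exact ⟨(conformal_iff _).2 fun x hx => htriple.timeShear_eq_zero_of_mem_reachedAt hevol hquad
      hJ hJ' h0J initial_shear ht ht0 hx,
    fun _ => (conformal_iff _).2 fun x _ => htriple.timeShear_eq_zero_of_compactSpace hevol hquad
      hJ hJ' h0J initial_shear ht ht0 x⟩
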